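/- \textbf{Notation.} Let $J\in\mathbb C$ with $J^2+J+1=0$, let $J_0$ satisfy $J=-1/J_0^2$, and put $j=J_0^2=-J^2$ (so $j^2-j+1=0$). $E_{ik}$ ($i,k\in\{0,1,2\}$) are the elementary $3\times3$ matrices, $P$ is the permutation of $\mathbb C^3\otimes\mathbb C^3$, and $\check R=PR$. For $\phi,\xi\neq0$ let $\upsilon$ be defined by $-4\xi\upsilon=\phi^2-\phi\psi+\psi^2$ and let \begin{align*} H_{GB}(\phi,\psi,\xi)={}&-\upsilon(E_{00}\otimes E_{00}+E_{22}\otimes E_{22})-(\upsilon+J^2\xi)E_{00}\otimes E_{22}+(\upsilon-\xi)E_{11}\otimes E_{11}-(\upsilon+J\xi)E_{22}\otimes E_{00}\\ &+\xi(E_{02}\otimes E_{20}+E_{20}\otimes E_{02})+\psi(E_{10}\otimes E_{01}+E_{12}\otimes E_{21})+\phi(E_{01}\otimes E_{10}+E_{21}\otimes E_{12})\\ &+\phi E_{01}\otimes E_{21}-J\phi E_{21}\otimes E_{01}-J^2(\psi-\tfrac{\xi^2}{\phi})E_{10}\otimes E_{12}+(\psi-\tfrac{\xi^2}{\phi})E_{12}\otimes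 E_{10} \end{align*} be the generalized Bariev Hamiltonian. A nineteen-vertex operator with weights $a,b,\bar b,c,d,\bar d,f,g,h,\bar h$ is \begin{align*} &a(E_{00}\otimes E_{00}+E_{22}\otimes E_{22})+b(E_{00}\otimes E_{11}+E_{22}\otimes E_{11})+\bar b(E_{11}\otimes E_{00}+E_{11}\otimes E_{22})+f(E_{00}\otimes E_{22}+E_{22}\otimes E_{00})+gE_{11}\otimes E_{11}\\ &+c(E_{01}\otimes E_{10}+E_{10}\otimes E_{01}+E_{12}\otimes E_{21}+E_{21}\otimes E_{12})+hE_{02}\otimes E_{20}+\bar hE_{20}\otimes E_{02}+d(E_{01}\otimes E_{21}+E_{12}\otimes E_{10})+\bar d(E_{10}\otimes E_{12}+E_{21}\otimes E_{01}). \end{align*} \textbf{Main branch.} Let $\beta\ne0$, $J_0^2\eta^2=\alpha\beta-1$, $q=a^4+a^2b^2+b^4$. The main-branch curve is $$(\alpha\beta-1)q^2+(2-\alpha\beta+\alpha^2+\beta^2)(\beta q+ab)ab-(\alpha\beta-2)a^4+\beta^2a^2b^2-(2-\alpha\beta+\beta^2)b^4-2\beta ab-1=0 ,$$ and its Lax operator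 $L(a,b)$ is the nineteen-vertex operator with weights $a$, $b$, $c=1$, $$\bar b=\frac{\beta b^3+a(1-(\alpha-\beta)ab-q)}{\beta q+2ab},\quad f=\frac{a^4+(1+\beta^2)a^2b^2+(\alpha\beta-1)b^4+(\alpha-\beta)ab-1}{\beta^2a^3+(\alpha\beta-2)ab^2+\beta b},$$ $$d=\eta(b^2-af),\quad \bar d=jd,\quad g=\frac{1-b\bar b+(\alpha\beta-1)(b^2-af)^2}{a+f},\quad h=a+j^{-1}f,\quad \bar h=a+jf .$$ Writing $a_x,b_x,\dots$ for the weights of $L(a(x),b(x))$, the main-branch $R$-matrix $R(x,y)$ is the nineteen-vertex operator with weights $r_c=1$ and $$r_{\bar b}=\bar b_xa_y-a_x\bar b_y,\quad r_a=\frac{a_x+r_{\bar b}b_y}{a_y},\quad r_b=\frac{r_ab_x-b_y}{a_x},\quad r_d=\frac{r_{\bar b}d_xa_y}{\Delta},\quad r_f=\frac{r_{\bar b}a_y(f_xa_y-\bar b_x\bar b_y)}{\Delta},$$ $$r_g=\frac{r_{\bar b}g_x+\bar b_y-j\,r_dd_xb_y}{\bar b_x},\quad r_{\bar d}=jr_d,\quad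 r_h=r_a+j^{-1}r_f,\quad r_{\bar h}=r_a+jr_f,\qquad \Delta=\bar b_x+b_y(f_xa_y-\bar b_x\bar b_y).$$ The special point $x_0$ is $a=1$, $b=0$; a point of the curve is called generic if it is a nonsingular point with $a\neq0$, $a+f\ne0$, $\bar b\ne0$, $\beta q+2ab\neq0$, $\beta^2a^3+(\alpha\beta-2)ab^2+\beta b\ne0$ and $\Delta|_{x=y}\neq0$. \textbf{Special branch.} Let $n(z)=a(z)^2+jb(z)^2$. The special-branch curve is $(a^2+jb^2)(a^4+a^2b^2+b^4+\Lambda_4ab)+b^2-a^2=0$, and its $R$-matrix is the nineteen-vertex operator with weights $r_c=1$ and $$r_a=\frac{a(x)a(y)}{n(y)}+\frac{jb(x)b(y)}{n(x)},\quad r_b=\frac{b(x)a(y)}{n(y)}-\frac{a(x)b(y)}{n(x)},\quad r_{\bar b}=\frac{jb(x)a(y)}{n(x)}-\frac{ja(x)b(y)}{n(y)},$$ $$r_d=j\frac{b(x)a(y)n(y)-a(x)b(y)n(x)}{ja(x)a(y)+b(x)b(y)n(x)n(y)},\quad r_f=r_d\,\frac{b(x)a(y)n(x)n(y)-j^2a(x)b(y)}{n(x)n(y)},\quad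 r_g(x,y)=r_f(y,x)+r_a(y,x),$$ $r_{\bar d}=jr_d$, $r_h=r_a+j^{-1}r_f$, $r_{\bar h}=r_a+jr_f$. A point of the curve is called generic if $n\ne0$ and $ja^2+b^2n^2\neq0$ there. In all cases $z\mapsto(a(z),b(z))$ is an analytic local parametrization of the curve in question. \textbf{Statement.} (1) (Main branch, special point.) If $a\ne0$ and $\bar b(a,b)\neq0$, then the main-branch $R$-matrix whose first argument has coordinates $(a,b)$ and whose second argument is $x_0$ equals $L(a,b)$. If $\alpha^2-\alpha\beta+\beta^2\ne0$ and $\rho=4/(\alpha^2-\alpha\beta+\beta^2)$, then $P\,\partial_xL(x)|_{x=x_0}=a'(x_0)H_{MB_0}$ for every parametrization through $x_0$, every value of $a'(x_0)$ occurs, and \begin{align*} H_{MB_0}={}&E_{00}\otimes E_{00}+E_{22}\otimes E_{22}+(1+J_0^2\rho)E_{00}\otimes E_{22}-(1+\rho)E_{11}\otimes E_{11}+(1+J_0^{-2}\rho)E_{22}\otimes E_{00}\\ &+\rho(E_{02}\otimes E_{20}+E_{20}\otimes E_{02})-\alpha\rho(E_{10}\otimes E_{01}+E_{12}\otimes E_{21})-\beta\rho(E_{01}\otimes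 E_{10}+E_{21}\otimes E_{12})\\ &-J_0^2\eta\rho(E_{01}\otimes E_{21}+E_{10}\otimes E_{12})-\eta\rho(E_{21}\otimes E_{01}+E_{12}\otimes E_{10}). \end{align*} If $\phi,\xi,\upsilon\neq0$ and $\phi\psi\ne\xi^2$, then with $\alpha=-\psi/\xi$, $\beta=-\phi/\xi$, $J_0^2\eta^2=\alpha\beta-1$ and $g=\mathrm{diag}(1,s,1)$, $s^2=J_0^2\eta/\beta$, $$H_{GB}(\phi,\psi,\xi)=(g\otimes g)\,(-\upsilon H_{MB_0})\,(g\otimes g)^{-1}.$$ (2) (Main branch and special branch, generic point.) For each of the two branches, at every generic point $z_0$ of the curve and for every parametrization, $\check R(z_0,z_0)=\mathbb I$ and $H=\partial_x\check R(x,z_0)|_{x=z_0}$ exists. If the coefficients $\phi,\xi,\kappa$ of $H$ on $E_{01}\otimes E_{10}$, $E_{02}\otimes E_{20}$, $E_{01}\otimes E_{21}$ are nonzero and $\psi$ is its coefficient on $E_{10}\otimes E_{01}$, then for every $s$ with $s^2=\kappa/\phi$ and $g=\mathrm{diag}(1,s,1)$, $$(g\otimes g)\,H\,(g\otimes g)^{-1}=H_{GB}(\phi,\psi,\xi).$$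 (3) (Both branches generate the same Hamiltonian.) Let $\phi,\psi,\xi\neq0$, $\phi\ne\psi$, $\phi^2-\phi\psi+\psi^2\neq0$, $\phi\psi\neq\xi^2$ and $(\psi-j\phi)^2+4j\xi^2\ne0$. Then $H_{GB}(\phi,\psi,\xi)$ is equal, up to conjugation by some $g\otimes g$ with $g=\mathrm{diag}(1,s,1)$, $s\ne0$, to the Hamiltonian $P\,\partial_xL(x)|_{x=x_0}$ of some main branch at the special point $x_0$, to the Hamiltonian $\partial_x\check R(x,y)|_{x=y}$ of some main branch at a generic point, and to the Hamiltonian $\partial_x\check R(x,y)|_{x=y}$ of some special branch at a generic point. -/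

import Mathlib

open scoped Kronecker Topology

noncomputable section

namespace Bariev

/-- Operators on the two-site space `ℂ³ ⊗ ℂ³`; the basis vector `|i⟩ ⊗ |k⟩` has index `(i, k)`. -/
abbrev TwoSite : Type := Matrix (Fin 3 × Fin 3) (Fin 3 × Fin 3) ℂ

/-- `EE i j k l` is the operator `E_{ij} ⊗ E_{kl}`. -/
def EE (i j k l : Fin 3) : TwoSite :=
  Matrix.single i j (1 : ℂ) ⊗ₖ Matrix.single k l (1 : ℂ)

/-- The permutation operator `P (u ⊗ v) = v ⊗ u`. -/
def perm : TwoSite :=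
  Matrix.of fun r c => if r.1 = c.2 ∧ r.2 = c.1 then 1 else 0

/-- Entrywise derivative of a family of two-site operators. -/
def HasOpDerivAt (M : ℂ → TwoSite) (H : TwoSite) (z₀ : ℂ) : Prop :=
  ∀ r c, HasDerivAt (fun z => M z r c) (H r c) z₀

/-- Conjugation of a two-site operator by `g ⊗ g`, where `g = diag(1, s, 1)`. -/
def twist (s : ℂ) (H : TwoSite) : TwoSite :=
  (Matrix.diagonal ![1, s, 1] ⊗ₖ Matrix.diagonal ![1, s, 1]) * H *
    (Matrix.diagonal ![1, s, 1] ⊗ₖ Matrix.diagonal ![1, s, 1])⁻¹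

/-! ### The generalized Bariev Hamiltonian -/

/-- The number `υ` fixed by `-4 ξ υ = φ² - φ ψ + ψ²`. -/
def upsilon (φ ψ ξ : ℂ) : ℂ := -(φ ^ 2 - φ * ψ + ψ ^ 2) / (4 * ξ)

/-- The generalized Bariev two-site Hamiltonian `H_GB`. -/
def HGB (J φ ψ ξ : ℂ) : TwoSite :=
  (-upsilon φ ψ ξ) • (EE 0 0 0 0 + EE 2 2 2 2)
    + (-upsilon φ ψ ξ - J ^ 2 * ξ) • EE 0 0 2 2
    + (upsilon φ ψ ξ - ξ) • EE 1 1 1 1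
    + (-upsilon φ ψ ξ - J * ξ) • EE 2 2 0 0
    + ξ • (EE 0 2 2 0 + EE 2 0 0 2)
    + ψ • (EE 1 0 0 1 + EE 1 2 2 1)
    + φ • (EE 0 1 1 0 + EE 2 1 1 2)
    + φ • EE 0 1 2 1
    + (-J * φ) • EE 2 1 0 1
    + (-J ^ 2 * (ψ - ξ ^ 2 / φ)) • EE 1 0 1 2
    + (ψ - ξ ^ 2 / φ) • EE 1 2 1 0

/-! ### Nineteen-vertex operators -/

/-- The Boltzmann weights of a nineteen-vertex operator; `b'`, `d'`, `h'` stand for the barred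
weights. -/
structure Weights where
  a : ℂ
  b : ℂ
  b' : ℂ
  c : ℂ
  d : ℂ
  d' : ℂ
  f : ℂ
  g : ℂ
  h : ℂ
  h' : ℂ

/-- The (non-braided) nineteen-vertex operator with given weights. -/
def vertexOp (w : Weights) : TwoSite :=
  w.a • (EE 0 0 0 0 + EE 2 2 2 2)
    + w.b • (EE 0 0 1 1 + EE 2 2 1 1)
    + w.b' • (EE 1 1 0 0 + EE 1 1 2 2)
    + w.f • (EE 0 0 2 2 + EE 2 2 0 0)
    + w.g • EE 1 1 1 1
    + w.c • (EE 0 1 1 0 + EE 1 0 0 1 + EE 1 2 2 1 + EE 2 1 1 2)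
    + w.h • EE 0 2 2 0
    + w.h' • EE 2 0 0 2
    + w.d • (EE 0 1 2 1 + EE 1 2 1 0)
    + w.d' • (EE 1 0 1 2 + EE 2 1 0 1)

/-- The braided operator `P R`. -/
def braided (w : Weights) : TwoSite := perm * vertexOp w

/-- `(a(z), b(z))` is an analytic local parametrization of the plane curve `F = 0` near `z₀`. -/
def LocalParam (F : ℂ → ℂ → ℂ) (a b : ℂ → ℂ) (z₀ : ℂ) : Prop :=
  AnalyticAt ℂ a z₀ ∧ AnalyticAt ℂ b z₀ ∧ ∀ᶠ z in 𝓝 z₀, F (a z) (b z) = 0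

/-- The partial derivatives of `F` at `(a, b)` do not both vanish. -/
def RegularPoint (F : ℂ → ℂ → ℂ) (a b : ℂ) : Prop :=
  deriv (fun x => F x b) a ≠ 0 ∨ deriv (fun y => F a y) b ≠ 0

/-! ### The main branch -/

/-- The polynomial of the main-branch curve. -/
def mbCurve (α β a b : ℂ) : ℂ :=
  (α * β - 1) * (a ^ 4 + a ^ 2 * b ^ 2 + b ^ 4) ^ 2
    + (2 - α * β + α ^ 2 + β ^ 2) * (β * (a ^ 4 + a ^ 2 * b ^ 2 + b ^ 4) + a * b) * (a * b)
    - (α * β - 2) * a ^ 4 + β ^ 2 * a ^ 2 * b ^ 2 - (2 - α * β + β ^ 2) * b ^ 4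
    - 2 * β * a * b - 1

/-- Denominator of the weight `b'` of the main-branch Lax operator. -/
def mbDenB (β a b : ℂ) : ℂ := β * (a ^ 4 + a ^ 2 * b ^ 2 + b ^ 4) + 2 * a * b

/-- Denominator of the weight `f` of the main-branch Lax operator. -/
def mbDenF (α β a b : ℂ) : ℂ := β ^ 2 * a ^ 3 + (α * β - 2) * a * b ^ 2 + β * b

/-- The weight `b'` of the main-branch Lax operator. -/
def mbB (α β a b : ℂ) : ℂ :=
  (β * b ^ 3 + a * (1 - (α - β) * a * b - (a ^ 4 + a ^ 2 * b ^ 2 + b ^ 4))) / mbDenB β a b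

/-- The weight `f` of the main-branch Lax operator. -/
def mbF (α β a b : ℂ) : ℂ :=
  (a ^ 4 + (1 + β ^ 2) * a ^ 2 * b ^ 2 + (α * β - 1) * b ^ 4 + (α - β) * a * b - 1)
    / mbDenF α β a b

/-- The Lax operator of the main branch in terms of a point `(a, b)` of the curve, with `c = 1`;
here `η` is a square root of `(α β - 1) / J₀²`, and `J₀² = j` satisfies `j² - j + 1 = 0`. -/
def mbLax (J₀ α β η a b : ℂ) : Weights where
  a := a
  b := b
  b' := mbB α β a b
  c := 1
  d := η * (b ^ 2 - a * mbF α β a b)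
  d' := J₀ ^ 2 * (η * (b ^ 2 - a * mbF α β a b))
  f := mbF α β a b
  g := (1 - b * mbB α β a b + (α * β - 1) * (b ^ 2 - a * mbF α β a b) ^ 2)
    / (a + mbF α β a b)
  h := a + (J₀ ^ 2)⁻¹ * mbF α β a b
  h' := a + J₀ ^ 2 * mbF α β a b

/-! The next definitions give the entries of the `R`-matrix in terms of two Lax operators `X`, `Y`
with `X.c = Y.c = 1`. They are the solution, normalized by `R.c = 1`, of the intertwining relation
`R₁₂ L₁(x) L₂(y) = L₂(y) L₁(x) R₁₂`. -/

def rB' (X Y : Weights) : ℂ := X.b' * Y.a - X.a * Y.b'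

def rA (X Y : Weights) : ℂ := (X.a + rB' X Y * Y.b) / Y.a

def rB (X Y : Weights) : ℂ := (rA X Y * X.b - Y.b) / X.a

def rDen (X Y : Weights) : ℂ := X.b' + Y.b * (X.f * Y.a - X.b' * Y.b')

def rD (X Y : Weights) : ℂ := rB' X Y * X.d * Y.a / rDen X Y

def rF (X Y : Weights) : ℂ := rB' X Y * Y.a * (X.f * Y.a - X.b' * Y.b') / rDen X Y

def rG (J₀ : ℂ) (X Y : Weights) : ℂ :=
  (rB' X Y * X.g + Y.b' - J₀ ^ 2 * rD X Y * X.d * Y.b) / X.b'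

/-- The intertwiner of two Lax operators. -/
def intertwiner (J₀ : ℂ) (X Y : Weights) : Weights where
  a := rA X Y
  b := rB X Y
  b' := rB' X Y
  c := 1
  d := rD X Y
  d' := J₀ ^ 2 * rD X Y
  f := rF X Y
  g := rG J₀ X Y
  h := rA X Y + (J₀ ^ 2)⁻¹ * rF X Y
  h' := rA X Y + J₀ ^ 2 * rF X Y

/-- The main-branch `R`-matrix `R(x, y)`, where `(a₁, b₁) = (a(x), b(x))` and
`(a₂, b₂) = (a(y), b(y))`. -/
def mbR (J₀ α β η a₁ b₁ a₂ b₂ : ℂ) : Weights :=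
  intertwiner J₀ (mbLax J₀ α β η a₁ b₁) (mbLax J₀ α β η a₂ b₂)

/-- Generic points of the main-branch curve: regular points at which no denominator in the Lax
operator or in the `R`-matrix on the diagonal `x = y` vanishes. -/
def MBGeneric (J₀ α β η a b : ℂ) : Prop :=
  a ≠ 0 ∧ RegularPoint (mbCurve α β) a b ∧ mbDenB β a b ≠ 0 ∧ mbDenF α β a b ≠ 0 ∧
    a + mbF α β a b ≠ 0 ∧ mbB α β a b ≠ 0 ∧
    rDen (mbLax J₀ α β η a b) (mbLax J₀ α β η a b) ≠ 0

/-- The main-branch Hamiltonian at the special point, normalized by `a'(x₀) = 1`;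
`ρ = 4 / (α² - α β + β²)`. -/
def HMB0 (J₀ α β η : ℂ) : TwoSite :=
  let ρ : ℂ := 4 / (α ^ 2 - α * β + β ^ 2)
  (EE 0 0 0 0 + EE 2 2 2 2)
    + (1 + J₀ ^ 2 * ρ) • EE 0 0 2 2
    + (-1 - ρ) • EE 1 1 1 1
    + (1 + (J₀ ^ 2)⁻¹ * ρ) • EE 2 2 0 0
    + ρ • (EE 0 2 2 0 + EE 2 0 0 2)
    + (-α * ρ) • (EE 1 0 0 1 + EE 1 2 2 1)
    + (-β * ρ) • (EE 0 1 1 0 + EE 2 1 1 2)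
    + (-J₀ ^ 2 * η * ρ) • (EE 0 1 2 1 + EE 1 0 1 2)
    + (-η * ρ) • (EE 2 1 0 1 + EE 1 2 1 0)

/-- `H = P L'(z₀)` for the main-branch Lax operator along a parametrization that passes through
the special point `a(z₀) = 1`, `b(z₀) = 0` with velocity `a'(z₀) = v`. -/
def MBSpecialHam (J₀ α β η v : ℂ) (H : TwoSite) : Prop :=
  ∃ (a b : ℂ → ℂ) (z₀ : ℂ), LocalParam (mbCurve α β) a b z₀ ∧ a z₀ = 1 ∧ b z₀ = 0 ∧
    deriv a z₀ = v ∧ HasOpDerivAt (fun z => braided (mbLax J₀ α β η (a z) (b z))) H z₀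

/-- `H = ∂ₓ Ř(x, y)` at `x = y = z₀` for the main-branch `R`-matrix along a parametrization
of the curve. -/
def MBDeriv (J₀ α β η : ℂ) (a b : ℂ → ℂ) (z₀ : ℂ) (H : TwoSite) : Prop :=
  HasOpDerivAt (fun z => braided (mbR J₀ α β η (a z) (b z) (a z₀) (b z₀))) H z₀

/-! ### The special branch -/

/-- The polynomial of the special-branch curve. -/
def sbCurve (j Λ₄ a b : ℂ) : ℂ :=
  (a ^ 2 + j * b ^ 2) * (a ^ 4 + a ^ 2 * b ^ 2 + b ^ 4 + Λ₄ * a * b) + b ^ 2 - a ^ 2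

def sbN (j a b : ℂ) : ℂ := a ^ 2 + j * b ^ 2

def sbA (j a₁ b₁ a₂ b₂ : ℂ) : ℂ := a₁ * a₂ / sbN j a₂ b₂ + j * b₁ * b₂ / sbN j a₁ b₁

def sbD (j a₁ b₁ a₂ b₂ : ℂ) : ℂ :=
  j * ((b₁ * a₂ * sbN j a₂ b₂ - a₁ * b₂ * sbN j a₁ b₁)
    / (j * a₁ * a₂ + b₁ * b₂ * sbN j a₁ b₁ * sbN j a₂ b₂))

def sbF (j a₁ b₁ a₂ b₂ : ℂ) : ℂ :=
  sbD j a₁ b₁ a₂ b₂ *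
    ((b₁ * a₂ * sbN j a₁ b₁ * sbN j a₂ b₂ - j ^ 2 * a₁ * b₂) / (sbN j a₁ b₁ * sbN j a₂ b₂))

/-- The special-branch `R`-matrix `R(x, y)`, where `(a₁, b₁) = (a(x), b(x))` and
`(a₂, b₂) = (a(y), b(y))`. The weight `g` is `-r_d(x,y) (r_f(y,x) + r_a(y,x)) / r_d(y,x)`, in
which the factor `-r_d(x,y) / r_d(y,x)` is identically `1` and has been cancelled, so that the
formula also makes sense at `x = y`. -/
def sbR (j a₁ b₁ a₂ b₂ : ℂ) : Weights where
  a := sbA j a₁ b₁ a₂ b₂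
  b := b₁ * a₂ / sbN j a₂ b₂ - a₁ * b₂ / sbN j a₁ b₁
  b' := j * b₁ * a₂ / sbN j a₁ b₁ - j * a₁ * b₂ / sbN j a₂ b₂
  c := 1
  d := sbD j a₁ b₁ a₂ b₂
  d' := j * sbD j a₁ b₁ a₂ b₂
  f := sbF j a₁ b₁ a₂ b₂
  g := sbF j a₂ b₂ a₁ b₁ + sbA j a₂ b₂ a₁ b₁
  h := sbA j a₁ b₁ a₂ b₂ + j⁻¹ * sbF j a₁ b₁ a₂ b₂
  h' := sbA j a₁ b₁ a₂ b₂ + j * sbF j a₁ b₁ a₂ b₂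

/-- Generic points of the special-branch curve: no denominator of the `R`-matrix vanishes on the
diagonal `x = y`. -/
def SBGeneric (j a b : ℂ) : Prop :=
  sbN j a b ≠ 0 ∧ j * a ^ 2 + b ^ 2 * sbN j a b ^ 2 ≠ 0

/-- `H = ∂ₓ Ř(x, y)` at `x = y = z₀` for the special-branch `R`-matrix along a parametrization
of the curve. -/
def SBDeriv (j : ℂ) (a b : ℂ → ℂ) (z₀ : ℂ) (H : TwoSite) : Prop :=
  HasOpDerivAt (fun z => braided (sbR j (a z) (b z) (a z₀) (b z₀))) H z₀

/-! ### Comparison with the generalized Bariev Hamiltonian -/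

/-- `H` is, up to a twist by `g ⊗ g` with `g = diag(1, s, 1)`, the generalized Bariev Hamiltonian
whose parameters `φ`, `ψ`, `ξ` are the entries of `H` at `E₀₁ ⊗ E₁₀`, `E₁₀ ⊗ E₀₁`, `E₀₂ ⊗ E₂₀`. The
number `s²` is the quotient of the entries at `E₀₁ ⊗ E₂₁` and `E₀₁ ⊗ E₁₀`, and any of its square
roots may be taken. -/
def TwistsToHGB (J : ℂ) (H : TwoSite) : Prop :=
  ∀ s : ℂ, s ^ 2 = H (0, 2) (1, 1) / H (0, 1) (1, 0) →
    twist s H = HGB J (H (0, 1) (1, 0)) (H (1, 0) (0, 1)) (H (0, 2) (2, 0))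

/-- The entries of `H` at `E₀₁ ⊗ E₁₀`, `E₀₂ ⊗ E₂₀` and `E₀₁ ⊗ E₂₁` do not vanish. -/
def NonzeroEntries (H : TwoSite) : Prop :=
  H (0, 1) (1, 0) ≠ 0 ∧ H (0, 2) (2, 0) ≠ 0 ∧ H (0, 2) (1, 1) ≠ 0

end Bariev

end

noncomputable section

namespace Bariev
/-! ### Entries of two-site operators -/

/-! Each Hamiltonian in question is `braided w`, where w lists the derivatives of the ten weights.
Suppose c = 0, d' = jd, h = a + f/j and h' = a + jf. Conjugation by g ⊗ g then rescales only the
entries carrying d and d', and `twist_braided_eq_HGB` shows that (with b', f, d' nonzero) the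
operator is a twisted H_GB with φ = b', ψ = b, ξ = f, υ = -a as soon as g + a + f = 0, j d² = b'b -
f² and 4fa = b'² - b'b + b². These conditions form `BarievRel`. What remains is to verify them on
each branch and to solve for the parameters when φ, ψ, ξ are prescribed.

Main branch: put B = b' and m = b² - af. The curve equation yields the polynomial relations `MBRel`
between a, b, B, m. On the diagonal the weight r_b' vanishes, and it is a factor of r_d and r_f;
hence the derivative of the R-matrix involves only the velocities of a, b and B. The tangent line
contains the explicit vector (`tanA`, `tanB`), scaled so that aB' - a'B, which is the entry φ,
equals 4βΔ on it (`denB_identity`, `MBRel.tangent`). So every entry is φ times a rational function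
of a, b, B, m, and the three conditions become `weightG_identity`, `psi_identity` and
`quartic_identity`, consequences of `MBRel`.

Special branch: the entries are expressed through n, its differential `dN` and the numerators `sbU`,
`sbS`. The condition on g holds by construction, and the other two are `sb_psi_identity` and
`sb_quadric_identity`, which follow from the curve equation and its differential.

Realization: at the special point α = -ψ/ξ and β = -φ/ξ can be read off. On the main branch a
generic point with b = 0 suffices. On the special branch n is a root of a quadratic equation, and
the discriminant hypothesis says that its roots are distinct. In the generic cases the curve is
regular at the chosen point, so a parametrization with suitable velocity gives the prescribed φ. -/

lemma EE_apply (i j k l : Fin 3) (r c : Fin 3 × Fin 3) :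
    EE i j k l r c = if (i = r.1 ∧ j = c.1) ∧ (k = r.2 ∧ l = c.2) then 1 else 0 := by
  simp only [EE, Matrix.kroneckerMap_apply, Matrix.single_apply]
  split_ifs <;> simp_all

lemma perm_mul_apply (M : TwoSite) (r c : Fin 3 × Fin 3) :
    (perm * M) r c = M (r.2, r.1) c := by
  rw [Matrix.mul_apply, Finset.sum_eq_single (r.2, r.1)]
  · simp [perm]
  · intro x _ hx
    have : ¬(r.1 = x.2 ∧ r.2 = x.1) := fun h => hx (Prod.ext h.2.symm h.1.symm)
    simp [perm, this]
  · simp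

lemma twist_apply {s : ℂ} (hs : s ≠ 0) (H : TwoSite) (r c : Fin 3 × Fin 3) :
    twist s H r c = ((![1, s, 1] : Fin 3 → ℂ) r.1 * (![1, s, 1] : Fin 3 → ℂ) r.2) * H r c *
      ((![1, s, 1] : Fin 3 → ℂ) c.1 * (![1, s, 1] : Fin 3 → ℂ) c.2)⁻¹ := by
  have hv : ∀ i, (![1, s, 1] : Fin 3 → ℂ) i ≠ 0 := by
    intro i; fin_cases i <;> simp [hs]
  set v : Fin 3 → ℂ := ![1, s, 1]
  have hinv : (Matrix.diagonal (fun p : Fin 3 × Fin 3 => v p.1 * v p.2))⁻¹ =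
      Matrix.diagonal (fun p : Fin 3 × Fin 3 => (v p.1 * v p.2)⁻¹) := by
    apply Matrix.inv_eq_right_inv
    rw [Matrix.diagonal_mul_diagonal, ← Matrix.diagonal_one]
    congr 1
    funext p
    exact mul_inv_cancel₀ (mul_ne_zero (hv _) (hv _))
  rw [twist, Matrix.diagonal_kronecker_diagonal, hinv, Matrix.mul_diagonal, Matrix.diagonal_mul]

lemma braided_eq (w : Weights) :
    braided w = w.a • (perm * (EE 0 0 0 0 + EE 2 2 2 2))
      + w.b • (perm * (EE 0 0 1 1 + EE 2 2 1 1))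
      + w.b' • (perm * (EE 1 1 0 0 + EE 1 1 2 2))
      + w.f • (perm * (EE 0 0 2 2 + EE 2 2 0 0))
      + w.g • (perm * EE 1 1 1 1)
      + w.c • (perm * (EE 0 1 1 0 + EE 1 0 0 1 + EE 1 2 2 1 + EE 2 1 1 2))
      + w.h • (perm * EE 0 2 2 0)
      + w.h' • (perm * EE 2 0 0 2)
      + w.d • (perm * (EE 0 1 2 1 + EE 1 2 1 0))
      + w.d' • (perm * (EE 1 0 1 2 + EE 2 1 0 1)) := by
  simp only [braided, vertexOp, mul_add, mul_smul_comm]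

/-! ### Differentiating families of weights -/

/-- Derivative of a family of weights. -/
structure HasWeightDerivAt (w : ℂ → Weights) (w' : Weights) (z : ℂ) : Prop where
  a : HasDerivAt (fun z => (w z).a) w'.a z
  b : HasDerivAt (fun z => (w z).b) w'.b z
  b' : HasDerivAt (fun z => (w z).b') w'.b' z
  c : HasDerivAt (fun z => (w z).c) w'.c z
  d : HasDerivAt (fun z => (w z).d) w'.d z
  d' : HasDerivAt (fun z => (w z).d') w'.d' z
  f : HasDerivAt (fun z => (w z).f) w'.f z
  g : HasDerivAt (fun z => (w z).g) w'.g z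
  h : HasDerivAt (fun z => (w z).h) w'.h z
  h' : HasDerivAt (fun z => (w z).h') w'.h' z

lemma HasWeightDerivAt.braided {w : ℂ → Weights} {w' : Weights} {z : ℂ}
    (H : HasWeightDerivAt w w' z) : HasOpDerivAt (fun z => braided (w z)) (braided w') z := by
  intro r c
  simp only [braided_eq, Matrix.add_apply, Matrix.smul_apply, smul_eq_mul]
  exact (((((((((H.a.mul_const _).add (H.b.mul_const _)).add (H.b'.mul_const _)).add
    (H.f.mul_const _)).add (H.g.mul_const _)).add (H.c.mul_const _)).add (H.h.mul_const _)).add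
    (H.h'.mul_const _)).add (H.d.mul_const _)).add (H.d'.mul_const _)

lemma HasOpDerivAt.unique {M : ℂ → TwoSite} {H₁ H₂ : TwoSite} {z : ℂ}
    (h₁ : HasOpDerivAt M H₁ z) (h₂ : HasOpDerivAt M H₂ z) : H₁ = H₂ := by
  ext r c
  exact (h₁ r c).unique (h₂ r c)

/-- The weights of the permutation operator. -/
def permWeights : Weights := ⟨1, 0, 0, 1, 0, 0, 0, 1, 1, 1⟩

/-- Since P² = 1, an R-matrix that reduces to P on the diagonal has trivial braided form there. -/
lemma braided_permWeights : braided permWeights = 1 := by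
  ext ⟨i, k⟩ ⟨j, l⟩
  rw [braided, perm_mul_apply]
  fin_cases i <;> fin_cases k <;> fin_cases j <;> fin_cases l <;>
    simp [vertexOp, permWeights, EE_apply]

section entries

variable (w : Weights)

lemma braided_entry_b' : braided w (0, 1) (1, 0) = w.b' := by
  rw [braided, perm_mul_apply]; simp [vertexOp, EE_apply]

lemma braided_entry_b : braided w (1, 0) (0, 1) = w.b := by
  rw [braided, perm_mul_apply]; simp [vertexOp, EE_apply]

lemma braided_entry_f : braided w (0, 2) (2, 0) = w.f := by
  rw [braided, perm_mul_apply]; simp [vertexOp, EE_apply]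

lemma braided_entry_d' : braided w (0, 2) (1, 1) = w.d' := by
  rw [braided, perm_mul_apply]; simp [vertexOp, EE_apply]

end entries

/-! ### Recognizing a twisted generalized Bariev Hamiltonian -/

/-- Matching of a nineteen-vertex Hamiltonian with the generalized Bariev Hamiltonian. -/
lemma twist_braided_eq_HGB {J j : ℂ} (hj : j ^ 2 - j + 1 = 0) (hJ : J = j ^ 2) {w : Weights}
    (hc : w.c = 0) (hd' : w.d' = j * w.d) (hh : w.h = w.a + j⁻¹ * w.f)
    (hh' : w.h' = w.a + j * w.f) (hb' : w.b' ≠ 0) (hf : w.f ≠ 0) (hd : w.d' ≠ 0)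
    (hg : w.g + w.a + w.f = 0) (hdd : j * w.d ^ 2 = w.b' * w.b - w.f ^ 2)
    (ha : 4 * w.f * w.a = w.b' ^ 2 - w.b' * w.b + w.b ^ 2) {s : ℂ} (hs : s ^ 2 = w.d' / w.b') :
    twist s (braided w) = HGB J w.b' w.b w.f := by
  have hs0 : s ≠ 0 := by
    rintro rfl
    exact div_ne_zero hd hb' (by rw [← hs]; ring)
  have hj0 : j ≠ 0 := by rintro rfl; norm_num at hj
  have hji : j⁻¹ = 1 - j := by field_simp; linear_combination hj
  -- The quadratic relation `ha` says exactly that -a is the υ belonging to φ = b', ψ = b, ξ = f.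
  have hup : upsilon w.b' w.b w.f = -w.a := by
    rw [upsilon]; field_simp; linear_combination ha
  -- Entries in column (1, 1) coming from d, d' are divided by s², and those in row (1, 1) are
  -- multiplied by s². The choice of s² normalizes the first kind; the second kind is then fixed by
  -- `hdd`.
  have hs2 : w.d' / s ^ 2 = w.b' := by rw [hs]; field_simp
  have hds : w.d' * (s ^ 2)⁻¹ = w.b' := hs2
  have hds' : w.d * (s ^ 2)⁻¹ = -J * w.b' := by
    rw [← hds, hd', hJ]
    linear_combination ((1 + j) * w.d * (s ^ 2)⁻¹) * hj
  have hes : s ^ 2 * w.d' = -J ^ 2 * (w.b - w.f ^ 2 / w.b') := by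
    rw [hs, hJ, hd']; field_simp
    linear_combination -j ^ 2 * hdd + (1 + j) * w.d ^ 2 * hj
  have hes' : s ^ 2 * w.d = w.b - w.f ^ 2 / w.b' := by
    rw [hs, hd']; field_simp
    linear_combination hdd
  -- The diagonal coefficients of H_GB arise from h and h' because j⁻¹ = 1 - j = -J and j = -J².
  have hJ1 : J = j - 1 := by rw [hJ]; linear_combination hj
  have hJ2 : J ^ 2 = -j := by rw [hJ]; linear_combination (j ^ 2 + j) * hj
  ext ⟨i, k⟩ ⟨i', l⟩
  rw [twist_apply hs0, braided, perm_mul_apply, HGB, hup]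
  fin_cases i <;> fin_cases k <;> fin_cases i' <;> fin_cases l <;>
    simp [vertexOp, EE_apply, hc, hh, hh', hji]
  all_goals first
    | linear_combination w.f * hJ2
    | linear_combination w.f * hJ1
    | linear_combination hds
    | linear_combination hds'
    | linear_combination hes
    | linear_combination hes'
    | (field_simp; done)
    | (field_simp; linear_combination hg)

/-! ### Parametrizations of plane curves -/

section curves

open scoped ContDiff

variable {F : ℂ → ℂ → ℂ}

/-- Chain rule for a function of two variables. -/
lemma hasDerivAt_comp₂ (hF : ContDiff ℂ ω (fun p : ℂ × ℂ => F p.1 p.2)) {a b : ℂ → ℂ}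
    {a' b' z : ℂ} (ha : HasDerivAt a a' z) (hb : HasDerivAt b b' z) :
    HasDerivAt (fun z => F (a z) (b z))
      (deriv (fun x => F x (b z)) (a z) * a' + deriv (fun y => F (a z) y) (b z) * b') z := by
  have hd : HasFDerivAt (fun p : ℂ × ℂ => F p.1 p.2)
      (fderiv ℂ (fun p : ℂ × ℂ => F p.1 p.2) (a z, b z)) (a z, b z) :=
    (hF.differentiable (by simp) _).hasFDerivAt
  set L := fderiv ℂ (fun p : ℂ × ℂ => F p.1 p.2) (a z, b z)
  have h1 : HasDerivAt (fun x => F x (b z)) (L (1, 0)) (a z) :=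
    hd.comp_hasDerivAt (a z) (f := fun x => (x, b z))
      ((hasDerivAt_id _).prodMk (hasDerivAt_const _ _))
  have h2 : HasDerivAt (fun y => F (a z) y) (L (0, 1)) (b z) :=
    hd.comp_hasDerivAt (b z) (f := fun y => (a z, y))
      ((hasDerivAt_const _ _).prodMk (hasDerivAt_id _))
  have h3 : HasDerivAt (fun z => F (a z) (b z)) (L (a', b')) z :=
    hd.comp_hasDerivAt z (f := fun z => (a z, b z)) (ha.prodMk hb)
  rw [h1.deriv, h2.deriv]
  convert h3 using 1
  have : ((a', b') : ℂ × ℂ) = a' • (1, 0) + b' • (0, 1) := by simp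
  rw [this, map_add, map_smul, map_smul, smul_eq_mul, smul_eq_mul]
  ring

/-- F is identically zero along the parametrization near z, so the chain-rule expression for its
derivative vanishes. -/
lemma LocalParam.tangent (hF : ContDiff ℂ ω (fun p : ℂ × ℂ => F p.1 p.2)) {a b : ℂ → ℂ} {z : ℂ}
    (h : LocalParam F a b z) :
    deriv (fun x => F x (b z)) (a z) * deriv a z +
      deriv (fun y => F (a z) y) (b z) * deriv b z = 0 := by
  have h1 := hasDerivAt_comp₂ hF h.1.differentiableAt.hasDerivAt h.2.1.differentiableAt.hasDerivAt
  have h2 : HasDerivAt (fun z => F (a z) (b z)) 0 z :=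
    (hasDerivAt_const z (0 : ℂ)).congr_of_eventuallyEq h.2.2
  exact h1.unique h2

/-- The implicit function theorem writes the curve as a graph over the first coordinate; this graph
is traversed with a = a₀ + uz. The case u = 0 is allowed and gives a constant parametrization. -/
lemma exists_localParam_of_deriv_snd (hF : ContDiff ℂ ω (fun p : ℂ × ℂ => F p.1 p.2))
    {a₀ b₀ u v : ℂ} (h0 : F a₀ b₀ = 0) (hb : deriv (fun y => F a₀ y) b₀ ≠ 0)
    (huv : deriv (fun x => F x b₀) a₀ * u + deriv (fun y => F a₀ y) b₀ * v = 0) :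
    ∃ a b : ℂ → ℂ, LocalParam F a b 0 ∧ a 0 = a₀ ∧ b 0 = b₀ ∧
      HasDerivAt a u 0 ∧ HasDerivAt b v 0 := by
  have cdf : ContDiffAt ℂ ω (fun p : ℂ × ℂ => F p.1 p.2) (a₀, b₀) := hF.contDiffAt
  have hd : HasFDerivAt (fun p : ℂ × ℂ => F p.1 p.2)
      (fderiv ℂ (fun p : ℂ × ℂ => F p.1 p.2) (a₀, b₀)) (a₀, b₀) :=
    (hF.differentiable (by simp) _).hasFDerivAt
  have h2 : HasDerivAt (fun y => F a₀ y)
      (fderiv ℂ (fun p : ℂ × ℂ => F p.1 p.2) (a₀, b₀) (0, 1)) b₀ :=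
    hd.comp_hasDerivAt b₀ (f := fun y => (a₀, y))
      ((hasDerivAt_const _ _).prodMk (hasDerivAt_id _))
  have hinv : (fderiv ℂ (fun p : ℂ × ℂ => F p.1 p.2) (a₀, b₀) ∘L
      .inr ℂ ℂ ℂ).IsInvertible := by
    rw [h2.deriv] at hb
    refine ⟨ContinuousLinearEquiv.unitsEquivAut ℂ (Units.mk0 _ hb), ?_⟩
    ext
    simp
  have hω : (ω : WithTop ℕ∞) ≠ 0 := by simp
  set ψ := cdf.implicitFunction hω hinv
  have hψ0 : ψ a₀ = b₀ := cdf.implicitFunction_apply_self hω hinv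
  have hψ : ∀ᶠ x in 𝓝 a₀, F x (ψ x) = F a₀ b₀ := cdf.eventually_apply_implicitFunction hω hinv
  have hψa : AnalyticAt ℂ ψ a₀ := (cdf.contDiffAt_implicitFunction hω hinv).analyticAt
  have haA : AnalyticAt ℂ (fun z : ℂ => a₀ + u * z) 0 := by fun_prop
  have ha0 : (fun z : ℂ => a₀ + u * z) 0 = a₀ := by simp
  have hbA : AnalyticAt ℂ (fun z : ℂ => ψ (a₀ + u * z)) 0 :=
    AnalyticAt.fun_comp (by simpa using hψa) haA
  have hda : HasDerivAt (fun z : ℂ => a₀ + u * z) u 0 := by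
    simpa using ((hasDerivAt_id (0 : ℂ)).const_mul u).const_add a₀
  have hev : ∀ᶠ z in 𝓝 (0 : ℂ), F (a₀ + u * z) (ψ (a₀ + u * z)) = 0 := by
    have ht : Filter.Tendsto (fun z : ℂ => a₀ + u * z) (𝓝 0) (𝓝 a₀) := by
      simpa using haA.continuousAt.tendsto
    filter_upwards [ht.eventually hψ] with z hz
    rw [hz, h0]
  have hp : LocalParam F (fun z => a₀ + u * z) (fun z => ψ (a₀ + u * z)) 0 := ⟨haA, hbA, hev⟩
  refine ⟨_, _, hp, by simp, by simpa using hψ0, hda, ?_⟩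
  have ht := hp.tangent hF
  simp only [mul_zero, add_zero, hψ0, hda.deriv] at ht
  -- The velocity of b needs no separate computation: it is forced by tangency, because the partial
  -- derivative in b is nonzero.
  have hv : deriv (fun z : ℂ => ψ (a₀ + u * z)) 0 = v :=
    mul_left_cancel₀ hb (by linear_combination ht - huv)
  rw [← hv]
  exact hbA.differentiableAt.hasDerivAt

/-- Through a regular point of a plane curve there is a parametrization with any given tangent
vector. -/
lemma exists_localParam (hF : ContDiff ℂ ω (fun p : ℂ × ℂ => F p.1 p.2))
    {a₀ b₀ u v : ℂ} (h0 : F a₀ b₀ = 0) (hr : RegularPoint F a₀ b₀)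
    (huv : deriv (fun x => F x b₀) a₀ * u + deriv (fun y => F a₀ y) b₀ * v = 0) :
    ∃ a b : ℂ → ℂ, LocalParam F a b 0 ∧ a 0 = a₀ ∧ b 0 = b₀ ∧
      HasDerivAt a u 0 ∧ HasDerivAt b v 0 := by
  rcases hr with h | h
  · have hF' : ContDiff ℂ ω (fun p : ℂ × ℂ => (fun x y => F y x) p.1 p.2) :=
      hF.comp (contDiff_snd.prodMk contDiff_fst)
    obtain ⟨b, a, hp, hb, ha, hb', ha'⟩ := exists_localParam_of_deriv_snd
      (F := fun x y => F y x) (a₀ := b₀) (b₀ := a₀) (u := v) (v := u) hF' h0 h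
      (by linear_combination huv)
    exact ⟨a, b, ⟨hp.2.1, hp.1, hp.2.2⟩, ha, hb, ha', hb'⟩
  · exact exists_localParam_of_deriv_snd hF h0 h huv

end curves

/-! ### Algebra of the main-branch curve -/

/-- Numerator of the weight `b'` of the main-branch Lax operator; it is also the numerator of
`b² - a f`. -/
def mbNum (α β a b : ℂ) : ℂ :=
  β * b ^ 3 + a * (1 - (α - β) * a * b - (a ^ 4 + a ^ 2 * b ^ 2 + b ^ 4))

/-- The relations between `a`, `b`, `B = b'` and `m = b² - a f` on the main-branch curve. -/
structure MBRel (α β a b B m : ℂ) : Prop where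
  h1 : m * (B + α * a) = b
  h2 : (α * β - 1) * a * b * m = β * b ^ 2 - β * m + a * B
  h3 : α * a ^ 2 * B + a * B ^ 2 + a * b ^ 2 + β * b ^ 2 * B = β * b
  h4 : B * mbDenB β a b = mbNum α β a b
  h5 : m * mbDenF α β a b = mbNum α β a b

/-- The denominator `rDen` on the diagonal, in terms of `b`, `B`, `m`. -/
def diagDen (b B m : ℂ) : ℂ := B + b * (b ^ 2 - m - B ^ 2)

/-- Numerator of the ratio of the entries `ψ` and `φ` of the Hamiltonian. -/
def psiNum (α β a b B m : ℂ) : ℂ :=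
  -α * B + α * b * (b ^ 2 - m + B ^ 2) + 2 * β * a ^ 2 * b + (α ^ 2 - α * β + β ^ 2) * a * b * B

/-- First component of a vector field tangent to the main-branch curve. -/
def tanA (α β a b B m : ℂ) : ℂ :=
  β * (-4 * b * diagDen b B m - 2 * a ^ 2 * (b ^ 2 - m - B ^ 2)
    - (α ^ 2 - α * β + β ^ 2 + 2) * a ^ 2 * m)

/-- Second component of a vector field tangent to the main-branch curve. -/
def tanB (α β a b B m : ℂ) : ℂ :=
  4 * a * psiNum α β a b B m + 2 * β * a * b * (b ^ 2 - m - B ^ 2)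
    + β * (α ^ 2 - α * β + β ^ 2 + 2) * a * b * m

/-- Differential of `mbNum`. -/
def dNum (α β a b x y : ℂ) : ℂ :=
  (1 - 2 * (α - β) * a * b - 5 * a ^ 4 - 3 * a ^ 2 * b ^ 2 - b ^ 4) * x
    + (3 * β * b ^ 2 - (α - β) * a ^ 2 - 2 * a ^ 3 * b - 4 * a * b ^ 3) * y

/-- Differential of `mbDenB`. -/
def dDenB (β a b x y : ℂ) : ℂ :=
  (β * (4 * a ^ 3 + 2 * a * b ^ 2) + 2 * b) * x + (β * (2 * a ^ 2 * b + 4 * b ^ 3) + 2 * a) * y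

/-- Differential of `mbDenF`. -/
def dDenF (α β a b x y : ℂ) : ℂ :=
  (3 * β ^ 2 * a ^ 2 + (α * β - 2) * b ^ 2) * x + (2 * (α * β - 2) * a * b + β) * y

/-- Partial derivative of `mbCurve` with respect to `a`. -/
def mbCurveA (α β a b : ℂ) : ℂ :=
  2 * (α * β - 1) * (a ^ 4 + a ^ 2 * b ^ 2 + b ^ 4) * (4 * a ^ 3 + 2 * a * b ^ 2)
    + (2 - α * β + α ^ 2 + β ^ 2) * ((β * (4 * a ^ 3 + 2 * a * b ^ 2) + b) * (a * b)
      + (β * (a ^ 4 + a ^ 2 * b ^ 2 + b ^ 4) + a * b) * b)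
    - 4 * (α * β - 2) * a ^ 3 + 2 * β ^ 2 * a * b ^ 2 - 2 * β * b

/-- Partial derivative of `mbCurve` with respect to `b`. -/
def mbCurveB (α β a b : ℂ) : ℂ :=
  2 * (α * β - 1) * (a ^ 4 + a ^ 2 * b ^ 2 + b ^ 4) * (2 * a ^ 2 * b + 4 * b ^ 3)
    + (2 - α * β + α ^ 2 + β ^ 2) * ((β * (2 * a ^ 2 * b + 4 * b ^ 3) + a) * (a * b)
      + (β * (a ^ 4 + a ^ 2 * b ^ 2 + b ^ 4) + a * b) * a)
    + 2 * β ^ 2 * a ^ 2 * b - 4 * (2 - α * β + β ^ 2) * b ^ 3 - 2 * β * a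

/-! ### Polynomial consequences of the main-branch relations -/

namespace MBRel

variable {α β a b B m : ℂ}

/-- This is j κ² = φψ - ξ² after division by φ² and clearing of denominators, where κ = φηma/δ, ξ =
φa(b² - m - B²)/δ, ψ = φ `psiNum`/(βδ) and δ = `diagDen`. The proof exhibits a times the difference
as a combination of the five relations. -/
lemma psi_identity (H : MBRel α β a b B m) (ha : a ≠ 0) : psiNum α β a b B m * diagDen b B m =
    β * a ^ 2 * ((α * β - 1) * m ^ 2 + (b ^ 2 - m - B ^ 2) ^ 2) := by
  obtain ⟨h1, h2, h3, h4, h5⟩ := H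
  apply mul_left_cancel₀ ha
  simp only [psiNum, diagDen, mbDenB, mbDenF, mbNum] at *
  linear_combination
    (α * β * a ^ 4 + α * β * b * B - 2 * α * β + α * a * b + β ^ 2 - β * a ^ 3 * B - 2 * β * a *
    b + a ^ 2 * b ^ 2) * h1 +  (-2 * α ^ 2 * a * b * B + α ^ 2 * a + α * β * a * b * B - α * β *
    a + α * a ^ 2 * b - α * b ^ 3 - α * b * B ^ 2 + α * b * m + 2 * α * B - β * a ^ 2 * b - β *
    B + a * b * B) * h2 +  (α ^ 2 * β * b ^ 2 * m - α ^ 2 * a * b + α * β * a * b - α * a ^ 4 -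
    α * a ^ 2 * b ^ 2 - α * b ^ 2 * B ^ 2 - α * b ^ 2 * m - α * b * B + 2 * α + β * a ^ 2 * b ^
    2 - β * a ^ 2 * B ^ 2 - β * a ^ 2 * m - β + a * b) * h3 +  (-α ^ 2 * β * m + α * B ^ 2 + α *
    m) * h4 +  (α ^ 2 * a * B + α * b ^ 2 - α * m) * h5

/-- In the same variables this is 4ξA = φ² - φψ + ψ², with 4δA = -φa(2(b² - m - B²) + (α² - αβ + β²
+ 2)m). -/
lemma quartic_identity (H : MBRel α β a b B m) (ha : a ≠ 0) :
    β ^ 2 * (-2 * a ^ 2 * (b ^ 2 - m - B ^ 2) ^ 2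
      - (α ^ 2 - α * β + β ^ 2 + 2) * a ^ 2 * (b ^ 2 - m - B ^ 2) * m - diagDen b B m ^ 2) =
      psiNum α β a b B m ^ 2 - β * diagDen b B m * psiNum α β a b B m := by
  obtain ⟨h1, h2, h3, h4, h5⟩ := H
  apply mul_left_cancel₀ ha
  simp only [psiNum, diagDen, mbDenB, mbDenF, mbNum] at *
  linear_combination
    (α ^ 2 * β * a ^ 4 + α ^ 2 * β * b * B - 2 * α ^ 2 * β + α ^ 2 * a * b + α * β ^ 2 + α * a ^
    2 * b ^ 2 + β ^ 4 * a * b + β ^ 3 * a ^ 2 * B ^ 2 - β ^ 3 - 6 * β ^ 2 * a * b - β * a ^ 2 *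
    B ^ 2 - β * b * B + 2 * β + a ^ 3 * B + a * b ^ 2 * B - 2 * a * b) * h1 +  (-α ^ 3 * a * b *
    B + α ^ 3 * a - α ^ 2 * β * a + α ^ 2 * a ^ 2 * b + α ^ 2 * b ^ 3 - α ^ 2 * b * B ^ 2 - α ^
    2 * b * m + 2 * α ^ 2 * B + α * β ^ 2 * a - α * β * a ^ 2 * b - α * β * b ^ 3 + α * β * b *
    m - α * β * B - 2 * α * a - β ^ 3 * a * b * B - β ^ 3 * a + β ^ 2 * b ^ 3 - β ^ 2 * b * m +
    β ^ 2 * B + 6 * β * a * b * B + 4 * β * a + 7 * a ^ 2 * b + b * B ^ 2 - 2 * B) * h2 +  (α ^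
    3 * β * b ^ 2 * m - α ^ 3 * a * b ^ 2 * B - α ^ 3 * a * b + α ^ 2 * β ^ 2 * a ^ 2 * m - α ^
    2 * β * a ^ 3 * B + α ^ 2 * β * a * b ^ 2 * B + α ^ 2 * β * a * b - α ^ 2 * a ^ 4 - α ^ 2 *
    a ^ 2 * b ^ 2 - 2 * α ^ 2 * b ^ 4 - α ^ 2 * b ^ 2 * B ^ 2 + α ^ 2 * b ^ 2 * m - α ^ 2 * b *
    B + 2 * α ^ 2 - α * β ^ 3 * a ^ 2 * m + α * β ^ 2 * a ^ 3 * B - α * β ^ 2 * a * b ^ 2 * B -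
    α * β ^ 2 * a * b - 4 * α * β * a ^ 2 * b ^ 2 + α * β * b ^ 4 - α * β * b ^ 2 * B ^ 2 - α *
    β * b ^ 2 * m - α * β + α * a * b + β ^ 4 * a ^ 2 * m + β ^ 4 * b ^ 2 * m - β ^ 3 * a ^ 3 *
    B - β ^ 3 * a * B * m + 4 * β ^ 2 * a ^ 2 * b ^ 2 - 2 * β ^ 2 * a ^ 2 * B ^ 2 - 2 * β ^ 2 *
    a ^ 2 * m + 3 * β ^ 2 * b ^ 4 - β ^ 2 * b ^ 2 * B ^ 2 - 3 * β ^ 2 * b ^ 2 * m + β ^ 2 + 7 *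
    β * a * b + β * a * B * m - a ^ 2 * m + b * B - 2) * h3 +  (-α ^ 3 * β * m + α ^ 3 * a * B -
    α ^ 2 * β * a * B + 2 * α ^ 2 * b ^ 2 + α ^ 2 * B ^ 2 - α ^ 2 * m + α * β ^ 2 * a * B - α *
    β * b ^ 2 + α * β * B ^ 2 + α * β * m - α * a * B - β ^ 4 * m - β ^ 2 * a ^ 2 - 3 * β ^ 2 *
    b ^ 2 + β ^ 2 * B ^ 2 + 3 * β ^ 2 * m - β * a * B + 4 * a ^ 2) * h4 +  (α ^ 2 * β * a * B -
    α ^ 2 * b ^ 2 + α ^ 2 * m - α * β ^ 2 * a * B + α * β * b ^ 2 - α * β * m + α * a * B + β ^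
    3 * a * B + β ^ 2 * a ^ 2 - β ^ 2 * b ^ 2 + β ^ 2 * m - 3 * β * a * B - 4 * a ^ 2) * h5

/-- The condition g' + A + ξ = 0 with the Lax weight g inserted; the factor a² + b² - m is a(a + f).
-/
lemma weightG_identity (H : MBRel α β a b B m) (ha : a ≠ 0) :
    a ^ 2 * diagDen b B m * (1 - b * B + (α * β - 1) * m ^ 2) =
      (a ^ 2 + b ^ 2 - m) * ((α * β - 1) * a ^ 2 * m ^ 2 * b + (1 - B * b) * diagDen b B m
        - a ^ 2 * (b ^ 2 - m - B ^ 2) * B) := by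
  obtain ⟨h1, h2, h3, h4, h5⟩ := H
  apply mul_left_cancel₀ ha
  simp only [diagDen, mbDenB, mbDenF, mbNum] at *
  linear_combination
    (-2 * α * a ^ 2 * b - β ^ 2 * a * b * B - β * a ^ 4 * b * m + 2 * β * a ^ 2 * b + β * a ^ 2
    * B * m + β * b * B ^ 2 - 2 * β * B - 2 * a ^ 5 - 2 * a ^ 3 * b ^ 2 + a ^ 3 * b * B * m + a
    ^ 3 * B ^ 2 - 2 * a * b ^ 4 + a * b ^ 3 * B * m + a * b ^ 2 * B ^ 2 - a * b ^ 2 * m - 4 * a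
    * b * B + 2 * a) * h1 +  (-2 * α * a * b * B ^ 2 + α * a * B + β * a * b * B ^ 2 - a ^ 2 * b
    * B - a ^ 2 * B ^ 2 * m - 3 * b ^ 3 * B + 3 * b ^ 2 - b * B ^ 3 + 2 * B ^ 2) * h2 +  (α * β
    * b ^ 2 * B * m - α * a * b * B - β * a ^ 3 * m + β * a * b * B - a ^ 4 * B - a ^ 2 * b ^ 2
    * B - a ^ 2 * b * m ^ 2 - a ^ 2 * B * m - b ^ 4 * B - b ^ 3 * m ^ 2 - b ^ 3 - b ^ 2 * B * m
    - b * B ^ 2 + 2 * b * m + 2 * B) * h3 +  (-α * β * B * m + 2 * α * a * m + b ^ 2 * B + b * m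
    ^ 2 - b + B * m) * h4 +  (α * a * B ^ 2 + b ^ 2 * B - b) * h5

/-- Differentiating B = `mbNum`/`mbDenB` in the direction (`tanA`, `tanB`) gives aB' - `tanA` B =
4βδ. This fixes the scale of the tangent vector. -/
lemma denB_identity (H : MBRel α β a b B m) :
    mbDenB β a b * (4 * β * diagDen b B m + tanA α β a b B m * B)
      + a * B * dDenB β a b (tanA α β a b B m) (tanB α β a b B m)
      = a * dNum α β a b (tanA α β a b B m) (tanB α β a b B m) := by
  obtain ⟨h1, h2, h3, h4, h5⟩ := H
  simp only [psiNum, diagDen, mbDenB, mbDenF, mbNum, tanA, tanB, dDenB, dNum] at *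
  linear_combination
    (-8 * α * β * a ^ 2 - 4 * β ^ 2 * a ^ 2 * b * B + 4 * β ^ 2 * a ^ 2 - 4 * β * a ^ 3 * b - 8
    * β * a * B) * h1 +  (4 * α ^ 2 * a ^ 3 - 8 * α ^ 2 * a * b ^ 3 * B + 8 * α ^ 2 * a * b ^ 2
    - 4 * α * β * a ^ 3 + 8 * α * a ^ 4 * b + 8 * α * a ^ 2 * b ^ 3 + 8 * α * a ^ 2 * B - 8 * α
    * b ^ 3 * B ^ 2 + 16 * α * b ^ 2 * B - 8 * α * b - 8 * β ^ 2 * a ^ 3 * b * B + 12 * β ^ 2 *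
    a ^ 3 - 8 * β ^ 2 * a * b ^ 3 * B + 8 * β ^ 2 * a * b ^ 2 - 8 * β * a ^ 2 * b ^ 3 - 8 * β *
    a ^ 2 * b * B ^ 2 - 4 * β * a ^ 2 * B - 16 * β * b ^ 2 * B + 16 * β * b + 16 * a * b ^ 3 * B
    - 32 * a * b ^ 2) * h2 +  (4 * α ^ 2 * a ^ 3 * b - 8 * α ^ 2 * a * b ^ 3 + 8 * α * β * a ^ 3
    * b ^ 2 * B - 12 * α * β * a ^ 3 * b + 16 * α * β * a * b ^ 4 * B - 8 * α * β * a * b ^ 3 +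
    8 * α * a ^ 2 * b ^ 4 + 8 * α * a ^ 2 * b * B - 8 * α * b ^ 6 + 8 * α * b ^ 4 * m - 8 * α *
    b ^ 3 * B + 8 * α * b ^ 2 + 8 * β ^ 2 * a ^ 3 * b ^ 2 * B - 4 * β ^ 2 * a ^ 3 * b - 8 * β ^
    2 * a * b ^ 4 * B + 12 * β ^ 2 * a * b * m - 16 * β * a ^ 2 * b ^ 4 - 8 * β * a ^ 2 * b ^ 2
    * m - 24 * β * a ^ 2 * b * B + 4 * β * a ^ 2 - 8 * β * b ^ 6 + 8 * β * b ^ 3 * B - 16 * β *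
    b ^ 2 + 8 * β * m) * h3 +  (-5 * α ^ 2 * β * a ^ 2 * m + 8 * α ^ 2 * a * b + 9 * α * β ^ 2 *
    a ^ 2 * m - 16 * α * β * a * b ^ 2 * B + 16 * α * β * a * b + 4 * α * a ^ 4 + 8 * α * b ^ 4
    - 8 * α * b ^ 2 * m + 8 * α * b * B - 8 * α + 3 * β ^ 3 * a ^ 2 * m + 8 * β ^ 2 * a * b ^ 2
    * B - 12 * β ^ 2 * a * b + 8 * β * a ^ 4 + 10 * β * a ^ 2 * b ^ 2 + 10 * β * a ^ 2 * B ^ 2 +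
    4 * β * b ^ 4 + 4 * β * b ^ 2 * B ^ 2 + 4 * β * b ^ 2 * m - 12 * β * b * B + 8 * β + 8 * a *
    b ^ 2 * B - 16 * a * b) * h4 +  (8 * α ^ 2 * a * b ^ 2 * B - 8 * α ^ 2 * a * b - 4 * α * β *
    a ^ 3 * B + 8 * α * β * a * b ^ 2 * B - 8 * α * β * a * b - 4 * α * a ^ 4 + 8 * α * b ^ 2 *
    B ^ 2 - 16 * α * b * B + 8 * α - 8 * β ^ 2 * a ^ 3 * B - 4 * β ^ 2 * a * b ^ 2 * B + 4 * β ^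
    2 * a * b - 8 * β * a ^ 4 - 4 * β * a ^ 2 * b ^ 2 + 8 * β * b * B - 8 * β - 8 * a * b ^ 2 *
    B + 16 * a * b) * h5

/-- The differential of m(B + αa) = b in the direction (`tanA`, `tanB`), multiplied by a `mbDenF`: m
is differentiated as `mbNum`/`mbDenF`, and aB' is taken from `denB_identity`. -/
lemma denF_identity (H : MBRel α β a b B m) :
    a * (B + α * a) * (dNum α β a b (tanA α β a b B m) (tanB α β a b B m)
        - m * dDenF α β a b (tanA α β a b B m) (tanB α β a b B m))
      + mbDenF α β a b * (m * (α * a * tanA α β a b B m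
        + (4 * β * diagDen b B m + tanA α β a b B m * B)) - a * tanB α β a b B m) = 0 := by
  obtain ⟨h1, h2, h3, h4, h5⟩ := H
  simp only [psiNum, diagDen, mbDenB, mbDenF, mbNum, tanA, tanB, dDenF, dNum] at *
  linear_combination
    (-α ^ 3 * β ^ 2 * a ^ 3 - α ^ 3 * a * b ^ 3 * B + α ^ 3 * a * b ^ 2 + 8 * α ^ 2 * β * a ^ 3
    - 6 * α ^ 2 * a ^ 2 * b ^ 3 - α * β ^ 3 * b - 4 * α * β ^ 2 * a ^ 3 + 8 * α * β ^ 2 * a * m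
    - 8 * α * a ^ 3 * b ^ 4 - 8 * α * a ^ 3 * b ^ 2 * m - 6 * α * a * b ^ 6 - 6 * α * a * b ^ 2
    - 4 * β ^ 4 * a ^ 2 * b * m + 14 * β ^ 3 * a ^ 3 - 4 * β ^ 3 * a * m + 18 * β ^ 2 * a ^ 2 *
    b * B ^ 2 + 12 * β ^ 2 * a ^ 2 * b * m - 39 * β ^ 2 * a ^ 2 * B + 4 * β ^ 2 * b + 4 * β ^ 2
    * B * m + 15 * β * a ^ 3 * b * B - 10 * β * a ^ 3 - 4 * β * a * b * B ^ 3 - 16 * β * a * b *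
    B * m + 3 * β * a * B ^ 2 + 12 * β * a * m + 20 * a ^ 4 * b ^ 2 * B + 10 * a ^ 4 * b + 8 * a
    ^ 4 * B * m + 8 * a ^ 2 * b ^ 4 * B - 16 * a ^ 2 * b ^ 3 - 18 * a ^ 2 * b ^ 2 * B ^ 3 + 8 *
    a ^ 2 * b ^ 2 * B * m + 67 * a ^ 2 * b * B ^ 2 - 12 * a ^ 2 * b * m - 10 * a ^ 2 * B) * h1 +
    (α ^ 4 * a * b ^ 2 * B - α ^ 4 * a * b - 4 * α ^ 3 * β * a ^ 3 * b * m + α ^ 3 * β * a ^ 3 *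
    B - 5 * α ^ 3 * a ^ 4 * b * B - 4 * α ^ 3 * a ^ 4 + 5 * α ^ 3 * a ^ 2 * b ^ 3 * B - 5 * α ^
    3 * a ^ 2 * b ^ 2 + α ^ 3 * b ^ 2 * B ^ 2 - α ^ 3 * b * B + 4 * α ^ 2 * β ^ 2 * a ^ 3 * b *
    m + 10 * α ^ 2 * β * a ^ 4 + α ^ 2 * β * a ^ 2 * b ^ 2 + α ^ 2 * β * a ^ 2 * B ^ 2 - 4 * α ^
    2 * β * a ^ 2 * m - 11 * α ^ 2 * a ^ 5 * b - 8 * α ^ 2 * a ^ 3 * b ^ 3 - 13 * α ^ 2 * a ^ 3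
    * b * B ^ 2 + 16 * α ^ 2 * a ^ 3 * b * m + 3 * α ^ 2 * a ^ 3 * B + 13 * α ^ 2 * a * b ^ 3 *
    B ^ 2 - 30 * α ^ 2 * a * b ^ 2 * B + 17 * α ^ 2 * a * b - 4 * α * β ^ 3 * a ^ 3 * b * m - 10
    * α * β ^ 2 * a ^ 4 + 3 * α * β ^ 2 * a ^ 2 * b ^ 2 + 4 * α * β ^ 2 * a ^ 2 * m + α * β ^ 2
    * b * B - 5 * α * β * a ^ 5 * b + 2 * α * β * a ^ 3 * b ^ 3 - 8 * α * β * a ^ 3 * b * m + 15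
    * α * β * a ^ 3 * B - 4 * α * β * a * b ^ 5 + α * β * a * b - 12 * α * β * a * B * m - 34 *
    α * a ^ 4 * b * B + 10 * α * a ^ 4 - 41 * α * a ^ 2 * b ^ 3 * B + 17 * α * a ^ 2 * b ^ 2 - 8
    * α * a ^ 2 * b * B ^ 3 + 8 * α * a ^ 2 * b * B * m + 11 * α * a ^ 2 * B ^ 2 - 12 * α * a ^
    2 * m - 6 * α * b ^ 5 * B + 6 * α * b ^ 4 + 8 * α * b ^ 3 * B ^ 3 - 22 * α * b ^ 2 * B ^ 2 +
    14 * α * b * B + 5 * β ^ 3 * a ^ 4 + 10 * β ^ 3 * a ^ 2 * b ^ 3 * B - 9 * β ^ 3 * a ^ 2 * b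
    ^ 2 + 5 * β ^ 3 * b ^ 5 * B - 5 * β ^ 3 * b ^ 4 + 4 * β ^ 2 * a ^ 5 * b + 9 * β ^ 2 * a ^ 3
    * b ^ 3 + 13 * β ^ 2 * a ^ 3 * b * B ^ 2 - 30 * β ^ 2 * a ^ 3 * B + 5 * β ^ 2 * a * b ^ 5 +
    26 * β ^ 2 * a * b ^ 3 * B ^ 2 - 37 * β ^ 2 * a * b ^ 2 * B + 15 * β ^ 2 * a * b + 4 * β ^ 2
    * a * B * m - 4 * β * a ^ 4 + 18 * β * a ^ 2 * b ^ 3 * B - 10 * β * a ^ 2 * b ^ 2 + 16 * β *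
    a ^ 2 * b * B ^ 3 - 8 * β * a ^ 2 * b * B * m + 24 * β * a ^ 2 * B ^ 2 - 39 * β * b ^ 5 * B
    + 35 * β * b ^ 4 + 8 * β * b ^ 3 * B ^ 3 - 8 * β * b ^ 3 * B * m + 16 * β * b ^ 2 * B ^ 2 +
    12 * β * b ^ 2 * m - 28 * β * b * B - 4 * β * B ^ 2 * m - 8 * a ^ 5 * b - 14 * a ^ 3 * b ^ 3
    + 12 * a ^ 3 * b * B ^ 2 - 8 * a ^ 3 * b * m + 10 * a ^ 3 * B - 35 * a * b ^ 5 + a * b ^ 3 *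
    B ^ 2 - 8 * a * b ^ 3 * m + 3 * a * b ^ 2 * B + 10 * a * b + 4 * a * B ^ 3 - 12 * a * B * m)
    * h2 +  (α ^ 4 * a * b ^ 2 + α ^ 3 * β * a ^ 3 + 6 * α ^ 3 * a ^ 2 * b ^ 3 + α ^ 3 * b ^ 5 +
    α ^ 3 * b ^ 2 * B - α ^ 2 * β ^ 2 * a * m + 4 * α ^ 2 * β * a ^ 2 * b ^ 3 + α ^ 2 * β * a ^
    2 * B + 3 * α ^ 2 * a ^ 7 - 8 * α ^ 2 * a ^ 3 * b ^ 4 + 5 * α ^ 2 * a ^ 3 * b ^ 2 * m - 9 *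
    α ^ 2 * a ^ 3 * b * B - 3 * α ^ 2 * a ^ 3 + 5 * α ^ 2 * a * b ^ 6 - 5 * α ^ 2 * a * b ^ 4 *
    m + 13 * α ^ 2 * a * b ^ 3 * B - 17 * α ^ 2 * a * b ^ 2 - 4 * α * β ^ 2 * a ^ 2 * b ^ 3 + 4
    * α * β ^ 2 * b * m ^ 2 + α * β ^ 2 * b - 3 * α * β * a ^ 7 + 16 * α * β * a ^ 3 * b ^ 4 - 2
    * α * β * a ^ 3 * b * B - α * β * a ^ 3 + 11 * α * β * a * b ^ 6 + 4 * α * β * a * b ^ 3 * B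
    - 11 * α * β * a * m - 8 * α * a ^ 2 * b ^ 4 * B - 5 * α * a ^ 2 * b ^ 3 + 8 * α * a ^ 2 * b
    ^ 2 * B * m - 8 * α * a ^ 2 * b * B ^ 2 - α * a ^ 2 * b * m + 7 * α * a ^ 2 * B + 8 * α * b
    ^ 6 * B - 12 * α * b ^ 5 - 8 * α * b ^ 4 * B * m + 8 * α * b ^ 3 * B ^ 2 + 6 * α * b ^ 3 * m
    - 14 * α * b ^ 2 * B + 10 * β ^ 3 * a ^ 2 * b ^ 3 + β ^ 3 * b ^ 5 + 3 * β ^ 2 * a ^ 7 + 19 *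
    β ^ 2 * a ^ 3 * b * B - 9 * β ^ 2 * a ^ 3 - 3 * β ^ 2 * a * b ^ 6 + 24 * β ^ 2 * a * b ^ 3 *
    B - 19 * β ^ 2 * a * b ^ 2 - 26 * β ^ 2 * a * b * B * m + 19 * β ^ 2 * a * m + 16 * β * a ^
    2 * b ^ 4 * B - 19 * β * a ^ 2 * b ^ 3 + 16 * β * a ^ 2 * b * B ^ 2 - 11 * β * a ^ 2 * b * m
    + 22 * β * a ^ 2 * B + 8 * β * b ^ 6 * B - 38 * β * b ^ 5 - 26 * β * b ^ 4 * B * m + 8 * β *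
    b ^ 3 * B ^ 2 + 11 * β * b ^ 3 * m + 24 * β * b ^ 2 * B + 4 * β * b * B ^ 2 * m + 12 * β * b
    * m ^ 2 - 4 * β * b - 11 * β * B * m + 6 * a ^ 7 + 7 * a ^ 5 * b ^ 2 + 7 * a ^ 3 * b ^ 4 - 8
    * a ^ 3 * b ^ 2 * m + 24 * a ^ 3 * b * B - 8 * a ^ 3 * m ^ 2 + 4 * a ^ 3 + a * b ^ 6 - 19 *
    a * b ^ 4 * m - 9 * a * b ^ 3 * B + 18 * a * b ^ 2 * B ^ 2 * m - 8 * a * b ^ 2 * m ^ 2 - 17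
    * a * b ^ 2 - 63 * a * b * B * m + 4 * a * B ^ 2 - 2 * a * m) * h3 +  (-α ^ 4 * a + 3 * α ^
    3 * β * a ^ 3 * m + 10 * α ^ 3 * β * a * b ^ 2 * m + 5 * α ^ 3 * a ^ 2 * b - α ^ 3 * b ^ 3 -
    α ^ 3 * B + 5 * α ^ 2 * β ^ 2 * a * b ^ 2 * m + 4 * α ^ 2 * β ^ 2 * a * m ^ 2 - 12 * α ^ 2 *
    β * a ^ 2 * b + 3 * α ^ 2 * β * a ^ 2 * B * m - 10 * α ^ 2 * β * b ^ 3 + 10 * α ^ 2 * β * b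
    * m + 3 * α ^ 2 * a ^ 5 + 15 * α ^ 2 * a ^ 3 * b ^ 2 + 4 * α ^ 2 * a ^ 3 * m + 5 * α ^ 2 * a
    * b ^ 4 - 9 * α ^ 2 * a * b ^ 2 * m - 13 * α ^ 2 * a * b * B + 7 * α ^ 2 * a - 5 * α * β ^ 3
    * a * b ^ 2 * m + 8 * α * β ^ 2 * a ^ 2 * b - 26 * α * β ^ 2 * a ^ 2 * B * m - 5 * α * β ^ 2
    * b ^ 3 + α * β ^ 2 * b * m - 3 * α * β * a ^ 5 - 7 * α * β * a ^ 3 * b ^ 2 - 6 * α * β * a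
    * b ^ 4 + 28 * α * β * a * b ^ 2 * m - 7 * α * β * a * b * B + 3 * α * β * a - 29 * α * a ^
    4 * B - 4 * α * a ^ 2 * b ^ 2 * B + 16 * α * a ^ 2 * b - 8 * α * b ^ 4 * B + 6 * α * b ^ 3 +
    8 * α * b ^ 2 * B * m - 8 * α * b * B ^ 2 + 14 * α * B - 4 * β ^ 3 * a ^ 2 * b + 4 * β ^ 3 *
    b ^ 3 - 5 * β ^ 3 * b * m - 3 * β ^ 2 * a ^ 3 * b ^ 2 + 3 * β ^ 2 * a ^ 3 * m + 3 * β ^ 2 *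
    a * b ^ 4 + 5 * β ^ 2 * a * b ^ 2 * m + 6 * β ^ 2 * a * b * B + 5 * β ^ 2 * a - 3 * β * a ^
    4 * B - 5 * β * a ^ 2 * b ^ 2 * B - 3 * β * a ^ 2 * b - 8 * β * b ^ 4 * B + 4 * β * b ^ 3 +
    26 * β * b ^ 2 * B * m - 8 * β * b * B ^ 2 + 11 * β * b * m - 21 * β * B + 3 * a ^ 5 - 2 * a
    ^ 3 * b ^ 2 - 6 * a ^ 3 * B ^ 2 - 2 * a * b ^ 4 - 4 * a * b ^ 2 * B ^ 2 - 14 * a * b ^ 2 * m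
    + 41 * a * b * B - 7 * a) * h4 +  (-α ^ 4 * a * b * B + α ^ 4 * a + 2 * α ^ 3 * β * a ^ 3 *
    m - 3 * α ^ 3 * a ^ 4 * B - 5 * α ^ 3 * a ^ 2 * b ^ 2 * B - 5 * α ^ 3 * a ^ 2 * b - α ^ 3 *
    b * B ^ 2 + α ^ 3 * B - 2 * α ^ 2 * β ^ 2 * a ^ 3 * m - 13 * α ^ 2 * β * a ^ 2 * b ^ 2 * B +
    7 * α ^ 2 * β * a ^ 2 * b - 2 * α ^ 2 * β * a ^ 2 * B * m - 10 * α ^ 2 * β * b ^ 4 * B + 10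
    * α ^ 2 * β * b ^ 3 - 3 * α ^ 2 * a ^ 5 - 18 * α ^ 2 * a ^ 3 * b ^ 2 - 3 * α ^ 2 * a ^ 3 * B
    ^ 2 - 4 * α ^ 2 * a ^ 3 * m - 10 * α ^ 2 * a * b ^ 4 - 13 * α ^ 2 * a * b ^ 2 * B ^ 2 + 10 *
    α ^ 2 * a * b * B - 7 * α ^ 2 * a + 2 * α * β ^ 3 * a ^ 3 * m + 5 * α * β ^ 2 * a ^ 2 * b ^
    2 * B - 3 * α * β ^ 2 * a ^ 2 * b - 2 * α * β ^ 2 * a ^ 2 * B * m - 5 * α * β ^ 2 * b ^ 4 *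
    B + 5 * α * β ^ 2 * b ^ 3 - 4 * α * β ^ 2 * b ^ 2 * B * m + 4 * α * β ^ 2 * b * m + 3 * α *
    β * a ^ 5 + 4 * α * β * a ^ 3 * b ^ 2 + 22 * α * β * a ^ 3 * B ^ 2 - α * β * a * b ^ 4 - 3 *
    α * β * a * b ^ 2 * B ^ 2 - 4 * α * β * a * b ^ 2 * m + α * β * a * b * B - 3 * α * β * a +
    23 * α * a ^ 4 * B + 3 * α * a ^ 2 * b ^ 2 * B - 16 * α * a ^ 2 * b - 8 * α * b ^ 2 * B ^ 3
    + 22 * α * b * B ^ 2 - 14 * α * B - β ^ 3 * a ^ 2 * b + 2 * β ^ 3 * a ^ 2 * B * m + 6 * β ^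
    2 * a * b * B - 5 * β ^ 2 * a - 5 * β * a ^ 2 * b ^ 2 * B + 9 * β * a ^ 2 * b - 4 * β * a ^
    2 * B ^ 3 + 5 * β * b ^ 4 * B - β * b ^ 3 - 8 * β * b ^ 2 * B ^ 3 - 13 * β * b * B ^ 2 - 4 *
    β * b * m + 21 * β * B - 3 * a ^ 5 - 4 * a ^ 3 * b ^ 2 + a * b ^ 4 + 3 * a * b ^ 2 * B ^ 2 -
    55 * a * b * B + 7 * a) * h5

end MBRel

/-! ### The tangent line and the Hamiltonian of the main branch -/

/-- The reason for using m = b² - af in place of f: its numerator is the same as that of b'. -/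
lemma sq_sub_mbF {α β a b : ℂ} (hf : mbDenF α β a b ≠ 0) :
    b ^ 2 - a * mbF α β a b = mbNum α β a b / mbDenF α β a b := by
  rw [mbF, eq_div_iff hf]
  field_simp
  simp only [mbNum, mbDenF]
  ring

/-- After clearing the denominators of B and m, the first two relations become -a² and -βa²b times
the curve polynomial. -/
lemma mbRel_of_curve {α β a b : ℂ} (hB : mbDenB β a b ≠ 0)
    (hf : mbDenF α β a b ≠ 0) (hF : mbCurve α β a b = 0) :
    MBRel α β a b (mbB α β a b) (b ^ 2 - a * mbF α β a b) := by
  have h4 : mbB α β a b * mbDenB β a b = mbNum α β a b := div_mul_cancel₀ _ hB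
  have h5 : (b ^ 2 - a * mbF α β a b) * mbDenF α β a b = mbNum α β a b := by
    rw [sq_sub_mbF hf, div_mul_cancel₀ _ hf]
  generalize b ^ 2 - a * mbF α β a b = m at *
  generalize mbB α β a b = B at *
  have h1 : m * (B + α * a) = b := by
    apply mul_right_cancel₀ (mul_ne_zero hf hB)
    have e : mbNum α β a b * (mbNum α β a b + α * a * mbDenB β a b)
        - b * mbDenF α β a b * mbDenB β a b = -a ^ 2 * mbCurve α β a b := by
      simp only [mbNum, mbDenF, mbDenB, mbCurve]; ring
    linear_combination e - a ^ 2 * hF + m * mbDenF α β a b * h4 +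
      (mbNum α β a b + α * a * mbDenB β a b) * h5
  have h2 : (α * β - 1) * a * b * m = β * b ^ 2 - β * m + a * B := by
    apply mul_right_cancel₀ (mul_ne_zero hf hB)
    have e : (α * β - 1) * a * b * mbNum α β a b * mbDenB β a b
        - β * b ^ 2 * mbDenF α β a b * mbDenB β a b + β * mbNum α β a b * mbDenB β a b
        - a * mbNum α β a b * mbDenF α β a b = -β * a ^ 2 * b * mbCurve α β a b := by
      simp only [mbNum, mbDenF, mbDenB, mbCurve]; ring
    linear_combination e - β * a ^ 2 * b * hF
      + ((α * β - 1) * a * b + β) * mbDenB β a b * h5 - a * mbDenF α β a b * h4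
  -- The third relation eliminates m: multiply the second by B + αa and replace m(B + αa) by b.
  exact ⟨h1, h2, by linear_combination -(α * a + B) * h2 +
    ((α * β - 1) * a * b + β) * h1, h4, h5⟩

/-- With its denominators cleared, m(B + αa) = b is -a² times the curve equation. A vector killing
the differential of this relation therefore kills the differential of the curve polynomial, as a ≠
0. -/
lemma MBRel.tangent {α β a b B m : ℂ} (H : MBRel α β a b B m) (ha : a ≠ 0)
    (hF : mbCurve α β a b = 0) :
    mbCurveA α β a b * tanA α β a b B m + mbCurveB α β a b * tanB α β a b B m = 0 := by
  -- The differential of the polynomial identity N(N + αa D_B) - b D_F D_B = -a² `mbCurve`, where N,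
  -- D_B, D_F are the numerator and the two denominators.
  have e : ∀ x y : ℂ, dNum α β a b x y * (α * a * mbDenB β a b + 2 * mbNum α β a b)
      + mbNum α β a b * (α * x * mbDenB β a b + α * a * dDenB β a b x y)
      - y * mbDenF α β a b * mbDenB β a b - b * dDenF α β a b x y * mbDenB β a b
      - b * mbDenF α β a b * dDenB β a b x y + 2 * a * x * mbCurve α β a b
      + a ^ 2 * (mbCurveA α β a b * x + mbCurveB α β a b * y) = 0 := by
    intro x y
    simp only [mbNum, mbDenF, mbDenB, mbCurve, mbCurveA, mbCurveB, dNum, dDenB, dDenF]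
    ring
  have e := e (tanA α β a b B m) (tanB α β a b B m)
  have t1 := H.denB_identity
  have t2 := H.denF_identity
  have h1 := H.h1
  have h4 := H.h4
  have h5 := H.h5
  have ha3 : a ^ 3 ≠ 0 := pow_ne_zero _ ha
  generalize tanA α β a b B m = x at *
  generalize tanB α β a b B m = y at *
  generalize dNum α β a b x y = dN at *
  generalize dDenB β a b x y = dB at *
  generalize dDenF α β a b x y = dF at *
  generalize mbDenB β a b = DB at *
  generalize mbDenF α β a b = DF at *
  generalize mbNum α β a b = N at *
  generalize mbCurveA α β a b * x + mbCurveB α β a b * y = G at *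
  rw [hF] at e
  generalize diagDen b B m = δ at *
  apply mul_left_cancel₀ ha3
  subst h1 h5
  linear_combination a * e - DB * t2 + m * DF * t1 + a * dN * h4

/-- A vector tangent to the main-branch curve is a multiple of `(tanA, tanB)`, with a factor
determined by the derivative `B'` of the weight `b'`. -/
lemma MBRel.tangent_eq {α β a b B m x y B' : ℂ} (H : MBRel α β a b B m) (ha : a ≠ 0)
    (hB : mbDenB β a b ≠ 0) (hF : mbCurve α β a b = 0)
    (hr : mbCurveA α β a b ≠ 0 ∨ mbCurveB α β a b ≠ 0)
    (hxy : mbCurveA α β a b * x + mbCurveB α β a b * y = 0)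
    (hB' : mbDenB β a b * B' = dNum α β a b x y - B * dDenB β a b x y) :
    4 * β * diagDen b B m * x = (B' * a - x * B) * tanA α β a b B m ∧
      4 * β * diagDen b B m * y = (B' * a - x * B) * tanB α β a b B m := by
  have ht := H.tangent ha hF
  have t1 := H.denB_identity
  have hpar : x * tanB α β a b B m = y * tanA α β a b B m := by
    rcases hr with h | h
    · apply mul_left_cancel₀ h
      linear_combination tanB α β a b B m * hxy - y * ht
    · apply mul_left_cancel₀ h
      linear_combination x * ht - tanA α β a b B m * hxy
  simp only [dNum, dDenB] at t1 hB'
  generalize tanA α β a b B m = u at *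
  generalize tanB α β a b B m = v at *
  constructor <;> apply mul_left_cancel₀ hB
  · linear_combination (-a * u) * hB' + x * t1 + (a * (3 * β * b ^ 2 - (α - β) * a ^ 2 -
      2 * a ^ 3 * b - 4 * a * b ^ 3) - a * B * (β * (2 * a ^ 2 * b + 4 * b ^ 3) + 2 * a)) * hpar
  · linear_combination (-a * v) * hB' + y * t1 + (mbDenB β a b * B - a * (1 - 2 * (α - β) * a * b -
      5 * a ^ 4 - 3 * a ^ 2 * b ^ 2 - b ^ 4) + a * B * (β * (4 * a ^ 3 + 2 * a * b ^ 2) +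
      2 * b)) * hpar

/-- The relations between the entries of the main-branch Hamiltonian. -/
lemma MBRel.hamiltonian {α β a b B m x y B' η j φ A ψ ξ κ g g' : ℂ} (H : MBRel α β a b B m)
    (hβ : β ≠ 0) (ha : a ≠ 0)
    (hΔ : diagDen b B m ≠ 0) (hB0 : B ≠ 0) (hη : j * η ^ 2 = α * β - 1)
    (hag : a ^ 2 + b ^ 2 - m ≠ 0)
    (hg : (a ^ 2 + b ^ 2 - m) * g = a * (1 - b * B + (α * β - 1) * m ^ 2))
    (hφ : φ = B' * a - x * B)
    (hx : 4 * β * diagDen b B m * x = φ * tanA α β a b B m)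
    (hy : 4 * β * diagDen b B m * y = φ * tanB α β a b B m)
    (hA : a * A = x + φ * b) (hψ : a * ψ = A * b + y)
    (hξ : diagDen b B m * ξ = φ * a * (b ^ 2 - m - B ^ 2))
    (hκ : diagDen b B m * κ = φ * (η * m) * a)
    (hg' : B * g' = φ * g - j * κ * (η * m) * b - B') :
    g' + A + ξ = 0 ∧ j * κ ^ 2 = φ * ψ - ξ ^ 2 ∧ 4 * ξ * A = φ ^ 2 - φ * ψ + ψ ^ 2 ∧
      β * diagDen b B m * ψ = φ * psiNum α β a b B m := by
  have i1 := H.psi_identity ha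
  have i2 := H.quartic_identity ha
  have i3 := H.weightG_identity ha
  have eψ : β * diagDen b B m * ψ = φ * psiNum α β a b B m := by
    apply mul_left_cancel₀ (mul_ne_zero (by norm_num : (4 : ℂ) ≠ 0) (pow_ne_zero 2 ha))
    simp only [tanA, tanB] at hx hy
    linear_combination 4 * β * diagDen b B m * a * hψ
      + 4 * β * diagDen b B m * b * hA + b * hx + a * hy
  -- The first term of `tanA` cancels the contribution φb to aA.
  have eA : 4 * diagDen b B m * A = -φ * a * (2 * (b ^ 2 - m - B ^ 2)
      + (α ^ 2 - α * β + β ^ 2 + 2) * m) := by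
    apply mul_left_cancel₀ (mul_ne_zero hβ ha)
    simp only [tanA] at hx
    linear_combination 4 * β * diagDen b B m * hA + hx
  clear hx hy
  generalize psiNum α β a b B m = p at *
  generalize diagDen b B m = δ at *
  have hβδ : (β * δ) ^ 2 ≠ 0 := pow_ne_zero _ (mul_ne_zero hβ hΔ)
  refine ⟨?_, ?_, ?_, eψ⟩
  · apply mul_left_cancel₀ (mul_ne_zero (mul_ne_zero (mul_ne_zero hB0 hΔ) ha) hag)
    linear_combination a * δ * (a ^ 2 + b ^ 2 - m) * hg' + a * δ * φ * hg
      - a * (a ^ 2 + b ^ 2 - m) * j * η * m * b * hκ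
      - a ^ 2 * (a ^ 2 + b ^ 2 - m) * φ * m ^ 2 * b * hη + δ * (a ^ 2 + b ^ 2 - m) * hφ
      + B * δ * (a ^ 2 + b ^ 2 - m) * hA + B * a * (a ^ 2 + b ^ 2 - m) * hξ + φ * i3
  · apply mul_left_cancel₀ hβδ
    linear_combination β ^ 2 * j * (δ * κ + φ * η * m * a) * hκ + β ^ 2 * φ ^ 2 * m ^ 2 * a ^ 2 * hη
      - β * δ * φ * eψ + β ^ 2 * (δ * ξ + φ * a * (b ^ 2 - m - B ^ 2)) * hξ - β * φ ^ 2 * i1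
  · apply mul_left_cancel₀ hβδ
    linear_combination 4 * β ^ 2 * δ * A * hξ + β ^ 2 * φ * a * (b ^ 2 - m - B ^ 2) * eA
      + β * δ * φ * eψ - (β * δ * ψ + φ * p) * eψ + φ ^ 2 * i2

/-! ### The intertwiner near the diagonal -/

/-- Derivative of the intertwiner of `X(z)` and `X(z₀)` at `z = z₀`, for `Y = X(z₀)` and
`X' = X'(z₀)`. -/
def intertwinerDeriv (J₀ : ℂ) (Y X' : Weights) : Weights :=
  let φ := X'.b' * Y.a - X'.a * Y.b'
  let A := (X'.a + φ * Y.b) / Y.a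
  let κ := φ * Y.d * Y.a / rDen Y Y
  let ξ := φ * Y.a * (Y.f * Y.a - Y.b' * Y.b') / rDen Y Y
  { a := A
    b := (A * Y.b + X'.b) / Y.a
    b' := φ
    c := 0
    d := κ
    d' := J₀ ^ 2 * κ
    f := ξ
    g := (φ * Y.g - J₀ ^ 2 * κ * Y.d * Y.b - X'.b') / Y.b'
    h := A + (J₀ ^ 2)⁻¹ * ξ
    h' := A + J₀ ^ 2 * ξ }

/-- The factor `rB'` vanishes on the diagonal. In every product containing it only this factor has
to be differentiated, so the derivatives of the weights d, f, g and of `rDen` drop out. -/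
lemma hasWeightDerivAt_intertwiner (J₀ : ℂ) {X : ℂ → Weights} {X' : Weights} {z₀ : ℂ}
    (hX : HasWeightDerivAt X X' z₀) (ha : (X z₀).a ≠ 0) (hb : (X z₀).b' ≠ 0)
    (hD : rDen (X z₀) (X z₀) ≠ 0) :
    HasWeightDerivAt (fun z => intertwiner J₀ (X z) (X z₀)) (intertwinerDeriv J₀ (X z₀) X') z₀ := by
  set Y := X z₀ with hY
  have hz : rB' Y Y = 0 := by rw [rB']; ring
  have hB' : HasDerivAt (fun z => rB' (X z) Y) (X'.b' * Y.a - X'.a * Y.b') z₀ :=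
    (hX.b'.mul_const _).sub (hX.a.mul_const _)
  have hA : HasDerivAt (fun z => rA (X z) Y)
      ((X'.a + (X'.b' * Y.a - X'.a * Y.b') * Y.b) / Y.a) z₀ :=
    (hX.a.add (hB'.mul_const _)).div_const _
  have hA1 : rA Y Y = 1 := by rw [rA, hz]; field_simp; ring
  have hden : HasDerivAt (fun z => rDen (X z) Y)
      (X'.b' + Y.b * (X'.f * Y.a - X'.b' * Y.b')) z₀ :=
    hX.b'.add (((hX.f.mul_const _).sub (hX.b'.mul_const _)).const_mul _)
  have hd : HasDerivAt (fun z => rD (X z) Y) ((X'.b' * Y.a - X'.a * Y.b') * Y.d * Y.a / rDen Y Y)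
      z₀ := by
    refine (((hB'.mul hX.d).mul_const Y.a).div hden hD).congr_deriv ?_
    simp only [Pi.mul_apply, ← hY, hz]
    field_simp
    ring
  have hf : HasDerivAt (fun z => rF (X z) Y) ((X'.b' * Y.a - X'.a * Y.b') * Y.a *
      (Y.f * Y.a - Y.b' * Y.b') / rDen Y Y) z₀ := by
    refine (((hB'.mul_const Y.a).mul ((hX.f.mul_const Y.a).sub (hX.b'.mul_const Y.b'))).div
      hden hD).congr_deriv ?_
    simp only [Pi.mul_apply, Pi.sub_apply, ← hY, hz]
    field_simp
    ring
  have hD0 : rD Y Y = 0 := by simp [rD, hz]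
  refine ⟨hA, ?_, hB', hasDerivAt_const _ _, hd, hd.const_mul _, hf, ?_,
    hA.add (hf.const_mul _), hA.add (hf.const_mul _)⟩
  · refine (((hA.mul hX.b).sub_const Y.b).div hX.a ha).congr_deriv ?_
    simp only [Pi.mul_apply, ← hY, hA1, intertwinerDeriv]
    field_simp
    ring
  · refine ((((hB'.mul hX.g).add_const Y.b').sub
      (((hd.const_mul (J₀ ^ 2)).mul hX.d).mul_const Y.b)).div hX.b' hb).congr_deriv ?_
    simp only [Pi.mul_apply, Pi.sub_apply, ← hY, hz, hD0, intertwinerDeriv]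
    field_simp
    ring

lemma intertwiner_self (J₀ : ℂ) {Y : Weights} (ha : Y.a ≠ 0) (hb : Y.b' ≠ 0) :
    intertwiner J₀ Y Y = permWeights := by
  have hz : rB' Y Y = 0 := by rw [rB']; ring
  have hA : rA Y Y = 1 := by rw [rA, hz]; field_simp; ring
  have hB : rB Y Y = 0 := by rw [rB, hA]; ring
  have hd : rD Y Y = 0 := by simp [rD, hz]
  have hf : rF Y Y = 0 := by simp [rF, hz]
  have hg : rG J₀ Y Y = 1 := by rw [rG, hd, hz]; field_simp; ring
  simp [intertwiner, permWeights, hz, hA, hB, hd, hf, hg]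

/-! ### Derivatives along a parametrization of the main-branch curve -/

section paramDeriv

variable {a b : ℂ → ℂ} {x y z : ℂ}

lemma hasDerivAt_quartic (ha : HasDerivAt a x z) (hb : HasDerivAt b y z) :
    HasDerivAt (fun z => a z ^ 4 + a z ^ 2 * b z ^ 2 + b z ^ 4)
      ((4 * a z ^ 3 + 2 * a z * b z ^ 2) * x + (2 * a z ^ 2 * b z + 4 * b z ^ 3) * y) z :=
  (((ha.fun_pow 4).add ((ha.fun_pow 2).mul (hb.fun_pow 2))).add (hb.fun_pow 4)).congr_deriv
    (by norm_num; ring)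

lemma hasDerivAt_mbDenB (β : ℂ) (ha : HasDerivAt a x z) (hb : HasDerivAt b y z) :
    HasDerivAt (fun z => mbDenB β (a z) (b z)) (dDenB β (a z) (b z) x y) z :=
  (((hasDerivAt_quartic ha hb).const_mul β).add ((ha.const_mul 2).mul hb)).congr_deriv
    (by rw [dDenB]; ring)

lemma hasDerivAt_mbDenF (α β : ℂ) (ha : HasDerivAt a x z) (hb : HasDerivAt b y z) :
    HasDerivAt (fun z => mbDenF α β (a z) (b z)) (dDenF α β (a z) (b z) x y) z :=
  ((((ha.fun_pow 3).const_mul (β ^ 2)).add ((ha.const_mul (α * β - 2)).mul (hb.fun_pow 2))).add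
    (hb.const_mul β)).congr_deriv (by rw [dDenF]; norm_num; ring)

lemma hasDerivAt_mbNum (α β : ℂ) (ha : HasDerivAt a x z) (hb : HasDerivAt b y z) :
    HasDerivAt (fun z => mbNum α β (a z) (b z)) (dNum α β (a z) (b z) x y) z :=
  (((hb.fun_pow 3).const_mul β).add (ha.mul ((((ha.const_mul (α - β)).mul hb).const_sub 1).sub
    (hasDerivAt_quartic ha hb)))).congr_deriv (by rw [dNum]; norm_num; ring)

lemma hasDerivAt_mbCurve (α β : ℂ) (ha : HasDerivAt a x z) (hb : HasDerivAt b y z) :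
    HasDerivAt (fun z => mbCurve α β (a z) (b z))
      (mbCurveA α β (a z) (b z) * x + mbCurveB α β (a z) (b z) * y) z := by
  have hq := hasDerivAt_quartic ha hb
  have hab := ha.mul hb
  refine (((((((hq.fun_pow 2).const_mul (α * β - 1)).add
    ((((hq.const_mul β).add hab).const_mul (2 - α * β + α ^ 2 + β ^ 2)).mul hab)).sub
    ((ha.fun_pow 4).const_mul (α * β - 2))).add
    (((ha.fun_pow 2).const_mul (β ^ 2)).mul (hb.fun_pow 2))).sub
    ((hb.fun_pow 4).const_mul (2 - α * β + β ^ 2))).sub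
    ((ha.const_mul (2 * β)).mul hb)).sub_const 1 |>.congr_deriv ?_
  simp only [mbCurveA, mbCurveB, Pi.mul_apply]
  norm_num
  ring

lemma deriv_mbCurve_fst (α β a b : ℂ) :
    deriv (fun x => mbCurve α β x b) a = mbCurveA α β a b := by
  have h := hasDerivAt_mbCurve α β (hasDerivAt_id a) (hasDerivAt_const a b)
  simpa using h.deriv

lemma deriv_mbCurve_snd (α β a b : ℂ) :
    deriv (fun y => mbCurve α β a y) b = mbCurveB α β a b := by
  have h := hasDerivAt_mbCurve α β (hasDerivAt_const b a) (hasDerivAt_id b)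
  simpa using h.deriv

open scoped ContDiff in
lemma contDiff_mbCurve (α β : ℂ) :
    ContDiff ℂ ω (fun p : ℂ × ℂ => mbCurve α β p.1 p.2) := by
  unfold mbCurve
  fun_prop

lemma hasDerivAt_mbB (α β : ℂ) (ha : HasDerivAt a x z) (hb : HasDerivAt b y z)
    (hB : mbDenB β (a z) (b z) ≠ 0) :
    ∃ B', HasDerivAt (fun z => mbB α β (a z) (b z)) B' z ∧
      mbDenB β (a z) (b z) * B' =
        dNum α β (a z) (b z) x y - mbB α β (a z) (b z) * dDenB β (a z) (b z) x y := by
  refine ⟨_, (hasDerivAt_mbNum α β ha hb).div (hasDerivAt_mbDenB β ha hb) hB, ?_⟩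
  have : mbB α β (a z) (b z) = mbNum α β (a z) (b z) / mbDenB β (a z) (b z) := rfl
  rw [this]
  field_simp

/-- The derivative of the weight `f`, in terms of the derivative of `m = b² - a f`. -/
lemma hasDerivAt_mbF (α β : ℂ) (ha : HasDerivAt a x z) (hb : HasDerivAt b y z)
    (ha0 : a z ≠ 0) (hf : mbDenF α β (a z) (b z) ≠ 0) :
    ∃ f', HasDerivAt (fun z => mbF α β (a z) (b z)) f' z ∧
      mbDenF α β (a z) (b z) * (2 * b z * y - mbF α β (a z) (b z) * x - a z * f') =
        dNum α β (a z) (b z) x y -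
          (b z ^ 2 - a z * mbF α β (a z) (b z)) * dDenF α β (a z) (b z) x y := by
  have hm := (hasDerivAt_mbNum α β ha hb).div (hasDerivAt_mbDenF α β ha hb) hf
  have hh := (((hb.fun_pow 2).sub hm).div ha ha0)
  -- Near z the weight f equals (b² - m)/a with m = `mbNum`/`mbDenF`, since neither a nor `mbDenF`
  -- vanishes there.
  refine ⟨_, hh.congr_of_eventuallyEq ?_, ?_⟩
  · have e1 := ha.continuousAt.eventually_ne ha0
    have e2 := (hasDerivAt_mbDenF α β ha hb).continuousAt.eventually_ne hf
    filter_upwards [e1, e2] with w h1 h2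
    have := sq_sub_mbF (α := α) (β := β) (a := a w) (b := b w) h2
    simp only [Pi.div_apply, Pi.sub_apply, ← this]
    field_simp
    ring
  · have e := sq_sub_mbF (α := α) (β := β) (a := a z) (b := b z) hf
    have e' : mbF α β (a z) (b z) =
        (b z ^ 2 - mbNum α β (a z) (b z) / mbDenF α β (a z) (b z)) / a z := by
      rw [← e]; field_simp; ring
    rw [e']
    simp only [Pi.div_apply, Pi.sub_apply]
    norm_num
    field_simp
    ring

/-- Derivative of the weights of the main-branch Lax operator. -/
lemma hasWeightDerivAt_mbLax (J₀ α β η : ℂ) {B' f' : ℂ} (ha : HasDerivAt a x z)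
    (hb : HasDerivAt b y z) (hB : HasDerivAt (fun z => mbB α β (a z) (b z)) B' z)
    (hf : HasDerivAt (fun z => mbF α β (a z) (b z)) f' z)
    (haf : a z + mbF α β (a z) (b z) ≠ 0) :
    HasWeightDerivAt (fun z => mbLax J₀ α β η (a z) (b z))
      { a := x
        b := y
        b' := B'
        c := 0
        d := η * (2 * b z * y - mbF α β (a z) (b z) * x - a z * f')
        d' := J₀ ^ 2 * (η * (2 * b z * y - mbF α β (a z) (b z) * x - a z * f'))
        f := f'
        g := (-y * mbB α β (a z) (b z) - b z * B' + (α * β - 1) *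
            (2 * (b z ^ 2 - a z * mbF α β (a z) (b z)) *
              (2 * b z * y - mbF α β (a z) (b z) * x - a z * f'))
          - (mbLax J₀ α β η (a z) (b z)).g * (x + f')) / (a z + mbF α β (a z) (b z))
        h := x + (J₀ ^ 2)⁻¹ * f'
        h' := x + J₀ ^ 2 * f' } z := by
  have hm : HasDerivAt (fun z => b z ^ 2 - a z * mbF α β (a z) (b z))
      (2 * b z * y - mbF α β (a z) (b z) * x - a z * f') z :=
    ((hb.fun_pow 2).sub (ha.mul hf)).congr_deriv (by norm_num; ring)
  refine ⟨ha, hb, hB, hasDerivAt_const _ _, hm.const_mul _, (hm.const_mul _).const_mul _, hf, ?_,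
    ha.add (hf.const_mul _), ha.add (hf.const_mul _)⟩
  refine ((((hb.mul hB).const_sub 1).add ((hm.fun_pow 2).const_mul (α * β - 1))).div
    (ha.add hf) haf).congr_deriv ?_
  simp only [mbLax, Pi.mul_apply, Pi.add_apply]
  norm_num
  field_simp
  ring

end paramDeriv

/-! ### The three relations and the choice of the twist -/

/-- The relations that characterize generalized Bariev Hamiltonians, up to a twist, among the
nineteen-vertex Hamiltonians. -/
structure BarievRel (j : ℂ) (w : Weights) : Prop where
  c : w.c = 0
  d' : w.d' = j * w.d
  h : w.h = w.a + j⁻¹ * w.f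
  h' : w.h' = w.a + j * w.f
  g : w.g + w.a + w.f = 0
  dd : j * w.d ^ 2 = w.b' * w.b - w.f ^ 2
  a : 4 * w.f * w.a = w.b' ^ 2 - w.b' * w.b + w.b ^ 2

lemma BarievRel.twistsToHGB {J j : ℂ} (hj : j ^ 2 - j + 1 = 0) (hJ : J = j ^ 2) {w : Weights}
    (H : BarievRel j w) (hn : NonzeroEntries (braided w)) : TwistsToHGB J (braided w) := by
  obtain ⟨h1, h2, h3⟩ := hn
  intro s hs
  rw [braided_entry_b', braided_entry_b, braided_entry_f] at *
  rw [braided_entry_d'] at *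
  exact twist_braided_eq_HGB hj hJ H.c H.d' H.h H.h' h1 h2 h3 H.g H.dd H.a hs

/-- A nineteen-vertex Hamiltonian with prescribed entries is a twisted generalized Bariev
Hamiltonian. -/
lemma BarievRel.exists_twist {J j φ ψ ξ : ℂ} (hj : j ^ 2 - j + 1 = 0) (hJ : J = j ^ 2)
    {w : Weights} (H : BarievRel j w) (hφ : w.b' = φ) (hψ : w.b = ψ) (hξ : w.f = ξ)
    (hφ0 : φ ≠ 0) (hξ0 : ξ ≠ 0) (hne : ψ * φ ≠ ξ ^ 2) :
    ∃ s, s ≠ 0 ∧ twist s (braided w) = HGB J φ ψ ξ := by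
  subst hφ hψ hξ
  have hj0 : j ≠ 0 := by rintro rfl; norm_num at hj
  -- By the relation j d² = φψ - ξ², the hypothesis φψ ≠ ξ² is what keeps the twist parameter away
  -- from zero.
  have hd : w.d ≠ 0 := by
    intro h
    apply hne
    have := H.dd
    rw [h] at this
    linear_combination -this
  have hd' : w.d' ≠ 0 := by rw [H.d']; exact mul_ne_zero hj0 hd
  obtain ⟨s, hs⟩ := IsAlgClosed.exists_pow_nat_eq (w.d' / w.b') (n := 2) (by norm_num)
  refine ⟨s, ?_, twist_braided_eq_HGB hj hJ H.c H.d' H.h H.h' hφ0 hξ0 hd' H.g H.dd H.a hs⟩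
  rintro rfl
  exact div_ne_zero hd' hφ0 (by rw [← hs]; ring)

lemma intertwinerDeriv_spec (J₀ : ℂ) {Y : Weights} (X' : Weights) (ha : Y.a ≠ 0) (hb : Y.b' ≠ 0)
    (hD : rDen Y Y ≠ 0) {w : Weights} (hw : w = intertwinerDeriv J₀ Y X') :
    w.b' = X'.b' * Y.a - X'.a * Y.b' ∧ Y.a * w.a = X'.a + w.b' * Y.b ∧
      Y.a * w.b = w.a * Y.b + X'.b ∧
      rDen Y Y * w.f = w.b' * Y.a * (Y.f * Y.a - Y.b' * Y.b') ∧
      rDen Y Y * w.d = w.b' * Y.d * Y.a ∧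
      Y.b' * w.g = w.b' * Y.g - J₀ ^ 2 * w.d * Y.d * Y.b - X'.b' := by
  subst hw
  exact ⟨rfl, mul_div_cancel₀ _ ha, mul_div_cancel₀ _ ha, mul_div_cancel₀ _ hD,
    mul_div_cancel₀ _ hD, mul_div_cancel₀ _ hb⟩

/-! ### Main-branch Hamiltonian at a generic point -/

/-- The Hamiltonian of the main branch at a generic point. -/
lemma mbR_hamiltonian {J₀ α β η : ℂ} (hβ : β ≠ 0)
    (hη : J₀ ^ 2 * η ^ 2 = α * β - 1) {a b : ℂ → ℂ} {x y z₀ : ℂ} (hax : HasDerivAt a x z₀)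
    (hby : HasDerivAt b y z₀) (hF : mbCurve α β (a z₀) (b z₀) = 0)
    (hxy : mbCurveA α β (a z₀) (b z₀) * x + mbCurveB α β (a z₀) (b z₀) * y = 0)
    (hgen : MBGeneric J₀ α β η (a z₀) (b z₀)) :
    ∃ w, HasWeightDerivAt (fun z => mbR J₀ α β η (a z) (b z) (a z₀) (b z₀)) w z₀ ∧
      BarievRel (J₀ ^ 2) w ∧
      4 * β * rDen (mbLax J₀ α β η (a z₀) (b z₀)) (mbLax J₀ α β η (a z₀) (b z₀)) * y =
        w.b' * tanB α β (a z₀) (b z₀) (mbB α β (a z₀) (b z₀))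
          (b z₀ ^ 2 - a z₀ * mbF α β (a z₀) (b z₀)) ∧
      β * rDen (mbLax J₀ α β η (a z₀) (b z₀)) (mbLax J₀ α β η (a z₀) (b z₀)) * w.b =
        w.b' * psiNum α β (a z₀) (b z₀) (mbB α β (a z₀) (b z₀))
          (b z₀ ^ 2 - a z₀ * mbF α β (a z₀) (b z₀)) ∧
      rDen (mbLax J₀ α β η (a z₀) (b z₀)) (mbLax J₀ α β η (a z₀) (b z₀)) * w.f =
        w.b' * a z₀ * (a z₀ * mbF α β (a z₀) (b z₀) - mbB α β (a z₀) (b z₀) ^ 2) := by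
  obtain ⟨ha, hr, hB, hf, haf, hB0, hΔ⟩ := hgen
  rw [RegularPoint, deriv_mbCurve_fst, deriv_mbCurve_snd] at hr
  obtain ⟨B', hB', eB'⟩ := hasDerivAt_mbB α β hax hby hB
  -- Only differentiability of f matters here: its derivative does not enter the derivative of the
  -- intertwiner.
  obtain ⟨f', hf', -⟩ := hasDerivAt_mbF α β hax hby ha hf
  have hX := hasWeightDerivAt_mbLax J₀ α β η hax hby hB' hf' haf
  have hR := hasWeightDerivAt_intertwiner J₀ hX ha hB0 hΔ
  have H := mbRel_of_curve hB hf hF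
  have hden : rDen (mbLax J₀ α β η (a z₀) (b z₀)) (mbLax J₀ α β η (a z₀) (b z₀)) =
      diagDen (b z₀) (mbB α β (a z₀) (b z₀)) (b z₀ ^ 2 - a z₀ * mbF α β (a z₀) (b z₀)) := by
    simp only [rDen, mbLax, diagDen]; ring
  obtain ⟨tA, tB⟩ := H.tangent_eq ha hB hF hr hxy eB'
  have hΔ' := hΔ
  rw [hden] at hΔ
  have hag : a z₀ ^ 2 + b z₀ ^ 2 - (b z₀ ^ 2 - a z₀ * mbF α β (a z₀) (b z₀)) ≠ 0 := by
    have : a z₀ ^ 2 + b z₀ ^ 2 - (b z₀ ^ 2 - a z₀ * mbF α β (a z₀) (b z₀)) =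
      a z₀ * (a z₀ + mbF α β (a z₀) (b z₀)) := by ring
    rw [this]
    exact mul_ne_zero ha haf
  have hg : (a z₀ ^ 2 + b z₀ ^ 2 - (b z₀ ^ 2 - a z₀ * mbF α β (a z₀) (b z₀))) *
      (mbLax J₀ α β η (a z₀) (b z₀)).g = a z₀ * (1 - b z₀ * mbB α β (a z₀) (b z₀) +
        (α * β - 1) * (b z₀ ^ 2 - a z₀ * mbF α β (a z₀) (b z₀)) ^ 2) := by
    simp only [mbLax]
    field_simp
    ring
  have hrest : ∀ Y X' w, w = intertwinerDeriv J₀ Y X' → w.c = 0 ∧ w.d' = J₀ ^ 2 * w.d ∧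
      w.h = w.a + (J₀ ^ 2)⁻¹ * w.f ∧ w.h' = w.a + J₀ ^ 2 * w.f := by
    rintro Y X' w rfl
    exact ⟨rfl, rfl, rfl, rfl⟩
  generalize hw : intertwinerDeriv J₀ _ _ = w at hR
  have hrest := hrest _ _ _ hw.symm
  obtain ⟨s1, s2, s3, s4, s5, s6⟩ := intertwinerDeriv_spec J₀ _ ha hB0 hΔ' hw.symm
  rw [hden] at s4 s5
  simp only [mbLax] at s1 s2 s3 s4 s5 s6
  rw [← s1] at tA tB
  obtain ⟨k1, k2, k3, k4⟩ := H.hamiltonian hβ ha hΔ hB0 hη hag hg s1 tA tB s2 s3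
    (by rw [s4]; ring) (by rw [s5]) s6
  refine ⟨w, hR, ⟨hrest.1, hrest.2.1, hrest.2.2.1, hrest.2.2.2, k1, k2, k3⟩, ?_, ?_, ?_⟩
  · rw [hden]; exact tB
  · rw [hden]; exact k4
  · rw [hden, s4]; ring

/-! ### The special point of the main branch -/

/-- At the special point a = 1 and b = b' = 0. Hence r_b' = b', r_a = a and Δ = b', and the
remaining weights collapse to those of L. -/
lemma mbR_special_right {J₀ α β η a b : ℂ} (ha : a ≠ 0) (hB : mbB α β a b ≠ 0) :
    mbR J₀ α β η a b 1 0 = mbLax J₀ α β η a b := by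
  have hB1 : mbB α β 1 0 = 0 := by simp [mbB]
  have h1 : rB' (mbLax J₀ α β η a b) (mbLax J₀ α β η 1 0) = mbB α β a b := by
    simp [rB', mbLax, hB1]
  have h2 : rA (mbLax J₀ α β η a b) (mbLax J₀ α β η 1 0) = a := by
    rw [rA, h1]; simp [mbLax]
  have h3 : rB (mbLax J₀ α β η a b) (mbLax J₀ α β η 1 0) = b := by
    rw [rB, h2]; simp [mbLax, ha]
  have h4 : rDen (mbLax J₀ α β η a b) (mbLax J₀ α β η 1 0) = mbB α β a b := by
    simp [rDen, mbLax]
  have h5 : rD (mbLax J₀ α β η a b) (mbLax J₀ α β η 1 0) = (mbLax J₀ α β η a b).d := by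
    rw [rD, h4, h1]
    change _ * _ * 1 / _ = _
    field_simp
  have h6 : rF (mbLax J₀ α β η a b) (mbLax J₀ α β η 1 0) = mbF α β a b := by
    rw [rF, h4, h1]
    change _ * 1 * (mbF α β a b * 1 - _ * mbB α β 1 0) / _ = _
    rw [hB1]
    field_simp
    ring
  have h7 : rG J₀ (mbLax J₀ α β η a b) (mbLax J₀ α β η 1 0) = (mbLax J₀ α β η a b).g := by
    rw [rG, h1]
    change (_ + mbB α β 1 0 - _ * 0) / mbB α β a b = _
    rw [hB1]
    field_simp
    ring
  rw [mbR, intertwiner, h1, h2, h3, h5, h6, h7]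
  rfl

lemma perm_mul_EE (i j k l : Fin 3) : perm * EE i j k l = EE k j i l := by
  ext r c
  rw [perm_mul_apply, EE_apply, EE_apply]
  congr 1
  simp only [eq_iff_iff]
  tauto

/-- The weights of the main-branch Hamiltonian at the special point. -/
def specialWeights (J₀ α β η ρ v : ℂ) : Weights where
  a := v
  b := -α * ρ * v
  b' := -β * ρ * v
  c := 0
  d := -η * ρ * v
  d' := J₀ ^ 2 * (-η * ρ * v)
  f := ρ * v
  g := -v - ρ * v
  h := v + (J₀ ^ 2)⁻¹ * (ρ * v)
  h' := v + J₀ ^ 2 * (ρ * v)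

lemma smul_HMB0 (J₀ α β η v : ℂ) : v • HMB0 J₀ α β η =
    braided (specialWeights J₀ α β η (4 / (α ^ 2 - α * β + β ^ 2)) v) := by
  rw [braided_eq, HMB0]
  simp only [mul_add, perm_mul_EE, specialWeights]
  generalize 4 / (α ^ 2 - α * β + β ^ 2) = ρ
  module

/-- The gradient of the curve at (1, 0) is (4αβ, β(α² - αβ + β²)). Its second component is nonzero,
so a is a local coordinate there and the derivatives of all weights are determined by v = a'. Every
v occurs, by the implicit function theorem. -/
lemma mbSpecialHam_iff {J₀ α β η v : ℂ} {H : TwoSite} (hβ : β ≠ 0)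
    (hn : α ^ 2 - α * β + β ^ 2 ≠ 0) :
    MBSpecialHam J₀ α β η v H ↔ H = v • HMB0 J₀ α β η := by
  have hA : mbCurveA α β 1 0 = 4 * α * β := by simp only [mbCurveA]; ring
  have hB : mbCurveB α β 1 0 = β * (α ^ 2 - α * β + β ^ 2) := by simp only [mbCurveB]; ring
  have hB0 : mbCurveB α β 1 0 ≠ 0 := by rw [hB]; exact mul_ne_zero hβ hn
  have key : ∀ (a b : ℂ → ℂ) (z : ℂ), LocalParam (mbCurve α β) a b z → a z = 1 → b z = 0 →
      HasDerivAt a v z →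
      HasOpDerivAt (fun z => braided (mbLax J₀ α β η (a z) (b z))) (v • HMB0 J₀ α β η) z := by
    intro a b z hp ha hb hav
    have hby : HasDerivAt b (deriv b z) z := hp.2.1.differentiableAt.hasDerivAt
    have ht := hp.tangent (contDiff_mbCurve α β)
    rw [deriv_mbCurve_fst, deriv_mbCurve_snd, hav.deriv, ha, hb, hA, hB] at ht
    set y := deriv b z
    have hDB : mbDenB β (a z) (b z) = β := by rw [ha, hb, mbDenB]; ring
    have hDF : mbDenF α β (a z) (b z) = β ^ 2 := by rw [ha, hb, mbDenF]; ring
    have hBz : mbB α β (a z) (b z) = 0 := by rw [ha, hb]; simp [mbB]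
    have hFz : mbF α β (a z) (b z) = 0 := by rw [ha, hb]; simp [mbF]
    obtain ⟨B', hB', eB⟩ := hasDerivAt_mbB α β hav hby (by rw [hDB]; exact hβ)
    obtain ⟨f', hf', ef⟩ := hasDerivAt_mbF α β hav hby (by rw [ha]; exact one_ne_zero)
      (by rw [hDF]; exact pow_ne_zero _ hβ)
    have hX := hasWeightDerivAt_mbLax J₀ α β η hav hby hB' hf' (by rw [hFz, ha]; simp)
    rw [smul_HMB0]
    convert hX.braided using 2
    rw [hDB, hBz, ha, hb] at eB
    rw [hDF, hFz, ha, hb] at ef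
    simp only [dNum] at eB ef
    have hρ : 4 / (α ^ 2 - α * β + β ^ 2) * (α ^ 2 - α * β + β ^ 2) = 4 := div_mul_cancel₀ _ hn
    generalize 4 / (α ^ 2 - α * β + β ^ 2) = ρ at *
    -- The velocity of b comes from tangency; those of b' and f come from differentiating their
    -- quotient formulas, whose denominators at (1, 0) are β and β².
    have ey : y = -α * ρ * v := by
      apply mul_left_cancel₀ (mul_ne_zero hβ hn)
      linear_combination ht + α * β * v * hρ
    have eB' : B' = -β * ρ * v := by
      apply mul_left_cancel₀ hβ
      rw [eB, ey]
      linear_combination v * hρ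
    have ef' : f' = ρ * v := by
      apply mul_left_cancel₀ (pow_ne_zero 2 hβ)
      rw [ey] at ef
      linear_combination -ef - v * hρ
    have hg1 : (mbLax J₀ α β η (a z) (b z)).g = 1 := by
      rw [ha, hb] at hFz ⊢
      simp [mbLax, hFz]
    rw [hg1, hBz, hFz, ha, hb]
    simp only [specialWeights, Weights.mk.injEq]
    rw [ey, eB', ef']
    refine ⟨trivial, rfl, rfl, trivial, ?_, ?_, rfl, ?_, rfl, rfl⟩ <;> ring
  constructor
  · rintro ⟨a, b, z, hp, ha, hb, hv, hH⟩
    exact hH.unique (key a b z hp ha hb (hv ▸ hp.1.differentiableAt.hasDerivAt))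
  · rintro rfl
    have h0 : mbCurve α β 1 0 = 0 := by rw [mbCurve]; ring
    obtain ⟨a, b, hp, ha, hb, hav, -⟩ := exists_localParam (contDiff_mbCurve α β) h0
      (u := v) (v := -mbCurveA α β 1 0 * v / mbCurveB α β 1 0)
      (Or.inr (by rw [deriv_mbCurve_snd]; exact hB0))
      (by rw [deriv_mbCurve_fst, deriv_mbCurve_snd]; field_simp; ring)
    exact ⟨a, b, 0, hp, ha, hb, hav.deriv, key a b 0 hp ha hb hav⟩

/-- The factor -`upsilon` turns ρ into ξ, so the weights b, b', f become -αξ = ψ, -βξ = φ and ξ, and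
`twist_braided_eq_HGB` applies. -/
lemma HGB_eq_twist_HMB0 {J J₀ φ ψ ξ α β η s : ℂ} (hj : (J₀ ^ 2) ^ 2 - J₀ ^ 2 + 1 = 0)
    (hJ : J = (J₀ ^ 2) ^ 2) (hφ : φ ≠ 0) (hξ : ξ ≠ 0) (hn : φ ^ 2 - φ * ψ + ψ ^ 2 ≠ 0)
    (hne : ψ * φ ≠ ξ ^ 2) (hα : α = -ψ / ξ) (hβ : β = -φ / ξ)
    (hη : J₀ ^ 2 * η ^ 2 = α * β - 1) (hs : s ^ 2 = J₀ ^ 2 * η / β) :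
    HGB J φ ψ ξ = twist s ((-upsilon φ ψ ξ) • HMB0 J₀ α β η) := by
  have hj0 : J₀ ^ 2 ≠ 0 := by intro h; rw [h] at hj; norm_num at hj
  have hρ : (4 / (α ^ 2 - α * β + β ^ 2)) * -upsilon φ ψ ξ = ξ := by
    have : α ^ 2 - α * β + β ^ 2 = (φ ^ 2 - φ * ψ + ψ ^ 2) / ξ ^ 2 := by
      rw [hα, hβ]; field_simp; ring
    rw [this, upsilon]
    generalize φ ^ 2 - φ * ψ + ψ ^ 2 = n at hn
    field_simp
  have hη0 : η ≠ 0 := by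
    rintro rfl
    apply hne
    rw [hα, hβ] at hη
    field_simp at hη
    linear_combination -hη
  have hβξ : -β * ξ = φ := by rw [hβ]; field_simp
  have hαξ : -α * ξ = ψ := by rw [hα]; field_simp
  have hβ0 : β ≠ 0 := by rintro rfl; apply hφ; rw [← hβξ]; ring
  rw [smul_HMB0]
  -- From here on the local υ is the negative of `upsilon`, that is, the weight a of the scaled
  -- operator.
  generalize hυ : -upsilon φ ψ ξ = υ at hρ
  have hυ' : 4 * ξ * υ = φ ^ 2 - φ * ψ + ψ ^ 2 := by rw [← hυ, upsilon]; field_simp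
  have hb : (specialWeights J₀ α β η (4 / (α ^ 2 - α * β + β ^ 2)) υ).b = ψ := by
    rw [← hαξ, ← hρ, specialWeights]; ring
  have hb' : (specialWeights J₀ α β η (4 / (α ^ 2 - α * β + β ^ 2)) υ).b' = φ := by
    rw [← hβξ, ← hρ, specialWeights]; ring
  have hf : (specialWeights J₀ α β η (4 / (α ^ 2 - α * β + β ^ 2)) υ).f = ξ := hρ
  have hd : (specialWeights J₀ α β η (4 / (α ^ 2 - α * β + β ^ 2)) υ).d = -η * ξ := by
    rw [← hρ, specialWeights]; ring
  have hd' : (specialWeights J₀ α β η (4 / (α ^ 2 - α * β + β ^ 2)) υ).d' =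
      J₀ ^ 2 * (-η * ξ) := by
    rw [← hd]; rfl
  have ha : (specialWeights J₀ α β η (4 / (α ^ 2 - α * β + β ^ 2)) υ).a = υ := rfl
  have hg : (specialWeights J₀ α β η (4 / (α ^ 2 - α * β + β ^ 2)) υ).g = -υ - ξ := by
    rw [← hρ, specialWeights]
  have hc : (specialWeights J₀ α β η (4 / (α ^ 2 - α * β + β ^ 2)) υ).c = 0 := rfl
  have hh : (specialWeights J₀ α β η (4 / (α ^ 2 - α * β + β ^ 2)) υ).h =
    υ + (J₀ ^ 2)⁻¹ * ξ := by rw [← hρ, specialWeights]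
  have hh' : (specialWeights J₀ α β η (4 / (α ^ 2 - α * β + β ^ 2)) υ).h' =
    υ + J₀ ^ 2 * ξ := by rw [← hρ, specialWeights]
  generalize specialWeights J₀ α β η (4 / (α ^ 2 - α * β + β ^ 2)) υ = w at *
  have hd0 : w.d' ≠ 0 := by
    rw [hd']; exact mul_ne_zero hj0 (mul_ne_zero (neg_ne_zero.2 hη0) hξ)
  rw [← hb, ← hb', ← hf]
  refine (twist_braided_eq_HGB hj hJ hc (by rw [hd', hd]) (by rw [hh, ha, hf])
    (by rw [hh', ha, hf]) (by rwa [hb']) (by rwa [hf]) hd0 (by rw [hg, ha, hf]; ring) ?_ ?_ ?_).symm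
  · rw [hd, hb, hb', hf, ← hβξ, ← hαξ]
    linear_combination ξ ^ 2 * hη
  · rw [ha, hb, hb', hf, hυ']
  · rw [hs, hd', hb', ← hβξ]
    field_simp

/-- The generalized Bariev Hamiltonian as a main-branch Hamiltonian at the special point. -/
lemma exists_mbSpecialHam {J J₀ φ ψ ξ : ℂ} (hj : (J₀ ^ 2) ^ 2 - J₀ ^ 2 + 1 = 0)
    (hJ : J = (J₀ ^ 2) ^ 2) (hφ : φ ≠ 0) (hξ : ξ ≠ 0) (hn : φ ^ 2 - φ * ψ + ψ ^ 2 ≠ 0)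
    (hne : ψ * φ ≠ ξ ^ 2) :
    ∃ (α β η v s : ℂ) (H : TwoSite), β ≠ 0 ∧ J₀ ^ 2 * η ^ 2 = α * β - 1 ∧ s ≠ 0 ∧
      MBSpecialHam J₀ α β η v H ∧ twist s H = HGB J φ ψ ξ := by
  have hj0 : J₀ ^ 2 ≠ 0 := by intro h; rw [h] at hj; norm_num at hj
  have hβ : -φ / ξ ≠ 0 := div_ne_zero (neg_ne_zero.2 hφ) hξ
  obtain ⟨η, hη⟩ := IsAlgClosed.exists_pow_nat_eq ((-ψ / ξ * (-φ / ξ) - 1) / J₀ ^ 2)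
    (n := 2) (by norm_num)
  have hη' : J₀ ^ 2 * η ^ 2 = -ψ / ξ * (-φ / ξ) - 1 := by
    rw [hη, mul_div_cancel₀ _ hj0]
  have hη0 : η ≠ 0 := by
    rintro rfl
    apply hne
    field_simp at hη'
    linear_combination -hη'
  obtain ⟨s, hs⟩ := IsAlgClosed.exists_pow_nat_eq (J₀ ^ 2 * η / (-φ / ξ)) (n := 2) (by norm_num)
  have hs0 : s ≠ 0 := by
    rintro rfl
    exact div_ne_zero (mul_ne_zero hj0 hη0) hβ (by rw [← hs]; ring)
  have hn' : (-ψ / ξ) ^ 2 - -ψ / ξ * (-φ / ξ) + (-φ / ξ) ^ 2 ≠ 0 := by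
    have : (-ψ / ξ) ^ 2 - -ψ / ξ * (-φ / ξ) + (-φ / ξ) ^ 2 =
      (φ ^ 2 - φ * ψ + ψ ^ 2) / ξ ^ 2 := by field_simp; ring
    rw [this]
    exact div_ne_zero hn (pow_ne_zero _ hξ)
  exact ⟨-ψ / ξ, -φ / ξ, η, -upsilon φ ψ ξ, s, _, hβ, hη', hs0, (mbSpecialHam_iff hβ hn').2 rfl,
    (HGB_eq_twist_HMB0 hj hJ hφ hξ hn hne rfl rfl hη' hs).symm⟩

/-! ### Generic points of the main branch -/

lemma mb_generic {J J₀ α β η : ℂ} (hj : (J₀ ^ 2) ^ 2 - J₀ ^ 2 + 1 = 0) (hJ : J = (J₀ ^ 2) ^ 2)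
    {a b : ℂ → ℂ} {z₀ : ℂ} (hβ : β ≠ 0) (hη : J₀ ^ 2 * η ^ 2 = α * β - 1)
    (hp : LocalParam (mbCurve α β) a b z₀) (hgen : MBGeneric J₀ α β η (a z₀) (b z₀)) :
    braided (mbR J₀ α β η (a z₀) (b z₀) (a z₀) (b z₀)) = 1 ∧
      ∃ H : TwoSite, MBDeriv J₀ α β η a b z₀ H ∧ (NonzeroEntries H → TwistsToHGB J H) := by
  have ht := hp.tangent (contDiff_mbCurve α β)
  rw [deriv_mbCurve_fst, deriv_mbCurve_snd] at ht
  obtain ⟨w, hw, hrel, -⟩ := mbR_hamiltonian hβ hη hp.1.differentiableAt.hasDerivAt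
    hp.2.1.differentiableAt.hasDerivAt hp.2.2.self_of_nhds ht hgen
  refine ⟨?_, braided w, hw.braided, hrel.twistsToHGB hj hJ⟩
  rw [mbR, intertwiner_self J₀ (Y := mbLax J₀ α β η (a z₀) (b z₀)) hgen.1 hgen.2.2.2.2.2.1,
    braided_permWeights]

/-- The generalized Bariev Hamiltonian as a main-branch Hamiltonian at a generic point with
`b = 0`. -/
lemma exists_mbDeriv {J J₀ φ ψ ξ : ℂ} (hj : (J₀ ^ 2) ^ 2 - J₀ ^ 2 + 1 = 0)
    (hJ : J = (J₀ ^ 2) ^ 2) (hφ : φ ≠ 0) (hψ : ψ ≠ 0) (hξ : ξ ≠ 0) (hφψ : φ ≠ ψ)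
    (hne : ψ * φ ≠ ξ ^ 2) :
    ∃ (α β η s : ℂ) (a b : ℂ → ℂ) (z₀ : ℂ) (H : TwoSite), β ≠ 0 ∧
      J₀ ^ 2 * η ^ 2 = α * β - 1 ∧ s ≠ 0 ∧ LocalParam (mbCurve α β) a b z₀ ∧
      MBGeneric J₀ α β η (a z₀) (b z₀) ∧ MBDeriv J₀ α β η a b z₀ H ∧
      twist s H = HGB J φ ψ ξ := by
  have hj0 : J₀ ^ 2 ≠ 0 := by intro h; rw [h] at hj; norm_num at hj
  -- At b = 0 the curve polynomial is ((αβ - 1)a⁴ + 1)(a⁴ - 1). On the locus of the first factor,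
  -- ψ/φ = -α/β and ξ/φ = -1/(βa²). Prescribing Y and X gives α = -Yβ and a²βX = -1, and the curve
  -- equation then becomes β²(X² - Y) = 1.
  obtain ⟨X, hX⟩ : ∃ X, X = ξ / φ := ⟨_, rfl⟩
  obtain ⟨Y, hY⟩ : ∃ Y, Y = ψ / φ := ⟨_, rfl⟩
  have hXφ : φ * X = ξ := by rw [hX]; field_simp
  have hYφ : φ * Y = ψ := by rw [hY]; field_simp
  have hX0 : X ≠ 0 := by rintro rfl; apply hξ; rw [← hXφ]; ring
  have hY0 : Y ≠ 0 := by rintro rfl; apply hψ; rw [← hYφ]; ring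
  have hY1 : 1 - Y ≠ 0 := by
    intro h; apply hφψ; rw [← hYφ]; linear_combination φ * h
  have hXY : X ^ 2 - Y ≠ 0 := by
    intro h; apply hne; rw [← hYφ, ← hXφ]; linear_combination -φ ^ 2 * h
  obtain ⟨β, hβ⟩ := IsAlgClosed.exists_pow_nat_eq (1 / (X ^ 2 - Y)) (n := 2) (by norm_num)
  replace hβ : β ^ 2 * (X ^ 2 - Y) = 1 := by rw [hβ]; field_simp
  have hβ0 : β ≠ 0 := by rintro rfl; norm_num at hβ
  obtain ⟨a, ha⟩ := IsAlgClosed.exists_pow_nat_eq (-1 / (β * X)) (n := 2) (by norm_num)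
  replace ha : a ^ 2 * β * X = -1 := by rw [ha]; field_simp
  have ha0 : a ≠ 0 := by rintro rfl; norm_num at ha
  obtain ⟨α, hα⟩ : ∃ α, α = -Y * β := ⟨_, rfl⟩
  have hα0 : α ≠ 0 := by rw [hα]; exact mul_ne_zero (neg_ne_zero.2 hY0) hβ0
  obtain ⟨η, hη⟩ := IsAlgClosed.exists_pow_nat_eq ((α * β - 1) / J₀ ^ 2) (n := 2) (by norm_num)
  replace hη : J₀ ^ 2 * η ^ 2 = α * β - 1 := by rw [hη, mul_div_cancel₀ _ hj0]
  have hlam : (α * β - 1) * a ^ 4 = -1 := by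
    rw [hα]; linear_combination a ^ 4 * hβ + (1 - a ^ 2 * β * X) * ha
  have hF : mbCurve α β a 0 = 0 := by
    rw [mbCurve]; linear_combination (a ^ 4 - 1) * hlam
  have hFa : mbCurveA α β a 0 = -4 * α * β * a ^ 3 := by
    rw [mbCurveA]; linear_combination 8 * a ^ 3 * hlam
  have hFa0 : mbCurveA α β a 0 ≠ 0 := by
    rw [hFa]
    exact mul_ne_zero (mul_ne_zero (mul_ne_zero (by norm_num) hα0) hβ0) (pow_ne_zero _ ha0)
  have hDB : mbDenB β a 0 ≠ 0 := by
    have : mbDenB β a 0 = β * a ^ 4 := by rw [mbDenB]; ring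
    rw [this]; exact mul_ne_zero hβ0 (pow_ne_zero _ ha0)
  have hDF : mbDenF α β a 0 ≠ 0 := by
    have : mbDenF α β a 0 = β ^ 2 * a ^ 3 := by rw [mbDenF]; ring
    rw [this]; exact mul_ne_zero (pow_ne_zero _ hβ0) (pow_ne_zero _ ha0)
  have hBv : mbB α β a 0 = (1 - a ^ 4) / (β * a ^ 3) := by
    rw [mbB, mbDenB]; field_simp; ring
  have hfv : mbF α β a 0 = -mbB α β a 0 / β := by
    rw [hBv, mbF, mbDenF]; field_simp; ring
  -- a⁴ = 1 would give β²X² = 1 and hence β²Y = 0; this is where ψ ≠ 0 enters the condition b' ≠ 0.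
  have ha4 : 1 - a ^ 4 ≠ 0 := by
    intro h
    apply mul_ne_zero (pow_ne_zero 2 hβ0) hY0
    linear_combination β ^ 2 * X ^ 2 * h - hβ + (a ^ 2 * β * X - 1) * ha
  have hB0 : mbB α β a 0 ≠ 0 := by
    rw [hBv]; exact div_ne_zero ha4 (mul_ne_zero hβ0 (pow_ne_zero _ ha0))
  -- a + f = 0 would mean (β² + 1)a⁴ = 1, that is Y = 1; hence the hypothesis φ ≠ ψ.
  have haf : a + mbF α β a 0 ≠ 0 := by
    intro h
    apply mul_ne_zero (pow_ne_zero 2 hβ0) hY1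
    rw [hfv, hBv] at h
    field_simp at h
    linear_combination β ^ 2 * X ^ 2 * h + hβ - (β ^ 2 + 1) * (a ^ 2 * β * X - 1) * ha
  have hden : rDen (mbLax J₀ α β η a 0) (mbLax J₀ α β η a 0) = mbB α β a 0 := by
    simp [rDen, mbLax]
  have hr : RegularPoint (mbCurve α β) a 0 := Or.inl (by rw [deriv_mbCurve_fst]; exact hFa0)
  have hgen : MBGeneric J₀ α β η a 0 := ⟨ha0, hr, hDB, hDF, haf, hB0, by rwa [hden]⟩
  have htB : ∀ m, tanB α β a 0 (mbB α β a 0) m = -4 * a * α * mbB α β a 0 := by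
    intro m; rw [tanB, psiNum]; ring
  -- The b-velocity for which 4βΔy = φ `tanB` holds with the prescribed φ. It may be chosen freely,
  -- because the a-derivative of the curve polynomial is nonzero.
  obtain ⟨y, hy⟩ : ∃ y, y = -φ * a * α / β := ⟨_, rfl⟩
  obtain ⟨A, B, hp, hA, hB, hax, hby⟩ := exists_localParam (contDiff_mbCurve α β) hF hr
    (u := -mbCurveB α β a 0 * y / mbCurveA α β a 0) (v := y)
    (by rw [deriv_mbCurve_fst, deriv_mbCurve_snd]; field_simp; ring)
  have hgen' : MBGeneric J₀ α β η (A 0) (B 0) := by rw [hA, hB]; exact hgen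
  obtain ⟨w, hw, hrel, e1, e2, e3⟩ := mbR_hamiltonian hβ0 hη hax hby hp.2.2.self_of_nhds
    (by rw [hA, hB]; field_simp; ring) hgen'
  rw [hA, hB, hden] at e1 e2 e3
  rw [htB] at e1
  have k1 : w.b' = φ := by
    apply mul_right_cancel₀ (mul_ne_zero (mul_ne_zero (mul_ne_zero (by norm_num : (-4 : ℂ) ≠ 0)
      ha0) hα0) hB0)
    rw [← e1, hy]; field_simp
  have k2 : w.b = ψ := by
    rw [k1, psiNum] at e2
    apply mul_left_cancel₀ (mul_ne_zero hβ0 hB0)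
    rw [e2, ← hYφ, hα]; ring
  have k3 : w.f = ξ := by
    rw [k1, hfv] at e3
    have e4 : w.f = φ * a * (-a / β - mbB α β a 0) := by
      apply mul_left_cancel₀ hB0
      rw [e3]; field_simp
    rw [e4, hBv, ← hXφ]
    field_simp
    linear_combination -ha
  obtain ⟨s, hs, hs'⟩ := hrel.exists_twist hj hJ k1 k2 k3 hφ hξ hne
  exact ⟨α, β, η, s, A, B, 0, _, hβ0, hη, hs, hp, hgen', hw.braided, hs'⟩

/-! ### Algebra of the special-branch curve -/

section specialAlgebra

variable {j Λ a b n x y : ℂ}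

/-- Differential of `sbN`. -/
def dN (j a b x y : ℂ) : ℂ := 2 * a * x + 2 * j * b * y

/-- Numerator of the entry `b'` of the special-branch Hamiltonian. -/
def sbU (j a b n x y : ℂ) : ℂ := (y * a - x * b) * n - a * b * dN j a b x y

/-- Numerator of the entry `b` of the special-branch Hamiltonian. -/
def sbS (j a b n x y : ℂ) : ℂ := (y * a - x * b) * n + a * b * dN j a b x y

/-- Partial derivative of `sbCurve` with respect to `a`. -/
def sbCurveA (j Λ a b : ℂ) : ℂ :=
  2 * a * (a ^ 4 + a ^ 2 * b ^ 2 + b ^ 4 + Λ * a * b)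
    + (a ^ 2 + j * b ^ 2) * (4 * a ^ 3 + 2 * a * b ^ 2 + Λ * b) - 2 * a

/-- Partial derivative of `sbCurve` with respect to `b`. -/
def sbCurveB (j Λ a b : ℂ) : ℂ :=
  2 * j * b * (a ^ 4 + a ^ 2 * b ^ 2 + b ^ 4 + Λ * a * b)
    + (a ^ 2 + j * b ^ 2) * (4 * b ^ 3 + 2 * a ^ 2 * b + Λ * a) + 2 * b

/-- Since j and 1 - j have sum and product 1, the quartic a⁴ + a²b² + b⁴ factors as (a² + jb²)(a² +
(1 - j)b²). -/
lemma sbCurve_reduced (h0 : j ^ 2 - j + 1 = 0) (hn : n = a ^ 2 + j * b ^ 2)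
    (hF : sbCurve j Λ a b = 0) :
    n * (n * (a ^ 2 + (1 - j) * b ^ 2) + Λ * a * b) + b ^ 2 - a ^ 2 = 0 := by
  rw [sbCurve, ← hn] at hF
  rw [← hF]
  linear_combination (a ^ 2 + (1 - j) * b ^ 2) * n * hn - n * b ^ 4 * h0

/-- The relation j κ² + ξ² = φψ for the special-branch entries, with denominators cleared and the
common factor j `sbU` removed. Because this factor is removed, the identity still carries
information when `sbU` vanishes. -/
lemma sb_psi_identity (h0 : j ^ 2 - j + 1 = 0) (hn : n = a ^ 2 + j * b ^ 2)
    (hF : sbCurve j Λ a b = 0) (hdF : sbCurveA j Λ a b * x + sbCurveB j Λ a b * y = 0) :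
    j ^ 2 * n ^ 4 * sbU j a b n x y + j * a ^ 2 * b ^ 2 * (n ^ 2 - j ^ 2) ^ 2 * sbU j a b n x y =
      sbS j a b n x y * (j * a ^ 2 + b ^ 2 * n ^ 2) ^ 2 := by
  replace hF := sbCurve_reduced h0 hn hF
  rw [sbCurveA, sbCurveB, ← hn] at hdF
  simp only [sbU, sbS, dN]
  linear_combination
    (2 * j ^ 2 * Λ * a ^ 4 * b * y - 3 * j ^ 2 * Λ * a ^ 2 * b * n * y + j ^ 2 * a ^ 5 * n * y -
    5 * j ^ 2 * a ^ 4 * b * n * x - j ^ 2 * a ^ 3 * n ^ 2 * y - j ^ 2 * a ^ 2 * b * n ^ 2 * x +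
    2 * j ^ 2 * a ^ 2 * b * x + 2 * j * Λ * a ^ 5 * x + 4 * j * Λ * a ^ 4 * b * y - j * Λ * a ^
    3 * n * x - 6 * j * Λ * a ^ 2 * b * n * y - j * Λ * a * n ^ 2 * x + 5 * j * a ^ 5 * n * y -
    9 * j * a ^ 4 * b * n * x - 5 * j * a ^ 3 * n ^ 2 * y + 2 * j * a ^ 3 * y - 3 * j * a ^ 2 *
    b * n ^ 2 * x + 4 * j * a ^ 2 * b * x - 2 * j * a * n * y + 4 * Λ * a ^ 5 * b ^ 2 * n * x +
    4 * Λ * a ^ 5 * x + 2 * Λ * a ^ 4 * b * n ^ 2 * y - 4 * Λ * a ^ 4 * b * y + 2 * Λ * a ^ 3 *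
    b ^ 2 * n ^ 2 * x + 4 * Λ * a ^ 3 * b ^ 2 * x - 2 * Λ * a ^ 3 * n * x - 2 * Λ * a ^ 2 * b *
    n ^ 3 * y + 2 * Λ * a * b ^ 2 * n * x - 2 * Λ * a * n ^ 2 * x + 4 * a ^ 7 * n ^ 2 * y - 4 *
    a ^ 7 * y + 4 * a ^ 6 * b * n ^ 2 * x + 2 * a ^ 5 * b ^ 4 * n ^ 3 * y - 2 * a ^ 5 * b ^ 2 *
    n ^ 2 * y - 12 * a ^ 5 * b ^ 2 * y - 2 * a ^ 5 * n ^ 3 * y + a ^ 5 * n * y - 2 * a ^ 4 * b ^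
    5 * n ^ 3 * x + 6 * a ^ 4 * b ^ 3 * n ^ 2 * x + 16 * a ^ 4 * b ^ 3 * x + 2 * a ^ 4 * b * n ^
    3 * x + 11 * a ^ 4 * b * n * x - 2 * a ^ 3 * b ^ 6 * n * y - 6 * a ^ 3 * b ^ 4 * n ^ 4 * y -
    2 * a ^ 3 * b ^ 4 * y + 30 * a ^ 3 * b ^ 2 * n * y - 2 * a ^ 3 * n ^ 4 * y - 4 * a ^ 3 * n ^
    2 * y + 10 * a ^ 3 * y + 2 * a ^ 2 * b ^ 7 * n * x + 2 * a ^ 2 * b ^ 5 * x + 2 * a ^ 2 * b ^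
    3 * n ^ 3 * x + 2 * a ^ 2 * b ^ 3 * n * x - 2 * a ^ 2 * b * n ^ 4 * x - 6 * a ^ 2 * b * n ^
    2 * x - 4 * a ^ 2 * b * x + 6 * a * b ^ 6 * n ^ 2 * y + 3 * a * b ^ 4 * n ^ 5 * y - 3 * a *
    b ^ 4 * n ^ 3 * y + 11 * a * b ^ 4 * n * y - 20 * a * b ^ 2 * n ^ 2 * y - 2 * a * b ^ 2 * y
    + a * n ^ 5 * y - 4 * a * n * y + b ^ 5 * n ^ 5 * x - b ^ 5 * n ^ 3 * x - b ^ 5 * n * x - b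
    * n ^ 5 * x) * h0 + (2 * j ^ 5 * a ^ 3 * b ^ 2 * y + 2 * j ^ 4 * Λ * a ^ 2 * b * y + 2 * j ^
    4 * a ^ 4 * b * x + 2 * j ^ 4 * a ^ 3 * b ^ 2 * y + j ^ 4 * a ^ 3 * n * y + j ^ 4 * a ^ 2 *
    b * n * x + 2 * j ^ 4 * a * b ^ 4 * y + 2 * j ^ 3 * Λ * a ^ 3 * x + 2 * j ^ 3 * Λ * a ^ 2 *
    b * y + j ^ 3 * Λ * a * n * x + 2 * j ^ 3 * a ^ 4 * b * x + 4 * j ^ 3 * a ^ 3 * n * y + 2 *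
    j ^ 3 * a ^ 2 * b ^ 3 * x + 2 * j ^ 3 * a ^ 2 * b * n * x + 2 * j ^ 3 * a * b ^ 4 * y + 6 *
    j ^ 3 * a * b ^ 2 * n * y + 2 * j ^ 3 * a * y - 4 * j ^ 2 * Λ * a ^ 4 * b * n * y + 2 * j ^
    2 * Λ * a ^ 3 * x - 6 * j ^ 2 * Λ * a ^ 2 * b * y + j ^ 2 * Λ * a * n * x - 12 * j ^ 2 * a ^
    3 * b ^ 2 * y - 4 * j ^ 2 * a ^ 3 * n * y + 2 * j ^ 2 * a ^ 2 * b ^ 3 * x + 4 * j ^ 2 * a ^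
    2 * b * n * x - 6 * j ^ 2 * a * b ^ 4 * y + 6 * j ^ 2 * a * b ^ 2 * n * y + 2 * j ^ 2 * a *
    y - 4 * j * Λ * a ^ 4 * b * n * y - 2 * j * Λ * a ^ 3 * x - 2 * j * Λ * a ^ 2 * b * n ^ 2 *
    y + 8 * j * Λ * a ^ 2 * b * y - j * Λ * a * n * x - 8 * j * a ^ 5 * n ^ 2 * y + 8 * j * a ^
    5 * y - 2 * j * a ^ 4 * b * n ^ 2 * x + 4 * j * a ^ 4 * b * x - 2 * j * a ^ 3 * b ^ 4 * n *
    y + 8 * j * a ^ 3 * b ^ 2 * y - 2 * j * a ^ 3 * n ^ 3 * y + 8 * j * a ^ 3 * n * y + 2 * j *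
    a ^ 2 * b ^ 5 * n * x - 4 * j * a ^ 2 * b ^ 3 * x - 4 * j * a ^ 2 * b * n ^ 3 * x - 4 * j *
    a ^ 2 * b * n * x + 8 * j * a * b ^ 4 * y - 7 * j * a * b ^ 2 * n * y + j * a * n ^ 4 * y -
    2 * j * a * y - j * b ^ 3 * n * x - j * b * n ^ 4 * x + 2 * Λ * a ^ 6 * b * n ^ 2 * y - 2 *
    Λ * a ^ 5 * b ^ 2 * n ^ 2 * x - 2 * Λ * a ^ 4 * b * n ^ 3 * y - 2 * Λ * a ^ 4 * b * n * y +
    4 * Λ * a ^ 3 * x + 2 * Λ * a ^ 2 * b ^ 3 * n * y + Λ * a ^ 2 * b * n ^ 4 * y - Λ * a ^ 2 *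
    b * n ^ 2 * y - 4 * Λ * a ^ 2 * b * y + Λ * a * b ^ 2 * n ^ 4 * x - Λ * a * b ^ 2 * n ^ 2 *
    x + 2 * Λ * a * n * x + 2 * a ^ 7 * n ^ 3 * y - 2 * a ^ 7 * n * y + 2 * a ^ 6 * b * n * x +
    2 * a ^ 5 * b ^ 2 * n ^ 3 * y + 2 * a ^ 5 * b ^ 2 * n * y - 2 * a ^ 5 * n ^ 4 * y + 4 * a ^
    5 * n ^ 2 * y - 2 * a ^ 5 * y - 4 * a ^ 4 * b ^ 3 * n * x + 2 * a ^ 4 * b * n ^ 4 * x + 4 *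
    a ^ 4 * b * n ^ 2 * x + 2 * a ^ 3 * b ^ 4 * n ^ 3 * y - 4 * a ^ 3 * b ^ 2 * n ^ 2 * y - 16 *
    a ^ 3 * b ^ 2 * y - a ^ 3 * n ^ 3 * y - 2 * a ^ 2 * b ^ 5 * n * x - 2 * a ^ 2 * b ^ 3 * n ^
    2 * x + 6 * a ^ 2 * b ^ 3 * x + a ^ 2 * b * n ^ 3 * x + 8 * a ^ 2 * b * n * x - 2 * a * b ^
    6 * n * y + 10 * a * b ^ 2 * n * y - a * n ^ 4 * y + 4 * a * y + b * n ^ 4 * x) * hn + (-4 *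
    j ^ 3 * a ^ 3 * b ^ 2 * y - 4 * j ^ 2 * a ^ 5 * y - 4 * j ^ 2 * a ^ 4 * b * x - 4 * j ^ 2 *
    a ^ 3 * b ^ 2 * y + 2 * j ^ 2 * a ^ 3 * n * y - 2 * j ^ 2 * a ^ 2 * b * n * x + 2 * j ^ 2 *
    a * n ^ 2 * y + 6 * j ^ 2 * a * y + 2 * j * a ^ 5 * b ^ 2 * n * y - 4 * j * a ^ 5 * y - 2 *
    j * a ^ 4 * b ^ 3 * n * x + 4 * j * a ^ 4 * b * x - 4 * j * a ^ 3 * b ^ 2 * n ^ 2 * y - 2 *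
    j * a ^ 3 * b ^ 2 * y + 4 * j * a ^ 3 * n * y + 4 * j * a ^ 2 * b * n * x + 4 * j * a * b ^
    4 * y + 3 * j * a * b ^ 2 * n ^ 3 * y - 3 * j * a * b ^ 2 * n * y + j * a * n ^ 2 * y - 6 *
    j * a * y + j * b ^ 3 * n ^ 3 * x - j * b ^ 3 * n * x + j * b * n ^ 2 * x + 2 * a ^ 7 * n *
    y - 2 * a ^ 6 * b * n * x - 4 * a ^ 5 * n ^ 2 * y - 2 * a ^ 5 * y - 4 * a ^ 4 * b * x + 2 *
    a ^ 3 * b ^ 2 * y + 2 * a ^ 3 * n ^ 3 * y - a ^ 3 * n * y + 2 * a ^ 2 * b ^ 3 * x + 2 * a ^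
    2 * b * n ^ 3 * x - 5 * a ^ 2 * b * n * x - a * b ^ 2 * n * y + 2 * a * n ^ 2 * y + 6 * a *
    y + b ^ 3 * n * x) * hF + (j ^ 4 * a * b + j ^ 3 * a * b - 3 * j ^ 2 * a * b - j * a * b * n
    ^ 2 + 4 * j * a * b + a ^ 3 * b * n ^ 3 - a * b ^ 3 * n - a * b * n ^ 4 + a * b * n ^ 2 - 2
    * a * b) * hdF

/-- The relation 4ξA = φ² - φψ + ψ² for the special-branch entries, with denominators cleared. The
combination proves it multiplied by n. -/
lemma sb_quadric_identity (h0 : j ^ 2 - j + 1 = 0) (hn : n = a ^ 2 + j * b ^ 2) (hn0 : n ≠ 0)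
    (hF : sbCurve j Λ a b = 0) (hdF : sbCurveA j Λ a b * x + sbCurveB j Λ a b * y = 0) :
    2 * j * sbU j a b n x y * a * b * (n ^ 2 - j ^ 2) * dN j a b x y * (a ^ 2 - j * b ^ 2) =
      (j * a ^ 2 + b ^ 2 * n ^ 2) * (j ^ 2 * sbU j a b n x y ^ 2
        - j * sbU j a b n x y * sbS j a b n x y + sbS j a b n x y ^ 2) := by
  replace hF := sbCurve_reduced h0 hn hF
  rw [sbCurveA, sbCurveB, ← hn] at hdF
  apply mul_left_cancel₀ hn0
  simp only [sbU, sbS, dN]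
  linear_combination
    (14 * j * Λ * a ^ 3 * b * n ^ 2 * y ^ 2 + 4 * j * Λ * a ^ 3 * b * y ^ 2 - 6 * j * Λ * a * b
    * n * y ^ 2 + 8 * j * a ^ 6 * n ^ 2 * y ^ 2 - 8 * j * a ^ 6 * y ^ 2 - j * a ^ 4 * n ^ 3 * y
    ^ 2 + 26 * j * a ^ 3 * b * n ^ 3 * x * y - 16 * j * a ^ 3 * b * n * x * y + 4 * j * a * b *
    x * y + 12 * Λ * a ^ 6 * n * x * y - 20 * Λ * a ^ 5 * b * n * x ^ 2 - 48 * Λ * a ^ 4 * b ^ 2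
    * n * x * y - 24 * Λ * a ^ 4 * n ^ 2 * x * y + 36 * Λ * a ^ 4 * x * y + 17 * Λ * a ^ 3 * b *
    n ^ 2 * x ^ 2 + 30 * Λ * a ^ 3 * b * n ^ 2 * y ^ 2 - 32 * Λ * a ^ 3 * b * x ^ 2 + 36 * Λ * a
    ^ 3 * b * y ^ 2 - 36 * Λ * a ^ 2 * b ^ 2 * n ^ 2 * x * y - 36 * Λ * a ^ 2 * b ^ 2 * x * y +
    26 * Λ * a ^ 2 * n ^ 3 * x * y - 50 * Λ * a ^ 2 * n * x * y + 8 * Λ * a * b * n ^ 3 * x ^ 2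
    - 12 * Λ * a * b * n ^ 3 * y ^ 2 - 16 * Λ * a * b * n * x ^ 2 - 54 * Λ * a * b * n * y ^ 2 +
    4 * Λ * b ^ 6 * n ^ 3 * x * y + 6 * Λ * b ^ 4 * n ^ 4 * x * y - 4 * Λ * b ^ 2 * n ^ 3 * x *
    y - 18 * Λ * b ^ 2 * n * x * y - 2 * Λ * n ^ 2 * x * y - 8 * a ^ 6 * n ^ 2 * x ^ 2 - 8 * a ^
    5 * b ^ 5 * n ^ 2 * x * y - 4 * a ^ 5 * b ^ 3 * n ^ 3 * x * y - 96 * a ^ 5 * b * n ^ 2 * x *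
    y + 124 * a ^ 5 * b * x * y + 8 * a ^ 4 * b ^ 6 * n ^ 2 * x ^ 2 + 4 * a ^ 4 * b ^ 4 * n ^ 3
    * x ^ 2 - 12 * a ^ 4 * b ^ 4 * n ^ 3 * y ^ 2 - 36 * a ^ 4 * b ^ 4 * n * y ^ 2 + 24 * a ^ 4 *
    b ^ 2 * n ^ 4 * y ^ 2 - 8 * a ^ 4 * b ^ 2 * n ^ 2 * x ^ 2 - 4 * a ^ 4 * b ^ 2 * n ^ 2 * y ^
    2 - 84 * a ^ 4 * b ^ 2 * x ^ 2 + 52 * a ^ 4 * b ^ 2 * y ^ 2 + 55 * a ^ 4 * n ^ 3 * x ^ 2 +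
    12 * a ^ 4 * n ^ 3 * y ^ 2 - 71 * a ^ 4 * n * x ^ 2 - 12 * a ^ 4 * n * y ^ 2 - 8 * a ^ 3 * b
    ^ 7 * n ^ 2 * x * y + 36 * a ^ 3 * b ^ 5 * n ^ 3 * x * y + 64 * a ^ 3 * b ^ 5 * n * x * y -
    16 * a ^ 3 * b ^ 3 * n ^ 4 * x * y - 56 * a ^ 3 * b ^ 3 * n ^ 2 * x * y - 88 * a ^ 3 * b ^ 3
    * x * y + 64 * a ^ 3 * b * n ^ 3 * x * y - 168 * a ^ 3 * b * n * x * y + 8 * a ^ 2 * b ^ 8 *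
    n ^ 2 * x ^ 2 - 8 * a ^ 2 * b ^ 8 * n ^ 2 * y ^ 2 - 12 * a ^ 2 * b ^ 6 * n ^ 3 * y ^ 2 - 28
    * a ^ 2 * b ^ 6 * n * x ^ 2 + 8 * a ^ 2 * b ^ 6 * n * y ^ 2 + 4 * a ^ 2 * b ^ 4 * n ^ 4 * x
    ^ 2 + 16 * a ^ 2 * b ^ 4 * n ^ 4 * y ^ 2 + 12 * a ^ 2 * b ^ 4 * n ^ 2 * x ^ 2 + 96 * a ^ 2 *
    b ^ 4 * n ^ 2 * y ^ 2 - 12 * a ^ 2 * b ^ 4 * x ^ 2 + 36 * a ^ 2 * b ^ 4 * y ^ 2 - 45 * a ^ 2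
    * b ^ 2 * n ^ 5 * y ^ 2 + 7 * a ^ 2 * b ^ 2 * n ^ 3 * x ^ 2 + 30 * a ^ 2 * b ^ 2 * n ^ 3 * y
    ^ 2 - 27 * a ^ 2 * b ^ 2 * n * x ^ 2 - 44 * a ^ 2 * b ^ 2 * n * y ^ 2 - 16 * a ^ 2 * n ^ 2 *
    x ^ 2 + 32 * a ^ 2 * x ^ 2 + 4 * a ^ 2 * y ^ 2 + 8 * a * b ^ 9 * n ^ 2 * x * y + 36 * a * b
    ^ 7 * n ^ 3 * x * y - 8 * a * b ^ 7 * n * x * y - 88 * a * b ^ 5 * n ^ 2 * x * y - 36 * a *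
    b ^ 5 * x * y + 26 * a * b ^ 3 * n ^ 5 * x * y + 20 * a * b ^ 3 * n ^ 3 * x * y - 164 * a *
    b ^ 3 * n * x * y + 16 * a * b * n ^ 2 * x * y + 4 * a * b * x * y + 24 * b ^ 8 * n ^ 3 * y
    ^ 2 - 4 * b ^ 6 * n ^ 4 * x ^ 2 + 24 * b ^ 6 * n ^ 4 * y ^ 2 - 4 * b ^ 6 * n ^ 2 * x ^ 2 - 4
    * b ^ 6 * n ^ 2 * y ^ 2 + 3 * b ^ 4 * n ^ 5 * x ^ 2 - 6 * b ^ 4 * n ^ 5 * y ^ 2 + 10 * b ^ 4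
    * n ^ 3 * x ^ 2 - 30 * b ^ 4 * n ^ 3 * y ^ 2 + 10 * b ^ 4 * n * x ^ 2 - 108 * b ^ 4 * n * y
    ^ 2 + 18 * b ^ 2 * n ^ 6 * y ^ 2 - 10 * b ^ 2 * n ^ 4 * x ^ 2 - 20 * b ^ 2 * n ^ 2 * y ^ 2 -
    36 * b ^ 2 * y ^ 2 - 4 * n * y ^ 2) * h0 + (8 * j ^ 5 * a ^ 2 * b ^ 4 * n * y ^ 2 + 12 * j ^
    4 * Λ * a * b ^ 3 * n * y ^ 2 + 16 * j ^ 4 * a ^ 3 * b ^ 3 * n * x * y + 12 * j ^ 4 * a ^ 2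
    * b ^ 4 * n * y ^ 2 + 12 * j ^ 4 * b ^ 6 * n * y ^ 2 - 8 * j ^ 3 * Λ * a ^ 3 * b * n * y ^ 2
    + 28 * j ^ 3 * Λ * a ^ 2 * b ^ 2 * n * x * y + 8 * j ^ 3 * Λ * a * b ^ 3 * n * y ^ 2 + 6 * j
    ^ 3 * Λ * a * b * n ^ 2 * y ^ 2 + 4 * j ^ 3 * Λ * a * b * y ^ 2 + 6 * j ^ 3 * Λ * b ^ 2 * n
    ^ 2 * x * y + 8 * j ^ 3 * a ^ 4 * b ^ 2 * n * x ^ 2 + 24 * j ^ 3 * a ^ 3 * b ^ 3 * n * x * y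
    - 4 * j ^ 3 * a ^ 3 * b * x * y - 4 * j ^ 3 * a ^ 2 * b ^ 4 * n * y ^ 2 + 8 * j ^ 3 * a ^ 2
    * b ^ 2 * y ^ 2 + 24 * j ^ 3 * a * b ^ 5 * n * x * y + 4 * j ^ 3 * a * b ^ 3 * x * y - 12 *
    j ^ 3 * a * b * n * x * y + 8 * j ^ 3 * b ^ 6 * n * y ^ 2 + 4 * j ^ 3 * b ^ 4 * y ^ 2 + 12 *
    j ^ 3 * b ^ 2 * n * y ^ 2 + 12 * j ^ 2 * Λ * a ^ 4 * n * x * y + 16 * j ^ 2 * Λ * a ^ 3 * b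
    * n * x ^ 2 + 8 * j ^ 2 * Λ * a ^ 3 * b * n * y ^ 2 + 32 * j ^ 2 * Λ * a ^ 2 * b ^ 2 * n * x
    * y - 12 * j ^ 2 * Λ * a ^ 2 * n ^ 2 * x * y + 36 * j ^ 2 * Λ * a ^ 2 * x * y + 12 * j ^ 2 *
    Λ * a * b ^ 3 * n * y ^ 2 + 6 * j ^ 2 * Λ * a * b * n ^ 2 * x ^ 2 + 12 * j ^ 2 * Λ * a * b *
    n ^ 2 * y ^ 2 + 32 * j ^ 2 * Λ * a * b * y ^ 2 + 4 * j ^ 2 * Λ * b ^ 2 * n ^ 2 * x * y + 2 *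
    j ^ 2 * Λ * n * x * y + 12 * j ^ 2 * a ^ 4 * b ^ 2 * n * x ^ 2 - 4 * j ^ 2 * a ^ 4 * x ^ 2 -
    8 * j ^ 2 * a ^ 3 * b ^ 3 * n * x * y + 56 * j ^ 2 * a ^ 3 * b * x * y + 12 * j ^ 2 * a ^ 2
    * b ^ 4 * n * x ^ 2 - 24 * j ^ 2 * a ^ 2 * b ^ 4 * n * y ^ 2 + 4 * j ^ 2 * a ^ 2 * b ^ 2 * x
    ^ 2 + 20 * j ^ 2 * a ^ 2 * b ^ 2 * y ^ 2 - 12 * j ^ 2 * a ^ 2 * n * x ^ 2 + 16 * j ^ 2 * a *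
    b ^ 5 * n * x * y + 52 * j ^ 2 * a * b ^ 3 * x * y + 12 * j ^ 2 * a * b * n * x * y - 12 * j
    ^ 2 * b ^ 6 * n * y ^ 2 + 56 * j ^ 2 * b ^ 4 * y ^ 2 + 20 * j ^ 2 * b ^ 2 * n * y ^ 2 + 4 *
    j ^ 2 * y ^ 2 + 4 * j * Λ * a ^ 7 * b * n * y ^ 2 + 4 * j * Λ * a ^ 5 * b ^ 3 * n * y ^ 2 +
    8 * j * Λ * a ^ 5 * b * n ^ 2 * y ^ 2 - 8 * j * Λ * a ^ 4 * b ^ 2 * n ^ 2 * x * y - 12 * j *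
    Λ * a ^ 4 * n * x * y + 4 * j * Λ * a ^ 3 * b ^ 5 * n * y ^ 2 + 10 * j * Λ * a ^ 3 * b * n ^
    3 * y ^ 2 + 24 * j * Λ * a ^ 3 * b * n * x ^ 2 + 28 * j * Λ * a ^ 3 * b * n * y ^ 2 - 18 * j
    * Λ * a ^ 2 * b ^ 2 * n ^ 3 * x * y + 8 * j * Λ * a ^ 2 * b ^ 2 * n * x * y + 12 * j * Λ * a
    ^ 2 * n ^ 2 * x * y - 36 * j * Λ * a ^ 2 * x * y + 60 * j * Λ * a * b ^ 3 * n * y ^ 2 - 12 *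
    j * Λ * a * b * n ^ 4 * y ^ 2 + 4 * j * Λ * a * b * n ^ 2 * x ^ 2 - 14 * j * Λ * a * b * n ^
    2 * y ^ 2 - 32 * j * Λ * a * b * y ^ 2 + 4 * j * Λ * b ^ 4 * n ^ 3 * x * y + 6 * j * Λ * b ^
    2 * n ^ 4 * x * y - 6 * j * Λ * b ^ 2 * n ^ 2 * x * y - 2 * j * Λ * n * x * y + 4 * j * a ^
    8 * n ^ 2 * y ^ 2 - 4 * j * a ^ 8 * y ^ 2 + 8 * j * a ^ 6 * n ^ 3 * y ^ 2 - 8 * j * a ^ 6 *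
    n * y ^ 2 - 4 * j * a ^ 4 * b ^ 2 * n * x ^ 2 + 8 * j * a ^ 4 * n ^ 4 * y ^ 2 + 40 * j * a ^
    4 * n ^ 2 * x ^ 2 + 28 * j * a ^ 4 * n ^ 2 * y ^ 2 - 36 * j * a ^ 4 * x ^ 2 - 36 * j * a ^ 4
    * y ^ 2 + 16 * j * a ^ 3 * b ^ 3 * n * x * y + 60 * j * a ^ 3 * b * n ^ 2 * x * y - 104 * j
    * a ^ 3 * b * x * y + 4 * j * a ^ 2 * b ^ 6 * y ^ 2 - 20 * j * a ^ 2 * b ^ 4 * n * x ^ 2 +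
    28 * j * a ^ 2 * b ^ 4 * n * y ^ 2 + 36 * j * a ^ 2 * b ^ 2 * x ^ 2 - 56 * j * a ^ 2 * b ^ 2
    * y ^ 2 - 18 * j * a ^ 2 * n ^ 5 * y ^ 2 + 10 * j * a ^ 2 * n ^ 3 * x ^ 2 + 18 * j * a ^ 2 *
    n ^ 3 * y ^ 2 + 2 * j * a ^ 2 * n * x ^ 2 - 32 * j * a * b ^ 5 * n * x * y - 4 * j * a * b ^
    3 * x * y - 12 * j * a * b * n ^ 3 * x * y - 8 * j * a * b * n * x * y + 12 * j * b ^ 6 * n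
    * y ^ 2 + 16 * j * b ^ 4 * y ^ 2 + 10 * j * b ^ 2 * n * x ^ 2 - 24 * j * b ^ 2 * n * y ^ 2 -
    4 * j * y ^ 2 + 8 * Λ * a ^ 7 * b * n * y ^ 2 - 8 * Λ * a ^ 6 * b ^ 2 * n * x * y + 8 * Λ *
    a ^ 5 * b ^ 3 * n * x ^ 2 + 8 * Λ * a ^ 5 * b ^ 3 * n * y ^ 2 - 4 * Λ * a ^ 5 * b * n ^ 2 *
    x ^ 2 + 8 * Λ * a ^ 5 * b * n ^ 2 * y ^ 2 - 8 * Λ * a ^ 4 * b ^ 4 * n * x * y + 12 * Λ * a ^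
    4 * b ^ 2 * n ^ 2 * x * y - 2 * Λ * a ^ 4 * n ^ 3 * x * y + 12 * Λ * a ^ 4 * n * x * y + 8 *
    Λ * a ^ 3 * b ^ 5 * n * x ^ 2 - 4 * Λ * a ^ 3 * b ^ 5 * n * y ^ 2 + 12 * Λ * a ^ 3 * b ^ 3 *
    n ^ 2 * y ^ 2 - 18 * Λ * a ^ 3 * b * n ^ 3 * x ^ 2 + 8 * Λ * a ^ 3 * b * n * x ^ 2 + 92 * Λ
    * a ^ 3 * b * n * y ^ 2 + 8 * Λ * a ^ 2 * b ^ 6 * n * x * y + 8 * Λ * a ^ 2 * b ^ 4 * n ^ 2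
    * x * y + 4 * Λ * a ^ 2 * b ^ 2 * n ^ 3 * x * y + 24 * Λ * a ^ 2 * b ^ 2 * n * x * y - 6 * Λ
    * a ^ 2 * n ^ 4 * x * y - 14 * Λ * a ^ 2 * n ^ 2 * x * y + 36 * Λ * a ^ 2 * x * y + 16 * Λ *
    a * b ^ 5 * n ^ 2 * y ^ 2 - 4 * Λ * a * b ^ 3 * n ^ 3 * x ^ 2 + 8 * Λ * a * b ^ 3 * n ^ 3 *
    y ^ 2 - 4 * Λ * a * b ^ 3 * n * x ^ 2 + 12 * Λ * a * b ^ 3 * n * y ^ 2 - 6 * Λ * a * b * n ^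
    4 * x ^ 2 - 2 * Λ * a * b * n ^ 4 * y ^ 2 + 4 * Λ * a * b * n ^ 2 * x ^ 2 + 8 * Λ * a * b *
    n ^ 2 * y ^ 2 + 36 * Λ * a * b * y ^ 2 - 4 * Λ * b ^ 4 * n ^ 3 * x * y - 2 * Λ * b ^ 2 * n ^
    4 * x * y + 6 * Λ * b ^ 2 * n ^ 2 * x * y + 2 * Λ * n * x * y - 4 * a ^ 8 * n ^ 2 * x ^ 2 +
    8 * a ^ 8 * n ^ 2 * y ^ 2 - 8 * a ^ 8 * y ^ 2 - 8 * a ^ 7 * b * n ^ 2 * x * y + 8 * a ^ 7 *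
    b * x * y - 4 * a ^ 6 * b ^ 2 * n ^ 2 * x ^ 2 + 16 * a ^ 6 * b ^ 2 * n ^ 2 * y ^ 2 - 8 * a ^
    6 * b ^ 2 * x ^ 2 - 20 * a ^ 6 * n ^ 3 * x ^ 2 + 8 * a ^ 6 * n ^ 3 * y ^ 2 - 4 * a ^ 6 * n *
    x ^ 2 - 8 * a ^ 6 * n * y ^ 2 - 16 * a ^ 5 * b ^ 3 * n ^ 2 * x * y + 4 * a ^ 5 * b * n ^ 3 *
    x * y - 20 * a ^ 5 * b * n * x * y - 4 * a ^ 4 * b ^ 4 * n ^ 2 * x ^ 2 + 4 * a ^ 4 * b ^ 4 *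
    n ^ 2 * y ^ 2 + 12 * a ^ 4 * b ^ 4 * y ^ 2 - 24 * a ^ 4 * b ^ 2 * n ^ 3 * x ^ 2 + 20 * a ^ 4
    * b ^ 2 * n ^ 3 * y ^ 2 + 8 * a ^ 4 * b ^ 2 * n * x ^ 2 - 4 * a ^ 4 * b ^ 2 * n * y ^ 2 - 28
    * a ^ 4 * n ^ 4 * x ^ 2 - 4 * a ^ 4 * n ^ 2 * x ^ 2 + 92 * a ^ 4 * n ^ 2 * y ^ 2 - 92 * a ^
    4 * y ^ 2 - 16 * a ^ 3 * b ^ 5 * n ^ 2 * x * y - 16 * a ^ 3 * b ^ 5 * x * y - 8 * a ^ 3 * b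
    ^ 3 * n ^ 3 * x * y - 4 * a ^ 3 * b ^ 3 * n * x * y - 8 * a ^ 3 * b * n ^ 4 * x * y - 64 * a
    ^ 3 * b * n ^ 2 * x * y + 80 * a ^ 3 * b * x * y - 4 * a ^ 2 * b ^ 6 * n ^ 2 * y ^ 2 + 8 * a
    ^ 2 * b ^ 6 * x ^ 2 - 4 * a ^ 2 * b ^ 6 * y ^ 2 - 20 * a ^ 2 * b ^ 4 * n ^ 3 * x ^ 2 + 16 *
    a ^ 2 * b ^ 4 * n ^ 3 * y ^ 2 + 16 * a ^ 2 * b ^ 4 * n * x ^ 2 - 40 * a ^ 2 * b ^ 4 * n * y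
    ^ 2 - 16 * a ^ 2 * b ^ 2 * n ^ 4 * x ^ 2 + 28 * a ^ 2 * b ^ 2 * n ^ 4 * y ^ 2 + 32 * a ^ 2 *
    b ^ 2 * n ^ 2 * x ^ 2 + 84 * a ^ 2 * b ^ 2 * n ^ 2 * y ^ 2 + 4 * a ^ 2 * b ^ 2 * x ^ 2 + 132
    * a ^ 2 * b ^ 2 * y ^ 2 + 12 * a ^ 2 * n ^ 3 * x ^ 2 - 6 * a ^ 2 * n ^ 3 * y ^ 2 - 8 * a ^ 2
    * n * x ^ 2 + 6 * a ^ 2 * n * y ^ 2 - 8 * a * b ^ 7 * n ^ 2 * x * y + 8 * a * b ^ 7 * x * y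
    - 12 * a * b ^ 5 * n ^ 3 * x * y + 56 * a * b ^ 5 * n * x * y - 40 * a * b ^ 3 * n ^ 4 * x *
    y + 16 * a * b ^ 3 * n ^ 2 * x * y + 28 * a * b ^ 3 * x * y - 8 * a * b * n ^ 3 * x * y + 4
    * a * b * n * x * y - 8 * b ^ 8 * n ^ 2 * y ^ 2 - 4 * b ^ 6 * n ^ 3 * y ^ 2 + 24 * b ^ 6 * n
    * y ^ 2 - 4 * b ^ 4 * n ^ 4 * x ^ 2 + 4 * b ^ 4 * n ^ 4 * y ^ 2 - 4 * b ^ 4 * n ^ 2 * x ^ 2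
    + 60 * b ^ 4 * n ^ 2 * y ^ 2 - 4 * b ^ 4 * x ^ 2 + 48 * b ^ 4 * y ^ 2 - 18 * b ^ 2 * n ^ 5 *
    y ^ 2 + 10 * b ^ 2 * n ^ 3 * x ^ 2 - 10 * b ^ 2 * n ^ 3 * y ^ 2 + 18 * b ^ 2 * n * y ^ 2 + 4
    * y ^ 2) * hn + (4 * j ^ 4 * a ^ 2 * b ^ 2 * y ^ 2 + 4 * j ^ 4 * a * b ^ 3 * x * y - 8 * j ^
    3 * a ^ 4 * y ^ 2 + 40 * j ^ 3 * a ^ 3 * b * x * y - 4 * j ^ 3 * a ^ 2 * b ^ 4 * n * y ^ 2 +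
    4 * j ^ 3 * a ^ 2 * b ^ 2 * x ^ 2 + 16 * j ^ 3 * a ^ 2 * b ^ 2 * y ^ 2 + 16 * j ^ 3 * a * b
    ^ 3 * x * y + 24 * j ^ 3 * b ^ 4 * y ^ 2 + 4 * j ^ 2 * a ^ 6 * b ^ 2 * y ^ 2 + 4 * j ^ 2 * a
    ^ 4 * b ^ 4 * y ^ 2 + 4 * j ^ 2 * a ^ 4 * b ^ 2 * n * y ^ 2 + 36 * j ^ 2 * a ^ 4 * x ^ 2 + 8
    * j ^ 2 * a ^ 4 * y ^ 2 - 8 * j ^ 2 * a ^ 3 * b ^ 3 * n * x * y + 68 * j ^ 2 * a ^ 3 * b * x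
    * y + 4 * j ^ 2 * a ^ 2 * b ^ 6 * y ^ 2 + 16 * j ^ 2 * a ^ 2 * b ^ 2 * x ^ 2 + 44 * j ^ 2 *
    a ^ 2 * b ^ 2 * y ^ 2 + j ^ 2 * a ^ 2 * n * x ^ 2 - 12 * j ^ 2 * a ^ 2 * n * y ^ 2 + 32 * j
    ^ 2 * a * b ^ 3 * x * y - 12 * j ^ 2 * a * b * n * x * y + 48 * j ^ 2 * b ^ 4 * y ^ 2 - 24 *
    j ^ 2 * b ^ 2 * n * y ^ 2 + 4 * j * a ^ 8 * y ^ 2 + 12 * j * a ^ 6 * b ^ 2 * y ^ 2 + 4 * j *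
    a ^ 6 * n * y ^ 2 - 8 * j * a ^ 5 * b ^ 3 * x * y - 8 * j * a ^ 5 * b * n * x * y + 8 * j *
    a ^ 4 * b ^ 4 * x ^ 2 + 12 * j * a ^ 4 * b ^ 4 * y ^ 2 + 4 * j * a ^ 4 * b ^ 2 * n * y ^ 2 +
    4 * j * a ^ 4 * x ^ 2 + 28 * j * a ^ 4 * y ^ 2 - 8 * j * a ^ 3 * b ^ 5 * x * y + 20 * j * a
    ^ 3 * b ^ 3 * n * x * y - 12 * j * a ^ 3 * b * n ^ 2 * x * y - 20 * j * a ^ 3 * b * x * y +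
    8 * j * a ^ 2 * b ^ 6 * x ^ 2 - 4 * j * a ^ 2 * b ^ 6 * y ^ 2 + 8 * j * a ^ 2 * b ^ 4 * n *
    y ^ 2 + 4 * j * a ^ 2 * b ^ 2 * n ^ 2 * x ^ 2 + 4 * j * a ^ 2 * b ^ 2 * n ^ 2 * y ^ 2 + 20 *
    j * a ^ 2 * b ^ 2 * x ^ 2 + 160 * j * a ^ 2 * b ^ 2 * y ^ 2 - 26 * j * a ^ 2 * n ^ 3 * y ^ 2
    - 31 * j * a ^ 2 * n * x ^ 2 - 24 * j * a ^ 2 * n * y ^ 2 + 8 * j * a * b ^ 7 * x * y + 16 *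
    j * a * b ^ 5 * n * x * y - 8 * j * a * b ^ 3 * x * y + 24 * j * a * b * n ^ 3 * x * y - 36
    * j * a * b * n * x * y + 24 * j * b ^ 6 * n * y ^ 2 - 4 * j * b ^ 4 * n ^ 2 * x ^ 2 + 12 *
    j * b ^ 4 * n ^ 2 * y ^ 2 - 4 * j * b ^ 4 * x ^ 2 + 12 * j * b ^ 4 * y ^ 2 + 4 * j * b ^ 2 *
    n ^ 3 * x ^ 2 - 6 * j * b ^ 2 * n ^ 3 * y ^ 2 + 10 * j * b ^ 2 * n * x ^ 2 - 54 * j * b ^ 2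
    * n * y ^ 2 + 18 * j * n ^ 4 * y ^ 2 - 10 * j * n ^ 2 * x ^ 2 + 8 * a ^ 8 * y ^ 2 - 8 * a ^
    7 * b * x * y + 8 * a ^ 6 * b ^ 2 * x ^ 2 + 8 * a ^ 6 * b ^ 2 * y ^ 2 - 8 * a ^ 5 * b ^ 3 *
    x * y + 20 * a ^ 5 * b * n * x * y + 8 * a ^ 4 * b ^ 4 * x ^ 2 - 4 * a ^ 4 * b ^ 4 * y ^ 2 +
    4 * a ^ 4 * b ^ 2 * n * y ^ 2 - 4 * a ^ 4 * n ^ 2 * x ^ 2 - 8 * a ^ 4 * n ^ 2 * y ^ 2 + 32 *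
    a ^ 4 * x ^ 2 + 92 * a ^ 4 * y ^ 2 + 8 * a ^ 3 * b ^ 5 * x * y + 16 * a ^ 3 * b ^ 3 * n * x
    * y + 80 * a ^ 3 * b * x * y + 20 * a ^ 2 * b ^ 4 * n * y ^ 2 - 8 * a ^ 2 * b ^ 2 * n ^ 2 *
    x ^ 2 - 4 * a ^ 2 * b ^ 2 * n ^ 2 * y ^ 2 - 24 * a ^ 2 * b ^ 2 * x ^ 2 + 12 * a ^ 2 * b ^ 2
    * y ^ 2 + 4 * a ^ 2 * n ^ 3 * x ^ 2 + 5 * a ^ 2 * n * x ^ 2 - 110 * a ^ 2 * n * y ^ 2 - 4 *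
    a * b ^ 3 * n ^ 2 * x * y - 12 * a * b * n ^ 3 * x * y + 16 * a * b * n * x * y + 4 * b ^ 4
    * n ^ 2 * x ^ 2 - 12 * b ^ 4 * n ^ 2 * y ^ 2 - 6 * b ^ 2 * n ^ 3 * y ^ 2 - 6 * b ^ 2 * n * x
    ^ 2 - 12 * b ^ 2 * n * y ^ 2 + 6 * n ^ 2 * y ^ 2) * hF + (6 * j ^ 4 * b ^ 3 * n * y + 6 * j
    ^ 3 * a * b ^ 2 * n * x + 4 * j ^ 3 * b ^ 3 * n * y - 6 * j ^ 3 * b * n ^ 2 * y + 2 * j ^ 3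
    * b * y + 2 * j ^ 2 * a ^ 2 * b ^ 3 * n ^ 2 * y + 4 * j ^ 2 * a * b ^ 2 * n * x - 14 * j ^ 2
    * a * n ^ 2 * x + 16 * j ^ 2 * a * x - 6 * j ^ 2 * b ^ 3 * n * y + 16 * j ^ 2 * b * y + 2 *
    j * a ^ 4 * b * n ^ 2 * y - 2 * j * a ^ 3 * b ^ 2 * n ^ 2 * x + 4 * j * a ^ 2 * b * n ^ 3 *
    y - 2 * j * a ^ 2 * b * n * y - 10 * j * a * b ^ 2 * n ^ 3 * x - 6 * j * a * b ^ 2 * n * x +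
    14 * j * a * n ^ 2 * x - 16 * j * a * x + 6 * j * b ^ 3 * n * y - 6 * j * b * n ^ 4 * y + 2
    * j * b * n ^ 2 * y - 16 * j * b * y - 2 * a ^ 5 * n ^ 2 * x - 4 * a ^ 3 * b ^ 2 * n ^ 2 * x
    - 4 * a ^ 3 * n ^ 3 * x - 2 * a ^ 3 * n * x - 2 * a ^ 2 * b * n ^ 3 * y - 4 * a ^ 2 * b * n
    * y - 4 * a * b ^ 4 * n ^ 2 * x + 4 * a * b ^ 2 * n ^ 3 * x + 10 * a * b ^ 2 * n * x + 6 * a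
    * n ^ 4 * x - 12 * a * n ^ 2 * x + 16 * a * x - 4 * b ^ 5 * n ^ 2 * y - 2 * b ^ 3 * n ^ 3 *
    y + 2 * b * n ^ 4 * y - 2 * b * n ^ 2 * y + 18 * b * y) * hdF

/-- The special-branch curve has no singular points among the generic points. -/
lemma sbCurve_regular (h0 : j ^ 2 - j + 1 = 0) (hn : n = a ^ 2 + j * b ^ 2) (hn0 : n ≠ 0)
    (hD : j * a ^ 2 + b ^ 2 * n ^ 2 ≠ 0) (hF : sbCurve j Λ a b = 0) :
    sbCurveA j Λ a b ≠ 0 ∨ sbCurveB j Λ a b ≠ 0 := by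
  by_contra! h
  obtain ⟨ha, hb⟩ := h
  replace hF := sbCurve_reduced h0 hn hF
  rw [sbCurveA, ← hn] at ha
  rw [sbCurveB, ← hn] at hb
  -- The product (ja² + b²n²)n lies in the ideal generated by the curve polynomial, its two partial
  -- derivatives and the relations defining j and n.
  apply mul_ne_zero hD hn0
  linear_combination
    (-2 * a ^ 2 * b ^ 4 * n + 13/6 * a ^ 2 * b ^ 2 * n ^ 2 - 2/3 * a ^ 2 * b ^ 2 - 2 * b ^ 6 * n
    + 4/3 * b ^ 4 * n ^ 2 + 2/3 * b ^ 4 - 11/6 * b ^ 2 * n ^ 3) * h0 + (j * Λ * a * b * n + 1/2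
    * j * a ^ 4 * n - 7/6 * j * a ^ 2 * b ^ 2 * n + 11/6 * j * a ^ 2 * n ^ 2 - 1/3 * j * a ^ 2 -
    5/6 * j * b ^ 4 * n + 2/3 * j * b ^ 2 + 2/3 * Λ * a * b ^ 3 + 1/3 * Λ * a * b * n + 2/3 * a
    ^ 4 * b ^ 2 + 2/3 * a ^ 2 * b ^ 4 + 8/3 * a ^ 2 * b ^ 2 * n + 2/3 * b ^ 6 + 4/3 * b ^ 4 * n
    + 17/6 * b ^ 2 * n ^ 2 + 2/3 * b ^ 2) * hn + (1/3 * j * a ^ 2 + 4/3 * j * b ^ 2 - 11/6 * j *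
    n - 4/3 * b ^ 2) * hF + (-1/6 * j ^ 2 * a * b ^ 2 - 1/3 * j * a * b ^ 2 + 1/4 * j * a * n +
    1/3 * a * b ^ 2) * ha + (1/6 * j * a ^ 2 * b + 7/12 * j * b * n + 1/3 * a ^ 2 * b + 1/3 * b
    ^ 3 - 1/3 * b * n) * hb

end specialAlgebra

/-! ### The Hamiltonian of the special branch -/

section paramDeriv

variable {a b : ℂ → ℂ} {x y z : ℂ}

lemma hasDerivAt_sbN (j : ℂ) (ha : HasDerivAt a x z) (hb : HasDerivAt b y z) :
    HasDerivAt (fun z => sbN j (a z) (b z)) (dN j (a z) (b z) x y) z :=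
  ((ha.fun_pow 2).add ((hb.fun_pow 2).const_mul j)).congr_deriv (by rw [dN]; norm_num; ring)

lemma hasDerivAt_sbCurve (j Λ : ℂ) (ha : HasDerivAt a x z) (hb : HasDerivAt b y z) :
    HasDerivAt (fun z => sbCurve j Λ (a z) (b z))
      (sbCurveA j Λ (a z) (b z) * x + sbCurveB j Λ (a z) (b z) * y) z := by
  refine ((((hasDerivAt_sbN j ha hb).mul ((hasDerivAt_quartic ha hb).add
    ((ha.const_mul Λ).mul hb))).add (hb.fun_pow 2)).sub (ha.fun_pow 2)).congr_deriv ?_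
  simp only [sbCurveA, sbCurveB, dN, sbN, Pi.mul_apply, Pi.add_apply]
  norm_num
  ring

lemma deriv_sbCurve_fst (j Λ a b : ℂ) :
    deriv (fun x => sbCurve j Λ x b) a = sbCurveA j Λ a b := by
  have h := hasDerivAt_sbCurve j Λ (hasDerivAt_id a) (hasDerivAt_const a b)
  simpa using h.deriv

lemma deriv_sbCurve_snd (j Λ a b : ℂ) :
    deriv (fun y => sbCurve j Λ a y) b = sbCurveB j Λ a b := by
  have h := hasDerivAt_sbCurve j Λ (hasDerivAt_const b a) (hasDerivAt_id b)
  simpa using h.deriv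

open scoped ContDiff in
lemma contDiff_sbCurve (j Λ : ℂ) :
    ContDiff ℂ ω (fun p : ℂ × ℂ => sbCurve j Λ p.1 p.2) := by
  unfold sbCurve
  fun_prop

end paramDeriv

/-- Derivative of the special-branch weights on the diagonal along the tangent vector `(x, y)`. -/
def sbDerivWeights (j a b x y : ℂ) : Weights :=
  let n := sbN j a b
  let A := dN j a b x y * (a ^ 2 - j * b ^ 2) / (2 * n ^ 2)
  let κ := j * sbU j a b n x y / (j * a ^ 2 + b ^ 2 * n ^ 2)
  let ξ := κ * (a * b * (n ^ 2 - j ^ 2) / n ^ 2)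
  { a := A
    b := sbS j a b n x y / n ^ 2
    b' := j * sbU j a b n x y / n ^ 2
    c := 0
    d := κ
    d' := j * κ
    f := ξ
    g := -ξ - A
    h := A + j⁻¹ * ξ
    h' := A + j * ξ }

lemma hasWeightDerivAt_sbR {j x y z₀ : ℂ} {a b : ℂ → ℂ} (ha : HasDerivAt a x z₀)
    (hb : HasDerivAt b y z₀) (hgen : SBGeneric j (a z₀) (b z₀)) :
    HasWeightDerivAt (fun z => sbR j (a z) (b z) (a z₀) (b z₀))
      (sbDerivWeights j (a z₀) (b z₀) x y) z₀ := by
  obtain ⟨hn0, hD0⟩ := hgen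
  have hn := hasDerivAt_sbN j ha hb
  obtain ⟨n, en⟩ : ∃ n, n = sbN j (a z₀) (b z₀) := ⟨_, rfl⟩
  have en' : n = a z₀ ^ 2 + j * b z₀ ^ 2 := en
  rw [← en] at hn0 hD0
  obtain ⟨n', en''⟩ : ∃ n', n' = dN j (a z₀) (b z₀) x y := ⟨_, rfl⟩
  have e2 : n' = 2 * (a z₀ * x + j * b z₀ * y) := by rw [en'', dN]; ring
  have hn2 : (2 : ℂ) * n ^ 2 ≠ 0 := mul_ne_zero two_ne_zero (pow_ne_zero _ hn0)
  have hA : HasDerivAt (fun z => sbA j (a z) (b z) (a z₀) (b z₀))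
      (sbDerivWeights j (a z₀) (b z₀) x y).a z₀ := by
    refine (((ha.mul_const (a z₀)).div_const _).add
      ((((hb.const_mul j).mul_const (b z₀))).div hn (by rwa [← en]))).congr_deriv ?_
    simp only [sbDerivWeights, ← en, ← en'']
    field_simp
    linear_combination -n * e2 + n' * en'
  -- The opposite sign reflects that `sbA` is constantly 1 on the diagonal. With the antisymmetry of
  -- `sbD`, this determines the derivative of the weight g, which has its arguments interchanged.
  have hA' : HasDerivAt (fun z => sbA j (a z₀) (b z₀) (a z) (b z))
      (-(sbDerivWeights j (a z₀) (b z₀) x y).a) z₀ := by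
    refine (((ha.const_mul (a z₀)).div hn (by rwa [← en])).add
      ((hb.const_mul (j * b z₀)).div_const _)).congr_deriv ?_
    simp only [sbDerivWeights, ← en, ← en'']
    field_simp
    linear_combination -n * e2 + n' * en'
  have hden : j * a z₀ * a z₀ + b z₀ * b z₀ * n * n ≠ 0 := by
    convert hD0 using 1; ring
  have hd : HasDerivAt (fun z => sbD j (a z) (b z) (a z₀) (b z₀))
      (sbDerivWeights j (a z₀) (b z₀) x y).d z₀ := by
    refine (((((hb.mul_const (a z₀)).mul_const (sbN j (a z₀) (b z₀))).sub
      ((ha.mul_const (b z₀)).mul hn)).div (((ha.const_mul j).mul_const (a z₀)).add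
      (((hb.mul_const (b z₀)).mul hn).mul_const (sbN j (a z₀) (b z₀))))
      (by simpa only [Pi.add_apply, Pi.mul_apply, ← en] using hden)).const_mul j).congr_deriv ?_
    simp only [sbDerivWeights, sbU, Pi.add_apply, Pi.sub_apply, Pi.mul_apply, ← en, ← en'']
    rw [show b z₀ * a z₀ * n - a z₀ * b z₀ * n = 0 by ring, zero_mul, sub_zero, sq,
      mul_div_mul_right _ _ hden, mul_div_assoc]
    congr 2 <;> ring
  have hd' : HasDerivAt (fun z => sbD j (a z₀) (b z₀) (a z) (b z))
      (-(sbDerivWeights j (a z₀) (b z₀) x y).d) z₀ := by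
    refine hd.neg.congr_of_eventuallyEq (Filter.Eventually.of_forall fun z => ?_)
    simp only [sbD, Pi.neg_apply]
    rw [← mul_neg, ← neg_div]
    congr 2 <;> ring
  -- Because `sbD` vanishes on the diagonal, the second factor of `sbF` need not be differentiated.
  have hz : sbD j (a z₀) (b z₀) (a z₀) (b z₀) = 0 := by
    have h : b z₀ * a z₀ * sbN j (a z₀) (b z₀) - a z₀ * b z₀ * sbN j (a z₀) (b z₀) = 0 := by ring
    rw [sbD, h, zero_div, mul_zero]
  have hf : HasDerivAt (fun z => sbF j (a z) (b z) (a z₀) (b z₀))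
      (sbDerivWeights j (a z₀) (b z₀) x y).f z₀ := by
    refine (hd.mul (((((hb.mul_const (a z₀)).mul hn).mul_const (sbN j (a z₀) (b z₀))).sub
      ((ha.const_mul (j ^ 2)).mul_const (b z₀))).div (hn.mul_const (sbN j (a z₀) (b z₀)))
      (by rw [← en]; exact mul_ne_zero hn0 hn0))).congr_deriv ?_
    rw [hz, zero_mul, add_zero]
    simp only [sbDerivWeights, Pi.div_apply, Pi.sub_apply, Pi.mul_apply, ← en]
    congr 2 <;> ring
  have hf' : HasDerivAt (fun z => sbF j (a z₀) (b z₀) (a z) (b z))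
      (-(sbDerivWeights j (a z₀) (b z₀) x y).f) z₀ := by
    refine (hd'.mul ((((ha.const_mul (b z₀)).mul_const (sbN j (a z₀) (b z₀))).mul hn |>.sub
      (hb.const_mul (j ^ 2 * a z₀))).div (hn.const_mul (sbN j (a z₀) (b z₀)))
      (by rw [← en]; exact mul_ne_zero hn0 hn0))).congr_deriv ?_
    rw [hz, zero_mul, add_zero]
    simp only [sbDerivWeights, Pi.div_apply, Pi.sub_apply, Pi.mul_apply, ← en]
    rw [neg_mul]
    congr 3 <;> ring
  refine ⟨hA, ?_, ?_, hasDerivAt_const _ _, hd, hd.const_mul _, hf,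
    (hf'.add hA').congr_deriv (by simp only [sbDerivWeights]; ring),
    hA.add (hf.const_mul _), hA.add (hf.const_mul _)⟩
  · refine (((hb.mul_const (a z₀)).div_const _).sub
      ((ha.mul_const (b z₀)).div hn (by rwa [← en]))).congr_deriv ?_
    simp only [sbDerivWeights, sbS, ← en, ← en'']
    field_simp
    ring
  · refine ((((hb.const_mul j).mul_const (a z₀)).div hn (by rwa [← en])).sub
      (((ha.const_mul j).mul_const (b z₀)).div_const _)).congr_deriv ?_
    simp only [sbDerivWeights, sbU, ← en, ← en'']
    field_simp
    ring

lemma sbR_self {j a b : ℂ} (hn : sbN j a b ≠ 0) : sbR j a b a b = permWeights := by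
  have hA : sbA j a b a b = 1 := by
    rw [sbA, ← add_div, div_eq_one_iff_eq hn, sbN]; ring
  have hD : sbD j a b a b = 0 := by
    rw [sbD, show b * a * sbN j a b - a * b * sbN j a b = 0 by ring, zero_div, mul_zero]
  have hF : sbF j a b a b = 0 := by rw [sbF, hD, zero_mul]
  rw [sbR, hA, hD, hF, permWeights]
  congr 1 <;> ring

lemma sbDerivWeights_barievRel {j Λ a b x y : ℂ} (h0 : j ^ 2 - j + 1 = 0)
    (hgen : SBGeneric j a b) (hF : sbCurve j Λ a b = 0)
    (hdF : sbCurveA j Λ a b * x + sbCurveB j Λ a b * y = 0) :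
    BarievRel j (sbDerivWeights j a b x y) := by
  obtain ⟨hn0, hD0⟩ := hgen
  have hψ := sb_psi_identity h0 (n := sbN j a b) rfl hF hdF
  have hq := sb_quadric_identity h0 (n := sbN j a b) rfl hn0 hF hdF
  refine ⟨rfl, rfl, rfl, rfl, by simp only [sbDerivWeights]; ring, ?_, ?_⟩ <;>
    simp only [sbDerivWeights] <;> generalize sbN j a b = n at * <;>
    generalize sbU j a b n x y = u at * <;> generalize sbS j a b n x y = s at * <;>
    generalize dN j a b x y = m at *
  · field_simp
    linear_combination j * u * hψ
  · field_simp
    linear_combination 2 * hq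

lemma sb_generic {J j Λ : ℂ} (hj : j ^ 2 - j + 1 = 0) (hJ : J = j ^ 2) {a b : ℂ → ℂ} {z₀ : ℂ}
    (hp : LocalParam (sbCurve j Λ) a b z₀) (hgen : SBGeneric j (a z₀) (b z₀)) :
    braided (sbR j (a z₀) (b z₀) (a z₀) (b z₀)) = 1 ∧
      ∃ H : TwoSite, SBDeriv j a b z₀ H ∧ (NonzeroEntries H → TwistsToHGB J H) := by
  have ht := hp.tangent (contDiff_sbCurve j Λ)
  rw [deriv_sbCurve_fst, deriv_sbCurve_snd] at ht
  refine ⟨by rw [sbR_self hgen.1, braided_permWeights], _,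
    (hasWeightDerivAt_sbR hp.1.differentiableAt.hasDerivAt hp.2.1.differentiableAt.hasDerivAt
      hgen).braided, (sbDerivWeights_barievRel hj hgen hp.2.2.self_of_nhds ht).twistsToHGB hj hJ⟩

/-! ### Prescribing the special-branch Hamiltonian -/

/-- If `sbU` vanished, `sb_psi_identity` would make `sbS` vanish too. Their sum and difference then
give ya = xb and ax + jby = 0, a linear system of determinant ±n, which forces x = y = 0. The lemma
allows φ to be scaled to any prescribed value. -/
lemma sbU_ne_zero {j Λ a b x y : ℂ} (h0 : j ^ 2 - j + 1 = 0) (hgen : SBGeneric j a b)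
    (ha : a ≠ 0) (hb : b ≠ 0) (hF : sbCurve j Λ a b = 0)
    (hdF : sbCurveA j Λ a b * x + sbCurveB j Λ a b * y = 0) (hxy : x ≠ 0 ∨ y ≠ 0) :
    sbU j a b (sbN j a b) x y ≠ 0 := by
  obtain ⟨hn0, hD0⟩ := hgen
  intro hu
  have hs := sb_psi_identity h0 (n := sbN j a b) rfl hF hdF
  rw [hu, mul_zero, mul_zero, add_zero, eq_comm, mul_eq_zero_iff_right (pow_ne_zero 2 hD0)] at hs
  rw [sbU] at hu
  rw [sbS] at hs
  have hw : y * a - x * b = 0 := by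
    apply mul_right_cancel₀ hn0; linear_combination (hu + hs) / 2
  have hm : dN j a b x y = 0 := by
    apply mul_left_cancel₀ (mul_ne_zero ha hb); linear_combination (hs - hu) / 2
  rw [dN] at hm
  rcases hxy with h | h <;> apply h <;> apply mul_right_cancel₀ hn0 <;> rw [sbN]
  · linear_combination a / 2 * hm - j * b * hw
  · linear_combination b / 2 * hm + a * hw

/-- The generalized Bariev Hamiltonian as a special-branch Hamiltonian at a generic point. -/
lemma exists_sbDeriv {J j φ ψ ξ : ℂ} (hj : j ^ 2 - j + 1 = 0) (hJ : J = j ^ 2) (hφ : φ ≠ 0)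
    (hξ : ξ ≠ 0) (hne : ψ * φ ≠ ξ ^ 2) (hdisc : (ψ - j * φ) ^ 2 + 4 * j * ξ ^ 2 ≠ 0) :
    ∃ (Λ₄ s : ℂ) (a b : ℂ → ℂ) (z₀ : ℂ) (H : TwoSite), s ≠ 0 ∧
      LocalParam (sbCurve j Λ₄) a b z₀ ∧ SBGeneric j (a z₀) (b z₀) ∧ SBDeriv j a b z₀ H ∧
      twist s H = HGB J φ ψ ξ := by
  have hj0 : j ≠ 0 := by rintro rfl; norm_num at hj
  obtain ⟨X, hX⟩ : ∃ X, X = ξ / φ := ⟨_, rfl⟩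
  obtain ⟨Y, hY⟩ : ∃ Y, Y = ψ / φ := ⟨_, rfl⟩
  have hXφ : φ * X = ξ := by rw [hX]; field_simp
  have hYφ : φ * Y = ψ := by rw [hY]; field_simp
  have hX0 : X ≠ 0 := by rintro rfl; apply hξ; rw [← hXφ]; ring
  -- k is the desired ratio κ/φ, prescribed by j κ² = φψ - ξ².
  obtain ⟨k, hk⟩ := IsAlgClosed.exists_pow_nat_eq ((Y - X ^ 2) / j) (n := 2) (by norm_num)
  replace hk : j * k ^ 2 = Y - X ^ 2 := by rw [hk]; field_simp
  have hk0 : k ≠ 0 := by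
    rintro rfl
    apply hne; rw [← hXφ, ← hYφ]; linear_combination -φ ^ 2 * hk
  -- N is the value of n at the point sought. The equations n = N and k(ja² + b²N²) = N² are linear
  -- in a², b²; comparing a²b² with the value of (ab)² required by ξ/φ = X gives kN² - (j + Y)N +
  -- j²k = 0, with discriminant r².
  obtain ⟨r, hr⟩ := IsAlgClosed.exists_pow_nat_eq ((j + Y) ^ 2 - 4 * j ^ 2 * k ^ 2) (n := 2)
    (by norm_num)
  obtain ⟨N, hN⟩ : ∃ N, N = (j + Y + r) / (2 * k) := ⟨_, rfl⟩
  replace hN : k * N ^ 2 - (j + Y) * N + j ^ 2 * k = 0 := by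
    rw [hN]; field_simp; linear_combination hr
  have hN0 : N ≠ 0 := by
    rintro rfl
    apply mul_ne_zero (pow_ne_zero 2 hj0) hk0
    linear_combination hN
  have hXN : X ^ 2 * N = (N - j * k) * (k * N - j) := by
    linear_combination -hN + N * hk
  have hNk : N - j * k ≠ 0 := by
    intro h
    rw [h, zero_mul] at hXN
    exact mul_ne_zero (pow_ne_zero 2 hX0) hN0 hXN
  -- The two roots have product j², so N² = j² would mean a double root. The discriminant is (Y -
  -- j)² + 4jX², nonzero by `hdisc`.
  have hNj : N ^ 2 - j ^ 2 ≠ 0 := by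
    intro h
    apply hdisc
    rw [← hXφ, ← hYφ]
    apply mul_left_cancel₀ (pow_ne_zero 2 hj0)
    linear_combination -φ ^ 2 * ((j + Y) * N + 2 * j ^ 2 * k) * hN
      + φ ^ 2 * (k * ((j + Y) * N + 2 * j ^ 2 * k) - (j + Y) ^ 2) * h + 4 * φ ^ 2 * j ^ 3 * hk
  obtain ⟨b, hb⟩ := IsAlgClosed.exists_pow_nat_eq (N * (N - j * k) / (k * (N ^ 2 - j ^ 2)))
    (n := 2) (by norm_num)
  have hb0 : b ≠ 0 := by
    rintro rfl
    exact div_ne_zero (mul_ne_zero hN0 hNk) (mul_ne_zero hk0 hNj) (by rw [← hb]; ring)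
  replace hb : k * b ^ 2 * (N ^ 2 - j ^ 2) = N * (N - j * k) := by rw [hb]; field_simp
  -- Only b is taken as a square root. Defining a through the product ab fixes its sign, so that ξ/φ
  -- is X and not -X.
  obtain ⟨a, ha⟩ : ∃ a, a = X * N ^ 2 / (k * b * (N ^ 2 - j ^ 2)) := ⟨_, rfl⟩
  replace ha : k * a * b * (N ^ 2 - j ^ 2) = X * N ^ 2 := by rw [ha]; field_simp
  have ha0 : a ≠ 0 := by
    rintro rfl
    exact mul_ne_zero hX0 (pow_ne_zero 2 hN0) (by rw [← ha]; ring)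
  have ha2 : k * a ^ 2 * (N ^ 2 - j ^ 2) = N ^ 2 * (k * N - j) := by
    apply mul_left_cancel₀ (mul_ne_zero hN0 hNk)
    linear_combination (k * a * b * (N ^ 2 - j ^ 2) + X * N ^ 2) * ha
      - k * a ^ 2 * (N ^ 2 - j ^ 2) * hb + N ^ 3 * hXN
  have hn : N = sbN j a b := by
    rw [sbN]
    apply mul_left_cancel₀ (mul_ne_zero hk0 hNj)
    linear_combination -ha2 - j * hb
  have hD : k * (j * a ^ 2 + b ^ 2 * N ^ 2) = N ^ 2 := by
    apply mul_left_cancel₀ hNj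
    linear_combination j * ha2 + N ^ 2 * hb
  have hD0 : j * a ^ 2 + b ^ 2 * N ^ 2 ≠ 0 := by
    intro h
    rw [h, mul_zero] at hD
    exact pow_ne_zero 2 hN0 hD.symm
  have hgen : SBGeneric j a b := by rw [SBGeneric, ← hn]; exact ⟨hN0, hD0⟩
  -- The curve equation is linear in Λ₄ with coefficient nab ≠ 0, so some special-branch curve
  -- passes through the point found.
  obtain ⟨Λ, hΛ⟩ : ∃ Λ, Λ = (a ^ 2 - b ^ 2 - N * (a ^ 4 + a ^ 2 * b ^ 2 + b ^ 4)) / (N * a * b) :=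
    ⟨_, rfl⟩
  have hF : sbCurve j Λ a b = 0 := by
    rw [sbN] at hn
    rw [sbCurve, ← hn, hΛ]; field_simp; ring
  have hreg := sbCurve_regular hj hn hN0 hD0 hF
  obtain ⟨A, hA⟩ : ∃ A, A = sbCurveA j Λ a b := ⟨_, rfl⟩
  obtain ⟨B, hB⟩ : ∃ B, B = sbCurveB j Λ a b := ⟨_, rfl⟩
  have hu := sbU_ne_zero (x := B) (y := -A) hj hgen ha0 hb0 hF (by rw [← hA, ← hB]; ring)
    (by rw [← hA, ← hB] at hreg; simpa [or_comm] using hreg)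
  rw [← hn] at hu
  -- (B, -A) is tangent to the curve, A and B being the partial derivatives; t rescales it so that
  -- the entry b' becomes φ.
  obtain ⟨t, ht⟩ : ∃ t, t = φ * N ^ 2 / (j * sbU j a b N B (-A)) := ⟨_, rfl⟩
  have hut : j * sbU j a b N (t * B) (t * -A) = φ * N ^ 2 := by
    have : sbU j a b N (t * B) (t * -A) = t * sbU j a b N B (-A) := by
      simp only [sbU, dN]; ring
    rw [this, ht]; field_simp
  have htan : sbCurveA j Λ a b * (t * B) + sbCurveB j Λ a b * (t * -A) = 0 := by
    rw [← hA, ← hB]; ring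
  obtain ⟨a₁, b₁, hp, ea, eb, da, db⟩ := exists_localParam (contDiff_sbCurve j Λ) hF
    (by rwa [RegularPoint, deriv_sbCurve_fst, deriv_sbCurve_snd])
    (by rwa [deriv_sbCurve_fst, deriv_sbCurve_snd])
  have hw := hasWeightDerivAt_sbR da db (by rwa [ea, eb])
  have hrel := sbDerivWeights_barievRel hj hgen hF htan
  have k1 : (sbDerivWeights j a b (t * B) (t * -A)).b' = φ := by
    simp only [sbDerivWeights]
    rw [← hn, hut]; field_simp
  have kd : (sbDerivWeights j a b (t * B) (t * -A)).d = φ * k := by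
    simp only [sbDerivWeights]
    rw [← hn, hut, div_eq_iff hD0]; linear_combination -φ * hD
  have k3 : (sbDerivWeights j a b (t * B) (t * -A)).f = ξ := by
    have : (sbDerivWeights j a b (t * B) (t * -A)).f =
        (sbDerivWeights j a b (t * B) (t * -A)).d * (a * b * (N ^ 2 - j ^ 2) / N ^ 2) := by
      rw [hn]; rfl
    rw [this, kd, ← hXφ]
    field_simp
    linear_combination ha
  -- With b', d and f known, the relation j d² = b'b - f² determines b, so `sbS` need not be
  -- evaluated.
  have k2 : (sbDerivWeights j a b (t * B) (t * -A)).b = ψ := by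
    have := hrel.dd
    rw [k1, kd, k3, ← hXφ] at this
    apply mul_left_cancel₀ hφ
    rw [← hYφ]
    linear_combination -this + φ ^ 2 * hk
  obtain ⟨s, hs, hst⟩ := hrel.exists_twist hj hJ k1 k2 k3 hφ hξ hne
  refine ⟨Λ, s, a₁, b₁, 0, _, hs, hp, by rwa [ea, eb], hw.braided, ?_⟩
  rw [ea, eb]
  exact hst

end Bariev

end

/-! ### Assembly of the theorem -/

theorem mainTheorem3 (J J₀ : ℂ) (hJ : J ^ 2 + J + 1 = 0) (hJ₀ : J * J₀ ^ 2 = -1) :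
    -- the main-branch Lax operator is the `R`-matrix with second argument at the special point
    (∀ α β η a b : ℂ, β ≠ 0 → a ≠ 0 → Bariev.mbB α β a b ≠ 0 →
      Bariev.mbR J₀ α β η a b 1 0 = Bariev.mbLax J₀ α β η a b) ∧
    -- the Hamiltonian of the main branch at the special point
    (∀ (α β η v : ℂ) (H : Bariev.TwoSite), β ≠ 0 → α ^ 2 - α * β + β ^ 2 ≠ 0 →
      J₀ ^ 2 * η ^ 2 = α * β - 1 →
      (Bariev.MBSpecialHam J₀ α β η v H ↔ H = v • Bariev.HMB0 J₀ α β η)) ∧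
    -- its relation with the generalized Bariev Hamiltonian
    (∀ φ ψ ξ α β η s : ℂ, φ ≠ 0 → ξ ≠ 0 → φ ^ 2 - φ * ψ + ψ ^ 2 ≠ 0 → ψ * φ ≠ ξ ^ 2 →
      α = -ψ / ξ → β = -φ / ξ → J₀ ^ 2 * η ^ 2 = α * β - 1 → s ^ 2 = J₀ ^ 2 * η / β →
      Bariev.HGB J φ ψ ξ =
        Bariev.twist s ((-Bariev.upsilon φ ψ ξ) • Bariev.HMB0 J₀ α β η)) ∧
    -- the Hamiltonian of the main branch at a generic point
    (∀ (α β η : ℂ) (a b : ℂ → ℂ) (z₀ : ℂ), β ≠ 0 → J₀ ^ 2 * η ^ 2 = α * β - 1 →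
      Bariev.LocalParam (Bariev.mbCurve α β) a b z₀ →
      Bariev.MBGeneric J₀ α β η (a z₀) (b z₀) →
      Bariev.braided (Bariev.mbR J₀ α β η (a z₀) (b z₀) (a z₀) (b z₀)) = 1 ∧
      ∃ H : Bariev.TwoSite, Bariev.MBDeriv J₀ α β η a b z₀ H ∧
        (Bariev.NonzeroEntries H → Bariev.TwistsToHGB J H)) ∧
    -- the Hamiltonian of the special branch at a generic point
    (∀ (Λ₄ : ℂ) (a b : ℂ → ℂ) (z₀ : ℂ),
      Bariev.LocalParam (Bariev.sbCurve (J₀ ^ 2) Λ₄) a b z₀ →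
      Bariev.SBGeneric (J₀ ^ 2) (a z₀) (b z₀) →
      Bariev.braided (Bariev.sbR (J₀ ^ 2) (a z₀) (b z₀) (a z₀) (b z₀)) = 1 ∧
      ∃ H : Bariev.TwoSite, Bariev.SBDeriv (J₀ ^ 2) a b z₀ H ∧
        (Bariev.NonzeroEntries H → Bariev.TwistsToHGB J H)) ∧
    -- the same Hamiltonian, for generic parameters, is obtained in the three ways
    (∀ φ ψ ξ : ℂ, φ ≠ 0 → ψ ≠ 0 → ξ ≠ 0 → φ ≠ ψ → φ ^ 2 - φ * ψ + ψ ^ 2 ≠ 0 →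
      ψ * φ ≠ ξ ^ 2 → (ψ - J₀ ^ 2 * φ) ^ 2 + 4 * J₀ ^ 2 * ξ ^ 2 ≠ 0 →
      (∃ (α β η v s : ℂ) (H : Bariev.TwoSite), β ≠ 0 ∧ J₀ ^ 2 * η ^ 2 = α * β - 1 ∧ s ≠ 0 ∧
        Bariev.MBSpecialHam J₀ α β η v H ∧
        Bariev.twist s H = Bariev.HGB J φ ψ ξ) ∧
      (∃ (α β η s : ℂ) (a b : ℂ → ℂ) (z₀ : ℂ) (H : Bariev.TwoSite), β ≠ 0 ∧
        J₀ ^ 2 * η ^ 2 = α * β - 1 ∧ s ≠ 0 ∧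
        Bariev.LocalParam (Bariev.mbCurve α β) a b z₀ ∧
        Bariev.MBGeneric J₀ α β η (a z₀) (b z₀) ∧ Bariev.MBDeriv J₀ α β η a b z₀ H ∧
        Bariev.twist s H = Bariev.HGB J φ ψ ξ) ∧
      (∃ (Λ₄ s : ℂ) (a b : ℂ → ℂ) (z₀ : ℂ) (H : Bariev.TwoSite), s ≠ 0 ∧
        Bariev.LocalParam (Bariev.sbCurve (J₀ ^ 2) Λ₄) a b z₀ ∧
        Bariev.SBGeneric (J₀ ^ 2) (a z₀) (b z₀) ∧ Bariev.SBDeriv (J₀ ^ 2) a b z₀ H ∧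
        Bariev.twist s H = Bariev.HGB J φ ψ ξ)) := by
  -- With j = J₀² the hypotheses on J and J₀ become j² - j + 1 = 0 and J = j², the form used in the
  -- lemmas.
  have hJj : J = J₀ ^ 2 - 1 := by
    linear_combination -J₀ ^ 2 * hJ + (J + 1) * hJ₀
  have hj : (J₀ ^ 2) ^ 2 - J₀ ^ 2 + 1 = 0 := by
    rw [hJj] at hJ; linear_combination hJ
  have hJ' : J = (J₀ ^ 2) ^ 2 := by linear_combination hJj - hj
  exact ⟨fun _ _ _ _ _ _ ha hB => Bariev.mbR_special_right ha hB,
    fun _ _ _ _ _ hβ hn _ => Bariev.mbSpecialHam_iff hβ hn,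
    fun _ _ _ _ _ _ _ hφ hξ hn hne hα hβ hη hs =>
      Bariev.HGB_eq_twist_HMB0 hj hJ' hφ hξ hn hne hα hβ hη hs,
    fun _ _ _ _ _ _ hβ hη hp hgen => Bariev.mb_generic hj hJ' hβ hη hp hgen,
    fun _ _ _ _ hp hgen => Bariev.sb_generic hj hJ' hp hgen,
    fun _ _ _ hφ hψ hξ hφψ hn hne hdisc =>
      ⟨Bariev.exists_mbSpecialHam hj hJ' hφ hξ hn hne,
        Bariev.exists_mbDeriv hj hJ' hφ hψ hξ hφψ hne,
        Bariev.exists_sbDeriv hj hJ' hφ hξ hne hdisc⟩⟩
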